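/- Let $(W_t)_{t\ge 0}$ be a standard Wiener process, and for $t>0$ let $M_t=\sup_{0\le s\le t}W_s$ and $m_t=\inf_{0\le s\le t}W_s$. A copula of a random vector $(X_1,\dots,X_n)$ is a function $C:[0,1]^n\to[0,1]$ that vanishes when some coordinate is $0$, satisfies $C(u)=u_j$ when all coordinates other than the $j$-th are $1$, has nonnegative $C$-volume on every rectangle, and satisfies $\mathbb P(X_1\le x_1,\dots,X_n\le x_n)=C\big(\mathbb P(X_1\le x_1),\dots,\mathbb P(X_n\le x_n)\big)$ for all real $x_1,\dots,x_n$. The triples $(W_t,M_t,m_t)$, $t>0$, have a common copula $C_{W,M,m}$, which does not depend on $t$. Let $C_{W,M}(u,v)=C_{W,M,m}(u,v,1)$, $C_{W,m}(u,w)=C_{W,M,m}(u,1,w)$ and $C_{M,m}(v,w)=C_{W,M,m}(1,v,w)$ be its bivariate marginal copulas, and for a bivariate copula $C$ let \[ \rho(C)=12\int_0^1\!\!\int_0^1 C(u,v)\,du\,dv-3 \] be its Spearman rho. Then \[ \rho(C_{W,M})=\rho(C_{W,m})=2-\frac6\pi\arccos\Big(\frac{\sqrt6}{3}\Big)\approx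 0.8245, \] \[ \rho(C_{M,m})=\frac{24}{\pi}\sum_{n=0}^\infty(-1)^n\bigg(\arccos\frac{n}{\sqrt{2(n(n+1)+1)}}+\arccos\frac{n+1}{\sqrt{2(n(n+1)+1)}}-\arccos\frac{n+1}{\sqrt{2((n+1)(n+2)+1)}}-\arccos\frac{n+2}{\sqrt{2((n+1)(n+2)+1)}}\bigg)-3\approx 0.80649, \] where the series converges absolutely and the approximate values are correct to all the digits shown, by rounding (errors less than $5\cdot10^{-5}$ and $5\cdot10^{-6}$ respectively). -/

import Mathlib

open MeasureTheory ProbabilityTheory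
open scoped NNReal

noncomputable section

/-- The running maximum `M_t = sup {W_s : 0 ≤ s ≤ t}` of a process `W`. -/
def runningMax {Ω : Type*} (W : ℝ≥0 → Ω → ℝ) (t : ℝ≥0) (ω : Ω) : ℝ :=
  sSup ((fun s => W s ω) '' Set.Icc 0 t)

/-- The running minimum `m_t = inf {W_s : 0 ≤ s ≤ t}` of a process `W`. -/
def runningMin {Ω : Type*} (W : ℝ≥0 → Ω → ℝ) (t : ℝ≥0) (ω : Ω) : ℝ :=
  sInf ((fun s => W s ω) '' Set.Icc 0 t)

/-- The random triple `(W_t, M_t, m_t)`. -/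
def wienerTriple {Ω : Type*} (W : ℝ≥0 → Ω → ℝ) (t : ℝ≥0) : Fin 3 → Ω → ℝ :=
  ![W t, runningMax W t, runningMin W t]

/-- `C` is an `n`-copula: on the unit cube it has values in `[0,1]`, is grounded, has uniform
margins, and gives every rectangle with lower vertex `u` and upper vertex `v` a nonnegative
`C`-volume, the signed sum of the values of `C` at the vertices. Only the values of `C` on the
unit cube matter. -/
structure IsCopula {n : ℕ} (C : (Fin n → ℝ) → ℝ) : Prop where
  mem_unit : ∀ u ∈ Set.Icc (0 : Fin n → ℝ) 1, C u ∈ Set.Icc (0 : ℝ) 1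
  grounded : ∀ u ∈ Set.Icc (0 : Fin n → ℝ) 1, (∃ i, u i = 0) → C u = 0
  margin : ∀ u ∈ Set.Icc (0 : Fin n → ℝ) 1, ∀ j, (∀ i, i ≠ j → u i = 1) → C u = u j
  volume_nonneg : ∀ u ∈ Set.Icc (0 : Fin n → ℝ) 1, ∀ v ∈ Set.Icc (0 : Fin n → ℝ) 1, u ≤ v →
    0 ≤ ∑ S : Finset (Fin n), (-1 : ℝ) ^ S.card * C (fun i => if i ∈ S then u i else v i)

/-- `C` is a copula of the random vector `X = (X_1, …, X_n)`: the joint distribution function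
is the composition of `C` with the marginal distribution functions. -/
def IsCopulaOf {Ω : Type*} [MeasurableSpace Ω] {n : ℕ} (C : (Fin n → ℝ) → ℝ)
    (X : Fin n → Ω → ℝ) (P : Measure Ω) : Prop :=
  IsCopula C ∧ ∀ x : Fin n → ℝ,
    P.real {ω | ∀ i, X i ω ≤ x i} = C (fun i => P.real {ω | X i ω ≤ x i})

/-- Spearman's rho of a bivariate copula, `ρ(C) = 12 ∫₀¹ ∫₀¹ C(u,v) du dv - 3`. -/
def spearmanRho (C : (Fin 2 → ℝ) → ℝ) : ℝ :=
  12 * (∫ v in (0 : ℝ)..1, ∫ u in (0 : ℝ)..1, C ![u, v]) - 3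

/-- The marginal `C(u, v, 1)` of a trivariate copula; for `(W, M, m)` it is `C_{W,M}`. -/
def marginWM (C : (Fin 3 → ℝ) → ℝ) : (Fin 2 → ℝ) → ℝ := fun p => C ![p 0, p 1, 1]

/-- The marginal `C(u, 1, w)` of a trivariate copula; for `(W, M, m)` it is `C_{W,m}`. -/
def marginWm (C : (Fin 3 → ℝ) → ℝ) : (Fin 2 → ℝ) → ℝ := fun p => C ![p 0, 1, p 1]

/-- The marginal `C(1, v, w)` of a trivariate copula; for `(W, M, m)` it is `C_{M,m}`. -/
def marginMm (C : (Fin 3 → ℝ) → ℝ) : (Fin 2 → ℝ) → ℝ := fun p => C ![1, p 0, p 1]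

/-- The `n`-th bracket of `arccos` terms in the series for the max–min pair. -/
def arccosBracket (n : ℕ) : ℝ :=
  Real.arccos ((n : ℝ) / √(2 * ((n : ℝ) * (n + 1) + 1)))
    + Real.arccos (((n : ℝ) + 1) / √(2 * ((n : ℝ) * (n + 1) + 1)))
    - Real.arccos (((n : ℝ) + 1) / √(2 * (((n : ℝ) + 1) * (n + 2) + 1)))
    - Real.arccos (((n : ℝ) + 2) / √(2 * (((n : ℝ) + 1) * (n + 2) + 1)))

end

/-! Brownian scaling, and the invariance of copulas under a common positive factor, reduce the claim
to time 1 and to a version of the process with measurable coordinates and continuous paths. A copula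
exists because the three marginal laws have no atoms. With Φ the normal distribution function and γ
the standard normal law, the substitutions u = Φ(x), v = P(M ≤ y) = 2Φ(y) − 1 and w = P(m ≤ −x) = 1
− P(M ≤ x) turn the Spearman integrals into Gaussian integrals of joint distribution functions. They
cover the open unit square, so the value holds for every copula of the triple and no uniqueness
statement is needed.

The joint laws come from the reflection principle, used as a method of images
(`IsRegularBrownian.setIntegral_compl_hitSet`). If f is odd about every point of a closed set D,
then f(W_1) has integral zero over the event that D is visited, so its integral over the
complementary event is ∫ f dγ. For D = {y} this gives the law of (W, M); for D = {−x, y}, f is a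
square wave and the result is the probability of staying between the barriers.

Writing Φ(g) as P(Z ≤ g) with a further normal variable makes the Spearman integrals combinations of
Gaussian measures of cones in space bounded by three planes. Rotation invariance handles two planes,
and the antipodal map reduces three planes to pairs (`stdNormal3_three_halfSpaces`), as in Girard's
formula for spherical triangles. The pair (W, M) needs two such cones, and (W, m) follows by W ↦ −W.
For (M, m) the square wave cuts the region X, Y > 0 into countably many strips, each a difference of
two cones. Their signed sum is the `arccos` series, which converges absolutely because the wave is
bounded.

For the numerical value, the two arccosines of index n add up to π/2 + α(p) with p = n(n+1) + 1,
where α is `angleExcess`. An explicit β (`bracketAngle`) satisfies β(n) + β(n+1) = 2α(p) + O(p⁻⁴),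
so after nine terms the alternating tail telescopes up to a tiny error. -/

/-! ### Gaussian measure of cones in the plane and in space -/

noncomputable section StandardNormal

/-- The standard normal distribution on the line. -/
abbrev stdNormal : Measure ℝ := gaussianReal 0 1

instance : NullSingletonClass stdNormal := nullSingletonClass_gaussianReal one_ne_zero

lemma gaussianPDF_mul_gaussianPDF_polar (p : ℝ × ℝ) :
    gaussianPDF 0 1 (polarCoord.symm p).1 * gaussianPDF 0 1 (polarCoord.symm p).2
      = gaussianPDF 0 1 p.1 * gaussianPDF 0 1 0 := by
  simp only [gaussianPDF, gaussianPDFReal, polarCoord_symm_apply]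
  rw [← ENNReal.ofReal_mul (by positivity), ← ENNReal.ofReal_mul (by positivity)]
  congr 1
  rw [mul_mul_mul_comm, ← Real.exp_add, mul_mul_mul_comm, ← Real.exp_add]
  congr 2
  have := Real.sin_sq_add_cos_sq p.2
  simp only [NNReal.coe_one, sub_zero]
  linear_combination (-p.1 ^ 2 / 2) * this

/-- Rotation invariance: in polar coordinates the density depends on r alone, so the angle is
uniformly distributed. The radial integral stays an unnamed constant `K`; evaluating on the whole
plane fixes it in the next lemma. -/
lemma exists_stdNormal_prod_cone : ∃ K : ENNReal, ∀ (S : Set (ℝ × ℝ)) (A : Set ℝ),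
    MeasurableSet S → MeasurableSet A → A ⊆ Set.Ioo (-Real.pi) Real.pi →
    (∀ r ∈ Set.Ioi (0 : ℝ), ∀ φ ∈ Set.Ioo (-Real.pi) Real.pi,
      (polarCoord.symm (r, φ) ∈ S ↔ φ ∈ A)) →
    (stdNormal.prod stdNormal) S = K * volume A := by
  refine ⟨∫⁻ r in Set.Ioi (0 : ℝ), ENNReal.ofReal r * (gaussianPDF 0 1 r * gaussianPDF 0 1 0), ?_⟩
  intro S A hS hA hAs h
  have hm : Measurable (gaussianPDF 0 1) := measurable_gaussianPDF 0 1
  rw [stdNormal, gaussianReal_of_var_ne_zero _ one_ne_zero, prod_withDensity hm hm,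
    withDensity_apply _ hS,
    ← lintegral_indicator hS, ← Measure.volume_eq_prod, ← lintegral_comp_polarCoord_symm]
  have key : ∀ p ∈ polarCoord.target, ENNReal.ofReal p.1 • S.indicator
      (fun z : ℝ × ℝ => gaussianPDF 0 1 z.1 * gaussianPDF 0 1 z.2) (polarCoord.symm p)
      = (ENNReal.ofReal p.1 * (gaussianPDF 0 1 p.1 * gaussianPDF 0 1 0)) *
        A.indicator 1 p.2 := by
    rintro ⟨r, φ⟩ hp
    rw [polarCoord_target, Set.mem_prod] at hp
    by_cases hφ : φ ∈ A
    · rw [Set.indicator_of_mem ((h r hp.1 φ hp.2).2 hφ), Set.indicator_of_mem hφ,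
        gaussianPDF_mul_gaussianPDF_polar]
      simp
    · rw [Set.indicator_of_notMem (fun h' => hφ ((h r hp.1 φ hp.2).1 h')),
        Set.indicator_of_notMem hφ]
      simp
  rw [setLIntegral_congr_fun polarCoord.open_target.measurableSet key, polarCoord_target,
    Measure.volume_eq_prod, ← Measure.prod_restrict, lintegral_prod_mul
      (f := fun r => ENNReal.ofReal r * (gaussianPDF 0 1 r * gaussianPDF 0 1 0)) (by fun_prop
        ) ((measurable_one.indicator hA).aemeasurable), lintegral_indicator_one hA,
    Measure.restrict_apply hA, Set.inter_eq_left.2 hAs]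

lemma stdNormal_prod_cone (S : Set (ℝ × ℝ)) (A : Set ℝ)
    (hS : MeasurableSet S) (hA : MeasurableSet A) (hAs : A ⊆ Set.Ioo (-Real.pi) Real.pi)
    (h : ∀ r ∈ Set.Ioi (0 : ℝ), ∀ φ ∈ Set.Ioo (-Real.pi) Real.pi,
      (polarCoord.symm (r, φ) ∈ S ↔ φ ∈ A)) :
    (stdNormal.prod stdNormal).real S = volume.real A / (2 * Real.pi) := by
  obtain ⟨K, hK⟩ := exists_stdNormal_prod_cone
  have h1 := hK Set.univ _ MeasurableSet.univ measurableSet_Ioo subset_rfl (by simp)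
  have h2 := hK S A hS hA hAs h
  rw [measureReal_def, h2, ENNReal.toReal_mul, measureReal_def]
  rw [measure_univ, Real.volume_Ioo] at h1
  have h3 := congrArg ENNReal.toReal h1
  rw [ENNReal.toReal_mul, ENNReal.toReal_ofReal (by linarith [Real.pi_pos])] at h3
  have hp := Real.pi_pos
  have : K.toReal = 1 / (2 * Real.pi) := by
    rw [eq_div_iff (by positivity)]
    simp at h3
    linarith
  rw [this]; ring

/-- In polar coordinates the two forms are r cos φ and r cos(φ − θ), so the angles form the interval
[θ − π/2, π/2], of length π − θ. -/
lemma stdNormal_prod_sector {θ : ℝ} (h0 : 0 ≤ θ) (h1 : θ < Real.pi) :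
    (stdNormal.prod stdNormal).real
      {p | 0 ≤ p.1 ∧ 0 ≤ Real.cos θ * p.1 + Real.sin θ * p.2} = 1 / 2 - θ / (2 * Real.pi) := by
  have hp := Real.pi_pos
  rw [stdNormal_prod_cone {p | 0 ≤ p.1 ∧ 0 ≤ Real.cos θ * p.1 + Real.sin θ * p.2}
    (Set.Icc (θ - Real.pi / 2) (Real.pi / 2))
    (MeasurableSet.inter (s₁ := {p : ℝ × ℝ | 0 ≤ p.1})
      (s₂ := {p : ℝ × ℝ | 0 ≤ Real.cos θ * p.1 + Real.sin θ * p.2})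
      (measurableSet_le measurable_const (by fun_prop))
      (measurableSet_le measurable_const (by fun_prop))) measurableSet_Icc]
  · rw [Real.volume_real_Icc, max_eq_left (by linarith)]
    field_simp
    ring
  · intro x hx
    exact ⟨by linarith [hx.1], by linarith [hx.2]⟩
  · intro r hr φ hφ
    have hr' : (0 : ℝ) < r := hr
    simp only [polarCoord_symm_apply, Set.mem_ofPred_eq, Set.mem_Icc]
    have e : Real.cos θ * (r * Real.cos φ) + Real.sin θ * (r * Real.sin φ)
        = r * Real.cos (φ - θ) := by rw [Real.cos_sub]; ring
    rw [e, mul_nonneg_iff_of_pos_left hr', mul_nonneg_iff_of_pos_left hr']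
    constructor
    · rintro ⟨ha, hb⟩
      have hle : φ ≤ Real.pi / 2 := by
        by_contra! hc
        exact absurd ha (not_le.2 (Real.cos_neg_of_pi_div_two_lt_of_lt hc (by linarith [hφ.2])))
      have hge : -(Real.pi / 2) ≤ φ := by
        by_contra! hc
        rw [← Real.cos_neg] at ha
        exact absurd ha (not_le.2 (Real.cos_neg_of_pi_div_two_lt_of_lt (by linarith)
          (by linarith [hφ.1])))
      refine ⟨?_, hle⟩
      by_contra! hc
      rw [← Real.cos_neg] at hb
      exact absurd hb (not_le.2 (Real.cos_neg_of_pi_div_two_lt_of_lt (by linarith) (by linarith)))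
    · rintro ⟨ha, hb⟩
      exact ⟨Real.cos_nonneg_of_mem_Icc ⟨by linarith, hb⟩,
        Real.cos_nonneg_of_mem_Icc ⟨by linarith, by linarith⟩⟩

/-- The linear form on space with coefficients `a`, `b`, `c`. -/
def linForm (a b c : ℝ) (p : ℝ × ℝ × ℝ) : ℝ := a * p.1 + b * p.2.1 + c * p.2.2

/-- The standard normal distribution on space. -/
abbrev stdNormal3 : Measure (ℝ × ℝ × ℝ) := stdNormal.prod (stdNormal.prod stdNormal)

@[fun_prop]
lemma measurable_linForm (a b c : ℝ) : Measurable (linForm a b c) := by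
  unfold linForm; fun_prop

lemma memLp_fst_stdNormal3 : MemLp (fun p : ℝ × ℝ × ℝ => p.1) 2 stdNormal3 :=
  (memLp_id_gaussianReal 2).comp_fst _

lemma memLp_snd_stdNormal3 : MemLp (fun p : ℝ × ℝ × ℝ => p.2.1) 2 stdNormal3 :=
  ((memLp_id_gaussianReal 2).comp_fst stdNormal).comp_snd stdNormal

lemma memLp_thd_stdNormal3 : MemLp (fun p : ℝ × ℝ × ℝ => p.2.2) 2 stdNormal3 :=
  ((memLp_id_gaussianReal 2).comp_snd stdNormal).comp_snd stdNormal

lemma memLp_linForm (a b c : ℝ) : MemLp (linForm a b c) 2 stdNormal3 :=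
  ((memLp_fst_stdNormal3.const_mul a).add (memLp_snd_stdNormal3.const_mul b)).add
    (memLp_thd_stdNormal3.const_mul c)

lemma integral_linForm (a b c : ℝ) : ∫ p, linForm a b c p ∂stdNormal3 = 0 := by
  have i1 := memLp_fst_stdNormal3.integrable (by norm_num)
  have i2 := memLp_snd_stdNormal3.integrable (by norm_num)
  have i3 := memLp_thd_stdNormal3.integrable (by norm_num)
  simp only [linForm]
  rw [integral_add (by fun_prop) (by fun_prop), integral_add (by fun_prop) (by fun_prop),
    integral_const_mul, integral_const_mul, integral_const_mul]
  have e1 : ∫ p, p.1 ∂stdNormal3 = 0 := by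
    rw [integral_fun_fst (fun x : ℝ => x)]; simp
  have e2 : ∫ p, p.2.1 ∂stdNormal3 = 0 := by
    rw [integral_fun_snd (fun x : ℝ × ℝ => x.1), integral_fun_fst (fun x : ℝ => x)]; simp
  have e3 : ∫ p, p.2.2 ∂stdNormal3 = 0 := by
    rw [integral_fun_snd (fun x : ℝ × ℝ => x.2), integral_fun_snd (fun x : ℝ => x)]; simp
  rw [e1, e2, e3]; ring

lemma integral_linForm_mul_linForm (a b c a' b' c' : ℝ) :
    ∫ p, linForm a b c p * linForm a' b' c' p ∂stdNormal3 = a * a' + b * b' + c * c' := by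
  have sq1 : ∫ x, x * x ∂stdNormal = 1 := by
    have := variance_fun_id_gaussianReal (μ := 0) (v := 1)
    rw [variance_of_integral_eq_zero (by fun_prop) (by simp)] at this
    simpa [pow_two] using this
  have m1 := memLp_fst_stdNormal3
  have m2 := memLp_snd_stdNormal3
  have m3 := memLp_thd_stdNormal3
  have e11 : ∫ p, p.1 * p.1 ∂stdNormal3 = 1 := by
    rw [integral_fun_fst (fun x : ℝ => x * x)]; simp [sq1]
  have e22 : ∫ p, p.2.1 * p.2.1 ∂stdNormal3 = 1 := by
    rw [integral_fun_snd (fun x : ℝ × ℝ => x.1 * x.1), integral_fun_fst (fun x : ℝ => x * x)]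
    simp [sq1]
  have e33 : ∫ p, p.2.2 * p.2.2 ∂stdNormal3 = 1 := by
    rw [integral_fun_snd (fun x : ℝ × ℝ => x.2 * x.2), integral_fun_snd (fun x : ℝ => x * x)]
    simp [sq1]
  have e12 : ∫ p, p.1 * p.2.1 ∂stdNormal3 = 0 := by
    rw [integral_prod_mul (fun x : ℝ => x) (fun x : ℝ × ℝ => x.1)]; simp
  have e13 : ∫ p, p.1 * p.2.2 ∂stdNormal3 = 0 := by
    rw [integral_prod_mul (fun x : ℝ => x) (fun x : ℝ × ℝ => x.2)]; simp
  have e23 : ∫ p, p.2.1 * p.2.2 ∂stdNormal3 = 0 := by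
    rw [integral_fun_snd (fun x : ℝ × ℝ => x.1 * x.2),
      integral_prod_mul (fun x : ℝ => x) (fun x : ℝ => x)]; simp
  have i11 := (m1.integrable_mul m1).const_mul (a * a')
  have i22 := (m2.integrable_mul m2).const_mul (b * b')
  have i33 := (m3.integrable_mul m3).const_mul (c * c')
  have i12 := (m1.integrable_mul m2).const_mul (a * b' + b * a')
  have i13 := (m1.integrable_mul m3).const_mul (a * c' + c * a')
  have i23 := (m2.integrable_mul m3).const_mul (b * c' + c * b')
  simp only [Pi.mul_apply] at i11 i22 i33 i12 i13 i23
  have : ∀ p, linForm a b c p * linForm a' b' c' p = (((((a * a') * (p.1 * p.1)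
      + (b * b') * (p.2.1 * p.2.1)) + (c * c') * (p.2.2 * p.2.2))
      + (a * b' + b * a') * (p.1 * p.2.1)) + (a * c' + c * a') * (p.1 * p.2.2))
      + (b * c' + c * b') * (p.2.1 * p.2.2) := by
    intro p; simp only [linForm]; ring
  simp_rw [this]
  rw [integral_add (by fun_prop) (by fun_prop), integral_add (by fun_prop) (by fun_prop),
    integral_add (by fun_prop) (by fun_prop), integral_add (by fun_prop) (by fun_prop),
    integral_add (by fun_prop) (by fun_prop)]
  simp only [integral_const_mul, e11, e22, e33, e12, e13, e23]
  ring

lemma hasGaussianLaw_linForm_prodMk (a b c a' b' c' : ℝ) :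
    HasGaussianLaw (fun p => (linForm a b c p, linForm a' b' c' p)) stdNormal3 := by
  have h : HasGaussianLaw id stdNormal3 := IsGaussian.hasGaussianLaw_id
  let F := ContinuousLinearMap.fst ℝ ℝ (ℝ × ℝ)
  let S := (ContinuousLinearMap.fst ℝ ℝ ℝ).comp (ContinuousLinearMap.snd ℝ ℝ (ℝ × ℝ))
  let T := (ContinuousLinearMap.snd ℝ ℝ ℝ).comp (ContinuousLinearMap.snd ℝ ℝ (ℝ × ℝ))
  exact h.map_fun ((a • F + b • S + c • T).prod (a' • F + b' • S + c' • T))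

/-- Orthonormal coefficient vectors give jointly Gaussian, uncorrelated forms of variance 1; these
are independent standard normals. -/
lemma map_linForm_prodMk {a b c a' b' c' : ℝ} (h : a ^ 2 + b ^ 2 + c ^ 2 = 1)
    (h' : a' ^ 2 + b' ^ 2 + c' ^ 2 = 1) (hd : a * a' + b * b' + c * c' = 0) :
    stdNormal3.map (fun p => (linForm a b c p, linForm a' b' c' p))
      = stdNormal.prod stdNormal := by
  have hg := hasGaussianLaw_linForm_prodMk a b c a' b' c'
  have one : ∀ a b c : ℝ, a ^ 2 + b ^ 2 + c ^ 2 = 1 → HasGaussianLaw (linForm a b c) stdNormal3 →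
      stdNormal3.map (linForm a b c) = stdNormal := by
    intro a b c h hL
    rw [hL.map_eq_gaussianReal, integral_linForm,
      variance_of_integral_eq_zero (by fun_prop) (integral_linForm a b c)]
    simp_rw [pow_two, integral_linForm_mul_linForm, ← pow_two]
    rw [h]; simp
  have hi : IndepFun (linForm a b c) (linForm a' b' c') stdNormal3 := by
    apply hg.indepFun_of_covariance_eq_zero
    rw [covariance_eq_sub (memLp_linForm _ _ _) (memLp_linForm _ _ _)]
    simp only [integral_linForm, Pi.mul_apply, integral_linForm_mul_linForm, hd]
    simp
  rw [(indepFun_iff_map_prod_eq_prod_map_map (by fun_prop) (by fun_prop)).1 hi,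
    one a b c h hg.fst, one a' b' c' h' hg.snd]

lemma stdNormal3_linForm_eq_zero {a b c : ℝ} (h : 0 < a ^ 2 + b ^ 2 + c ^ 2) :
    ∀ᵐ p ∂stdNormal3, linForm a b c p ≠ 0 := by
  have hL := (hasGaussianLaw_linForm_prodMk a b c a b c).fst
  have hm : Measurable (linForm a b c) := by fun_prop
  have key : stdNormal3.map (linForm a b c) {0} = 0 := by
    rw [hL.map_eq_gaussianReal, integral_linForm,
      variance_of_integral_eq_zero (by fun_prop) (integral_linForm a b c)]
    simp_rw [pow_two, integral_linForm_mul_linForm, ← pow_two]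
    have : NullSingletonClass (gaussianReal 0 (a ^ 2 + b ^ 2 + c ^ 2).toNNReal) :=
      nullSingletonClass_gaussianReal (by simpa using h)
    exact measure_singleton 0
  rw [Measure.map_apply hm (measurableSet_singleton _)] at key
  rw [ae_iff]
  convert key using 2
  ext p; simp

lemma map_neg_stdNormal3 : stdNormal3.map (fun p => -p) = stdNormal3 := by
  have h1 : stdNormal.map (fun x => -x) = stdNormal := by
    rw [gaussianReal_map_neg]; simp
  have h2 : (stdNormal.prod stdNormal).map (fun p => -p) = stdNormal.prod stdNormal := by
    have := Measure.map_prod_map stdNormal stdNormal measurable_neg measurable_neg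
    rw [h1] at this
    exact this.symm
  have := Measure.map_prod_map stdNormal (stdNormal.prod stdNormal) measurable_neg measurable_neg
  rw [h1, h2] at this
  exact this.symm

lemma linForm_neg (a b c : ℝ) (p : ℝ × ℝ × ℝ) : linForm a b c (-p) = -linForm a b c p := by
  simp only [linForm, Prod.fst_neg, Prod.snd_neg]; ring

lemma measurableSet_nonneg_linForm (a b c : ℝ) : MeasurableSet {p | 0 ≤ linForm a b c p} :=
  measurableSet_le measurable_const (by fun_prop)

/-- Here `r` and `s` are the lengths of the two normals and `θ` is the angle between them.
Gram–Schmidt on the normals reduces the claim to the planar sector. -/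
lemma stdNormal3_two_halfSpaces {a b c a' b' c' r s θ : ℝ} (h0 : 0 < θ) (h1 : θ < Real.pi)
    (hr : 0 < r) (hs : 0 < s) (ha : a ^ 2 + b ^ 2 + c ^ 2 = r ^ 2)
    (ha' : a' ^ 2 + b' ^ 2 + c' ^ 2 = s ^ 2)
    (hd : a * a' + b * b' + c * c' = r * s * Real.cos θ) :
    stdNormal3.real ({p | 0 ≤ linForm a b c p} ∩ {p | 0 ≤ linForm a' b' c' p})
      = 1 / 2 - θ / (2 * Real.pi) := by
  have hsin : 0 < Real.sin θ := Real.sin_pos_of_pos_of_lt_pi h0 h1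
  have hsc := Real.sin_sq_add_cos_sq θ
  rw [← stdNormal_prod_sector h0.le h1]
  set C := Real.cos θ with hC
  set S := Real.sin θ with hS
  have hmap := map_linForm_prodMk (a := a / r) (b := b / r) (c := c / r)
    (a' := (a' / s - C * (a / r)) / S) (b' := (b' / s - C * (b / r)) / S)
    (c' := (c' / s - C * (c / r)) / S) ?_ ?_ ?_
  · rw [← hmap, map_measureReal_apply (by fun_prop)]
    · congr 1
      ext p
      have e1 : linForm a b c p = r * linForm (a / r) (b / r) (c / r) p := by
        simp only [linForm]; field_simp
      have e2 : linForm a' b' c' p = s * (C * linForm (a / r) (b / r) (c / r) p +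
          S * linForm ((a' / s - C * (a / r)) / S) ((b' / s - C * (b / r)) / S)
            ((c' / s - C * (c / r)) / S) p) := by
        simp only [linForm]; field_simp; ring
      simp only [Set.mem_inter_iff, Set.mem_ofPred_eq, Set.mem_preimage]
      rw [e2, e1, mul_nonneg_iff_of_pos_left hr, mul_nonneg_iff_of_pos_left hs]
    · exact MeasurableSet.inter (s₁ := {p : ℝ × ℝ | 0 ≤ p.1})
        (s₂ := {p : ℝ × ℝ | 0 ≤ C * p.1 + S * p.2})
        (measurableSet_le measurable_const (by fun_prop))
        (measurableSet_le measurable_const (by fun_prop))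
  · field_simp; linarith
  · have : ∀ x y z, (x / S) ^ 2 + (y / S) ^ 2 + (z / S) ^ 2 = (x ^ 2 + y ^ 2 + z ^ 2) / S ^ 2 := by
      intro x y z; field_simp
    rw [this, div_eq_one_iff_eq (by positivity)]
    have e : (a' / s - C * (a / r)) ^ 2 + (b' / s - C * (b / r)) ^ 2 + (c' / s - C * (c / r)) ^ 2
        = (a' ^ 2 + b' ^ 2 + c' ^ 2) / s ^ 2 - 2 * C * (a * a' + b * b' + c * c') / (r * s)
          + C ^ 2 * (a ^ 2 + b ^ 2 + c ^ 2) / r ^ 2 := by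
      field_simp; ring
    rw [e, ha, ha', hd]
    field_simp
    linarith
  · have e : a / r * ((a' / s - C * (a / r)) / S) + b / r * ((b' / s - C * (b / r)) / S)
        + c / r * ((c' / s - C * (c / r)) / S)
        = ((a * a' + b * b' + c * c') / (r * s) - C * (a ^ 2 + b ^ 2 + c ^ 2) / r ^ 2) / S := by
      field_simp
      ring
    rw [e, ha, hd]
    field_simp
    ring

/-- Split A, of measure 1/2, by B and C: it consists of A ∩ B, (A ∩ C) \ B and A \ (B ∪ C). By
hypothesis the last piece has the measure of B ∩ C less the triple intersection, which is thus
subtracted twice. -/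
lemma two_mul_measureReal_inter_three {Ω : Type*} [MeasurableSpace Ω] {μ : Measure Ω}
    [IsProbabilityMeasure μ] {A B C : Set Ω} (hA : MeasurableSet A) (hB : MeasurableSet B)
    (hC : MeasurableSet C) (h1 : μ.real A = μ.real Aᶜ)
    (h2 : μ.real ((A \ B) \ C) = μ.real ((B ∩ C) \ A)) :
    2 * μ.real (A ∩ B ∩ C)
      = μ.real (A ∩ B) + μ.real (A ∩ C) + μ.real (B ∩ C) - 1 / 2 := by
  have e1 := probReal_add_probReal_compl (μ := μ) hA
  have e2 := measureReal_inter_add_sdiff (μ := μ) (s := A) hB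
  have e3 := measureReal_inter_add_sdiff (μ := μ) (s := A \ B) hC
  have e4 := measureReal_inter_add_sdiff (μ := μ) (s := A ∩ C) hB
  have e5 := measureReal_inter_add_sdiff (μ := μ) (s := B ∩ C) hA
  have e6 := measureReal_inter_add_sdiff (μ := μ) (s := A ∩ B) hC
  rw [show A ∩ C ∩ B = A ∩ B ∩ C by grind, show (A ∩ C) \ B = A \ B ∩ C by grind] at e4
  rw [show B ∩ C ∩ A = A ∩ B ∩ C by grind] at e5
  linarith

/-- Off the bounding planes, p ↦ −p exchanges each half-space with its complement, hence A \ (B ∪ C)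
with (B ∩ C) \ A. This is the argument behind Girard's area formula. -/
lemma stdNormal3_three_halfSpaces {a₁ b₁ c₁ a₂ b₂ c₂ a₃ b₃ c₃ : ℝ}
    (h1 : 0 < a₁ ^ 2 + b₁ ^ 2 + c₁ ^ 2) (h2 : 0 < a₂ ^ 2 + b₂ ^ 2 + c₂ ^ 2)
    (h3 : 0 < a₃ ^ 2 + b₃ ^ 2 + c₃ ^ 2) :
    2 * stdNormal3.real ({p | 0 ≤ linForm a₁ b₁ c₁ p} ∩ {p | 0 ≤ linForm a₂ b₂ c₂ p} ∩
        {p | 0 ≤ linForm a₃ b₃ c₃ p})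
      = stdNormal3.real ({p | 0 ≤ linForm a₁ b₁ c₁ p} ∩ {p | 0 ≤ linForm a₂ b₂ c₂ p})
      + stdNormal3.real ({p | 0 ≤ linForm a₁ b₁ c₁ p} ∩ {p | 0 ≤ linForm a₃ b₃ c₃ p})
      + stdNormal3.real ({p | 0 ≤ linForm a₂ b₂ c₂ p} ∩ {p | 0 ≤ linForm a₃ b₃ c₃ p})
      - 1 / 2 := by
  have m1 := measurableSet_nonneg_linForm a₁ b₁ c₁
  have m2 := measurableSet_nonneg_linForm a₂ b₂ c₂
  have m3 := measurableSet_nonneg_linForm a₃ b₃ c₃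
  have mp : MeasurePreserving (fun p : ℝ × ℝ × ℝ => -p) stdNormal3 stdNormal3 :=
    ⟨measurable_neg, map_neg_stdNormal3⟩
  apply two_mul_measureReal_inter_three m1 m2 m3
  · rw [← mp.measureReal_preimage m1.nullMeasurableSet]
    apply measureReal_congr
    filter_upwards [stdNormal3_linForm_eq_zero h1] with p hp
    apply propext
    change 0 ≤ linForm a₁ b₁ c₁ (-p) ↔ ¬ (0 ≤ linForm a₁ b₁ c₁ p)
    rw [linForm_neg]
    grind
  · rw [← mp.measureReal_preimage ((m1.diff m2).diff m3).nullMeasurableSet]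
    apply measureReal_congr
    filter_upwards [stdNormal3_linForm_eq_zero h1, stdNormal3_linForm_eq_zero h2,
      stdNormal3_linForm_eq_zero h3] with p hp hp2 hp3
    apply propext
    change (0 ≤ linForm a₁ b₁ c₁ (-p) ∧ ¬ (0 ≤ linForm a₂ b₂ c₂ (-p))) ∧
      ¬ (0 ≤ linForm a₃ b₃ c₃ (-p)) ↔ (0 ≤ linForm a₂ b₂ c₂ p ∧ 0 ≤ linForm a₃ b₃ c₃ p) ∧
      ¬ (0 ≤ linForm a₁ b₁ c₁ p)
    rw [linForm_neg, linForm_neg, linForm_neg]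
    grind

lemma stdNormal3_two_halfSpaces_arccos {a b c a' b' c' r s u : ℝ} (hu : -1 < u) (hu' : u < 1)
    (hr : 0 < r) (hs : 0 < s) (ha : a ^ 2 + b ^ 2 + c ^ 2 = r ^ 2)
    (ha' : a' ^ 2 + b' ^ 2 + c' ^ 2 = s ^ 2) (hd : a * a' + b * b' + c * c' = r * s * u) :
    stdNormal3.real ({p | 0 ≤ linForm a b c p} ∩ {p | 0 ≤ linForm a' b' c' p})
      = 1 / 2 - Real.arccos u / (2 * Real.pi) := by
  refine stdNormal3_two_halfSpaces (Real.arccos_pos.2 hu') ?_ hr hs ha ha' ?_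
  · refine lt_of_le_of_ne (Real.arccos_le_pi u) fun h => ?_
    rw [Real.arccos_eq_pi] at h
    linarith
  · rw [Real.cos_arccos hu.le hu'.le, hd]

/-- The Gaussian measure of the cones `{X ≥ 0, Y ≥ 0, Z ≥ (k - 1) X + k Y}`. -/
lemma stdNormal3_exit_cone (k : ℝ) :
    stdNormal3.real ({p | 0 ≤ linForm 1 0 0 p} ∩ {p | 0 ≤ linForm 0 1 0 p} ∩
        {p | 0 ≤ linForm (1 - k) (-k) 1 p})
      = -1 / 8 + (Real.arccos ((k - 1) / √(2 * (k * (k - 1) + 1)))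
        + Real.arccos (k / √(2 * (k * (k - 1) + 1)))) / (4 * Real.pi) := by
  have hpos : 0 < 2 * (k * (k - 1) + 1) := by nlinarith [sq_nonneg (2 * k - 1)]
  set N := √(2 * (k * (k - 1) + 1)) with hN
  have hN0 : 0 < N := Real.sqrt_pos.2 hpos
  have hN2 : N ^ 2 = 2 * (k * (k - 1) + 1) := Real.sq_sqrt hpos.le
  have b : ∀ t : ℝ, t ^ 2 < N ^ 2 → -1 < -t / N ∧ -t / N < 1 := by
    intro t ht
    have := abs_lt_of_sq_lt_sq' ht hN0.le
    constructor
    · rw [lt_div_iff₀ hN0]; linarith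
    · rw [div_lt_iff₀ hN0]; linarith
  have bk := b k (by rw [hN2]; nlinarith [sq_nonneg (k - 1)])
  have bk1 := b (k - 1) (by rw [hN2]; nlinarith [sq_nonneg k])
  have h12 := stdNormal3_two_halfSpaces_arccos (a := 1) (b := 0) (c := 0) (a' := 0) (b' := 1)
    (c' := 0) (r := 1) (s := 1) (u := 0) (by norm_num) (by norm_num) (by norm_num) (by norm_num)
    (by norm_num) (by norm_num) (by norm_num)
  have h13 := stdNormal3_two_halfSpaces_arccos (a := 1) (b := 0) (c := 0) (a' := 1 - k)
    (b' := -k) (c' := 1) (r := 1) (s := N) (u := -(k - 1) / N) bk1.1 bk1.2 (by norm_num) hN0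
    (by norm_num) (by rw [hN2]; ring) (by field_simp; ring)
  have h23 := stdNormal3_two_halfSpaces_arccos (a := 0) (b := 1) (c := 0) (a' := 1 - k)
    (b' := -k) (c' := 1) (r := 1) (s := N) (u := -k / N) bk.1 bk.2 (by norm_num) hN0
    (by norm_num) (by rw [hN2]; ring) (by field_simp; ring)
  have h := stdNormal3_three_halfSpaces (a₁ := 1) (b₁ := 0) (c₁ := 0) (a₂ := 0) (b₂ := 1)
    (c₂ := 0) (a₃ := 1 - k) (b₃ := -k) (c₃ := 1) (by norm_num) (by norm_num) (by positivity)
  rw [h12, h13, h23, Real.arccos_zero, neg_div, neg_div, Real.arccos_neg, Real.arccos_neg] at h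
  have hp := Real.pi_pos
  have e : ∀ x y z : ℝ, 2 * x = 1 / 2 - Real.pi / 2 / (2 * Real.pi) +
      (1 / 2 - (Real.pi - y) / (2 * Real.pi)) + (1 / 2 - (Real.pi - z) / (2 * Real.pi)) - 1 / 2 →
      x = -1 / 8 + (y + z) / (4 * Real.pi) := by
    intro x y z hx
    field_simp at hx ⊢
    linarith
  exact e _ _ _ h

/-- With coordinates (Y, X, Z) this is the event Y ≥ 0, Z ≤ min(X, Y), which carries the direct term
of the law of (W, M). The normals meet at angles π/2, π/4 and π/3. -/
lemma stdNormal3_max_cone :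
    stdNormal3.real ({p | 0 ≤ linForm 1 0 0 p} ∩ {p | 0 ≤ linForm 0 1 (-1) p} ∩
        {p | 0 ≤ linForm 1 0 (-1) p}) = 11 / 48 := by
  have hp := Real.pi_pos
  have h2 : (√2 : ℝ) ^ 2 = 2 := Real.sq_sqrt (by norm_num)
  have s2 : (0 : ℝ) < √2 := by positivity
  have h12 := stdNormal3_two_halfSpaces (a := 1) (b := 0) (c := 0) (a' := 0) (b' := 1)
    (c' := -1) (r := 1) (s := √2) (θ := Real.pi / 2) (by positivity) (by linarith) (by norm_num)
    s2 (by norm_num) (by rw [h2]; norm_num) (by simp)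
  have h13 := stdNormal3_two_halfSpaces (a := 1) (b := 0) (c := 0) (a' := 1) (b' := 0)
    (c' := -1) (r := 1) (s := √2) (θ := Real.pi / 4) (by positivity) (by linarith) (by norm_num)
    s2 (by norm_num) (by rw [h2]; norm_num) (by rw [Real.cos_pi_div_four]; linarith)
  have h23 := stdNormal3_two_halfSpaces (a := 0) (b := 1) (c := -1) (a' := 1) (b' := 0)
    (c' := -1) (r := √2) (s := √2) (θ := Real.pi / 3) (by positivity) (by linarith) s2
    s2 (by rw [h2]; norm_num) (by rw [h2]; norm_num) (by rw [Real.cos_pi_div_three]; linarith)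
  have h := stdNormal3_three_halfSpaces (a₁ := 1) (b₁ := 0) (c₁ := 0) (a₂ := 0) (b₂ := 1)
    (c₂ := -1) (a₃ := 1) (b₃ := 0) (c₃ := -1) (by norm_num) (by norm_num) (by norm_num)
  rw [h12, h13, h23] at h
  field_simp at h
  linarith

/-- With coordinates (Y, X, Z) this is the event Y ≥ 0, Z ≤ min(X, Y) − 2Y, the image term of the
law of (W, M). Only the angle between the first two normals is not a rational multiple of π given in
closed form. -/
lemma stdNormal3_reflected_cone :
    stdNormal3.real ({p | 0 ≤ linForm 1 0 0 p} ∩ {p | 0 ≤ linForm (-2) 1 (-1) p} ∩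
        {p | 0 ≤ linForm (-1) 0 (-1) p}) = 1 / 48 + Real.arccos (√6 / 3) / (4 * Real.pi) := by
  have hp := Real.pi_pos
  have h2 : (√2 : ℝ) ^ 2 = 2 := Real.sq_sqrt (by norm_num)
  have s2 : (0 : ℝ) < √2 := by positivity
  have h6 : (√6 : ℝ) ^ 2 = 6 := Real.sq_sqrt (by norm_num)
  have s6 : (0 : ℝ) < √6 := by positivity
  have h62 : (√6 : ℝ) * √2 = 2 * √3 := by
    rw [show (6 : ℝ) = 2 * 3 by norm_num, Real.sqrt_mul (by norm_num)]
    linear_combination √3 * h2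
  have h3 : (√3 : ℝ) ^ 2 = 3 := Real.sq_sqrt (by norm_num)
  have h12 := stdNormal3_two_halfSpaces_arccos (a := 1) (b := 0) (c := 0) (a' := -2) (b' := 1)
    (c' := -1) (r := 1) (s := √6) (u := -(√6 / 3)) (by nlinarith) (by linarith) (by norm_num)
    s6 (by norm_num) (by rw [h6]; norm_num) (by nlinarith)
  have h13 := stdNormal3_two_halfSpaces (a := 1) (b := 0) (c := 0) (a' := -1) (b' := 0)
    (c' := -1) (r := 1) (s := √2) (θ := Real.pi - Real.pi / 4) (by linarith) (by linarith)
    (by norm_num) s2 (by norm_num) (by rw [h2]; norm_num)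
    (by rw [Real.cos_pi_sub, Real.cos_pi_div_four]; linarith)
  have h23 := stdNormal3_two_halfSpaces (a := -2) (b := 1) (c := -1) (a' := -1) (b' := 0)
    (c' := -1) (r := √6) (s := √2) (θ := Real.pi / 6) (by positivity) (by linarith) s6
    s2 (by rw [h6]; norm_num) (by rw [h2]; norm_num) (by
      rw [Real.cos_pi_div_six, h62]; linarith)
  have h := stdNormal3_three_halfSpaces (a₁ := 1) (b₁ := 0) (c₁ := 0) (a₂ := -2) (b₂ := 1)
    (c₂ := -1) (a₃ := -1) (b₃ := 0) (c₃ := -1) (by norm_num) (by norm_num) (by norm_num)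
  rw [h12, h13, h23, Real.arccos_neg] at h
  field_simp at h ⊢
  linarith

end StandardNormal

/-! ### Reflection principle at the first visit to a closed set -/

noncomputable section Reflection

open Filter Topology

/-- A Brownian motion started at zero all of whose paths are continuous and all of whose
coordinates are measurable. -/
structure IsRegularBrownian {Ω : Type*} [MeasurableSpace Ω] (W : ℝ≥0 → Ω → ℝ) (P : Measure Ω) :
    Prop extends IsPreBrownianReal W P where
  measurable_eval : ∀ t, Measurable (W t)
  continuous_path : ∀ ω, Continuous (W · ω)
  eval_zero : ∀ ω, W 0 ω = 0

variable {Ω : Type*} {W : ℝ≥0 → Ω → ℝ}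

/-- Replace the path by zero outside a measurable set of full measure on which it is continuous,
starts at 0 and agrees with measurable versions at a dense sequence of times. Measurability at the
other times follows by continuity. -/
lemma exists_isRegularBrownian [MeasurableSpace Ω] {P : Measure Ω} (hW : IsBrownianReal W P) :
    ∃ V : ℝ≥0 → Ω → ℝ, IsRegularBrownian V P ∧ ∀ᵐ ω ∂P, ∀ t, W t ω = V t ω := by
  let q := TopologicalSpace.denseSeq ℝ≥0
  have hq : DenseRange q := TopologicalSpace.denseRange_denseSeq ℝ≥0
  have h : ∀ᵐ ω ∂P, Continuous (W · ω) ∧ W 0 ω = 0 ∧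
      ∀ n, W (q n) ω = (hW.aemeasurable (q n)).mk _ ω := by
    filter_upwards [hW.cont, hW.eval_zero_ae_eq_zero,
      ae_all_iff.2 fun n => (hW.aemeasurable (q n)).ae_eq_mk] with ω h1 h2 h3
    exact ⟨h1, h2, h3⟩
  obtain ⟨G, hG, hGm, hGp⟩ := h.exists_measurable_mem
  have hGae : ∀ᵐ ω ∂P, ω ∈ G := hG
  have heq : ∀ᵐ ω ∂P, ∀ t, W t ω = G.indicator (W t) ω := by
    filter_upwards [hGae] with ω hω t
    rw [Set.indicator_of_mem hω]
  have hc : ∀ ω, Continuous fun t => G.indicator (W t) ω := by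
    intro ω
    by_cases hω : ω ∈ G
    · simpa [Set.indicator_of_mem hω] using (hGp ω hω).1
    · simpa [Set.indicator_of_notMem hω] using continuous_const
  refine ⟨fun t => G.indicator (W t), ⟨hW.toIsPreBrownianReal.congr fun t => ?_, ?_, hc, ?_⟩, heq⟩
  · filter_upwards [heq] with ω hω using hω t
  · have hm : ∀ n, Measurable (G.indicator (W (q n))) := by
      intro n
      have : G.indicator (W (q n)) = G.indicator ((hW.aemeasurable (q n)).mk _) := by
        ext ω
        by_cases hω : ω ∈ G
        · simp only [Set.indicator_of_mem hω, (hGp ω hω).2.2 n]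
        · simp only [Set.indicator_of_notMem hω]
      rw [this]
      exact (hW.aemeasurable (q n)).measurable_mk.indicator hGm
    intro t
    obtain ⟨u, hu, hut⟩ := mem_closure_iff_seq_limit.1 (hq t)
    choose m hm' using hu
    refine measurable_of_tendsto_metrizable (f := fun n => G.indicator (W (u n))) (fun n => ?_) ?_
    · rw [← hm' n]; exact hm _
    · rw [tendsto_pi_nhds]
      intro ω
      exact ((hc ω).tendsto t).comp hut
  · intro ω
    by_cases hω : ω ∈ G
    · simp [Set.indicator_of_mem hω, (hGp ω hω).2.1]
    · simp [Set.indicator_of_notMem hω]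

/-- The σ-algebra generated by a process up to time `t`. -/
abbrev pastAlgebra (W : ℝ≥0 → Ω → ℝ) (t : ℝ≥0) : MeasurableSpace Ω :=
  MeasurableSpace.comap (fun ω (s : Set.Iic t) => W s ω) inferInstance

lemma pastAlgebra_mono (W : ℝ≥0 → Ω → ℝ) {s t : ℝ≥0} (h : s ≤ t) :
    pastAlgebra W s ≤ pastAlgebra W t := by
  have : (fun ω (r : Set.Iic s) => W r ω) = (fun (x : Set.Iic t → ℝ) (r : Set.Iic s) =>
      x ⟨r, r.2.trans h⟩) ∘ fun ω (r : Set.Iic t) => W r ω := rfl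
  rw [pastAlgebra, this, ← MeasurableSpace.comap_comp]
  refine MeasurableSpace.comap_mono ?_
  exact Measurable.comap_le (by fun_prop)

/-- The event that a process visits `D` up to time `t`. -/
def hitSet (W : ℝ≥0 → Ω → ℝ) (D : Set ℝ) (t : ℝ≥0) : Set Ω := {ω | ∃ s ≤ t, W s ω ∈ D}

lemma hitSet_mono (W : ℝ≥0 → Ω → ℝ) (D : Set ℝ) {s t : ℝ≥0} (h : s ≤ t) :
    hitSet W D s ⊆ hitSet W D t := fun _ ⟨r, hr, hD⟩ => ⟨r, hr.trans h, hD⟩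

lemma exists_mem_iff_infDist_denseSeq {X : Type*} [TopologicalSpace X] [CompactSpace X]
    [TopologicalSpace.SeparableSpace X] [Nonempty X] {f : X → ℝ} (hf : Continuous f) {D : Set ℝ}
    (hD : IsClosed D) (hne : D.Nonempty) :
    (∃ s, f s ∈ D) ↔ ∀ n : ℕ, ∃ k,
      Metric.infDist (f (TopologicalSpace.denseSeq X k)) D < 1 / ((n : ℝ) + 1) := by
  have hc : Continuous fun s => Metric.infDist (f s) D := (Metric.continuous_infDist_pt D).comp hf
  constructor
  · rintro ⟨s, hs⟩ n
    have ho : IsOpen {s | Metric.infDist (f s) D < 1 / ((n : ℝ) + 1)} :=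
      isOpen_lt hc continuous_const
    obtain ⟨k, hk⟩ := (TopologicalSpace.denseRange_denseSeq X).exists_mem_open ho
      ⟨s, by simp only [Set.mem_ofPred_eq, Metric.infDist_zero_of_mem hs]; positivity⟩
    exact ⟨k, hk⟩
  · intro h
    obtain ⟨s, -, hs⟩ := isCompact_univ.exists_isMinOn Set.univ_nonempty hc.continuousOn
    refine ⟨s, (hD.mem_iff_infDist_zero hne).2 (le_antisymm ?_ Metric.infDist_nonneg)⟩
    refine le_of_forall_pos_le_add fun ε hε => ?_
    obtain ⟨n, hn⟩ := exists_nat_one_div_lt hε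
    obtain ⟨k, hk⟩ := h n
    have := isMinOn_iff.1 hs (TopologicalSpace.denseSeq X k) trivial
    linarith

/-- A continuous path on a compact interval meets a closed set exactly when its distance to the set
comes arbitrarily close to 0 along a dense sequence of times. So the event is decided by the path up
to time `t`, with no look into the future. -/
lemma measurableSet_pastAlgebra_hitSet (hc : ∀ ω, Continuous (W · ω)) {D : Set ℝ}
    (hD : IsClosed D) (hne : D.Nonempty) (t : ℝ≥0) :
    MeasurableSet[pastAlgebra W t] (hitSet W D t) := by
  have : CompactSpace (Set.Iic t) := by
    rw [← isCompact_iff_compactSpace, ← Set.Icc_bot]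
    exact isCompact_Icc
  let q := TopologicalSpace.denseSeq (Set.Iic t)
  refine ⟨⋂ n : ℕ, ⋃ k, {x | Metric.infDist (x (q k)) D < 1 / ((n : ℝ) + 1)}, ?_, ?_⟩
  · refine MeasurableSet.iInter fun n => MeasurableSet.iUnion fun k => ?_
    exact measurableSet_lt ((Metric.continuous_infDist_pt D).measurable.comp
      (measurable_pi_apply _)) measurable_const
  · ext ω
    have := exists_mem_iff_infDist_denseSeq (X := Set.Iic t) (f := fun s => W s ω)
      ((hc ω).comp continuous_subtype_val) hD hne
    simp only [Set.mem_preimage, Set.mem_iInter, Set.mem_iUnion, Set.mem_ofPred_eq]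
    rw [← this]
    simp [hitSet]

lemma pastAlgebra_le [mΩ : MeasurableSpace Ω] (hm : ∀ t, Measurable (W t)) (t : ℝ≥0) :
    pastAlgebra W t ≤ mΩ :=
  Measurable.comap_le (measurable_pi_lambda _ fun s => hm s)

/-- Reflection at a deterministic time: the increment W_1 − W_t is symmetric and independent of the
past, and 2W_t − W_1 = W_t − (W_1 − W_t). -/
lemma IsRegularBrownian.setIntegral_reflect [MeasurableSpace Ω] {P : Measure Ω}
    (hW : IsRegularBrownian W P) {t : ℝ≥0} (ht : t ≤ 1)
    {E : Set Ω} (hE : MeasurableSet[pastAlgebra W t] E) {g : ℝ → ℝ} (hg : Measurable g) :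
    ∫ ω in E, g (W 1 ω) ∂P = ∫ ω in E, g (2 * W t ω - W 1 ω) ∂P := by
  have : IsProbabilityMeasure P := hW.isGaussianProcess.isProbabilityMeasure
  have hEm := pastAlgebra_le hW.measurable_eval t _ hE
  obtain ⟨S, hS, rfl⟩ := hE
  set η : Ω → (Set.Iic t → ℝ) := fun ω s => W s ω with hη
  have hηm : Measurable η := measurable_pi_lambda _ fun s => hW.measurable_eval s
  set ξ : Ω → ℝ := fun ω => W 1 ω - W t ω with hξ
  have hξm : Measurable ξ := (hW.measurable_eval 1).sub (hW.measurable_eval t)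
  have hind : IndepFun ξ η P := by
    have hev : Measurable fun x : ℝ≥0 → ℝ => x (1 - t) := measurable_pi_apply _
    have h := (hW.indepFun_shift t).comp (φ := fun x : ℝ≥0 → ℝ => x (1 - t)) (ψ := id)
      hev measurable_id
    convert h using 1
    · ext ω
      simp [hξ, add_tsub_cancel_of_le ht]
    · rfl
  have hlaw : HasLaw ξ (gaussianReal 0 (nndist ((1 : ℝ≥0) : ℝ) t)) P := hW.hasLaw_sub 1 t
  have hlaw' : P.map (fun ω => -ξ ω) = P.map ξ := by
    refine (gaussianReal_neg hlaw).map_eq.trans ?_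
    rw [hlaw.map_eq]; simp
  have hind' : IndepFun (fun ω => -ξ ω) η P := hind.comp measurable_neg measurable_id
  have hξn : Measurable fun ω => -ξ ω := hξm.neg
  have hjoint : P.map (fun ω => (ξ ω, η ω)) = P.map (fun ω => (-ξ ω, η ω)) := by
    rw [(indepFun_iff_map_prod_eq_prod_map_map hξm.aemeasurable hηm.aemeasurable).1 hind,
      (indepFun_iff_map_prod_eq_prod_map_map hξn.aemeasurable hηm.aemeasurable).1 hind',
      hlaw']
  let F : ℝ × (Set.Iic t → ℝ) → ℝ := (Prod.snd ⁻¹' S).indicator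
    fun p => g (p.2 ⟨t, Set.self_mem_Iic⟩ + p.1)
  have hF : Measurable F := by
    refine Measurable.indicator (hg.comp ?_) (measurable_snd hS)
    fun_prop
  have e1 : ∫ ω, F (ξ ω, η ω) ∂P = ∫ ω in η ⁻¹' S, g (W 1 ω) ∂P := by
    rw [← integral_indicator hEm]
    congr 1; ext ω
    by_cases h : η ω ∈ S
    · rw [Set.indicator_of_mem (show ω ∈ η ⁻¹' S from h)]
      simp only [F]
      rw [Set.indicator_of_mem (show (ξ ω, η ω) ∈ Prod.snd ⁻¹' S from h)]
      simp [hξ, hη]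
    · rw [Set.indicator_of_notMem (show ω ∉ η ⁻¹' S from h)]
      simp only [F]
      rw [Set.indicator_of_notMem (show (ξ ω, η ω) ∉ Prod.snd ⁻¹' S from h)]
  have e2 : ∫ ω, F (-ξ ω, η ω) ∂P = ∫ ω in η ⁻¹' S, g (2 * W t ω - W 1 ω) ∂P := by
    rw [← integral_indicator hEm]
    congr 1; ext ω
    by_cases h : η ω ∈ S
    · rw [Set.indicator_of_mem (show ω ∈ η ⁻¹' S from h)]
      simp only [F]
      rw [Set.indicator_of_mem (show (-ξ ω, η ω) ∈ Prod.snd ⁻¹' S from h)]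
      simp only [hξ, hη]
      ring_nf
    · rw [Set.indicator_of_notMem (show ω ∉ η ⁻¹' S from h)]
      simp only [F]
      rw [Set.indicator_of_notMem (show (-ξ ω, η ω) ∉ Prod.snd ⁻¹' S from h)]
  rw [← e1, ← e2, ← integral_map (hξm.prodMk hηm).aemeasurable hF.aestronglyMeasurable, hjoint,
    integral_map (hξn.prodMk hηm).aemeasurable hF.aestronglyMeasurable]

/-- The first time at which a process visits `D`. -/
def firstHit (W : ℝ≥0 → Ω → ℝ) (D : Set ℝ) (ω : Ω) : ℝ≥0 := sInf {s | W s ω ∈ D}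

lemma firstHit_mem (hc : ∀ ω, Continuous (W · ω)) {D : Set ℝ} (hD : IsClosed D) {ω : Ω}
    {t : ℝ≥0} (h : ω ∈ hitSet W D t) : W (firstHit W D ω) ω ∈ D := by
  obtain ⟨s, -, hs⟩ := h
  exact IsClosed.csInf_mem (s := {s | W s ω ∈ D}) (hD.preimage (hc ω)) ⟨s, hs⟩ (OrderBot.bddBelow _)

lemma firstHit_le_iff (hc : ∀ ω, Continuous (W · ω)) {D : Set ℝ} (hD : IsClosed D) {ω : Ω}
    {t : ℝ≥0} (h : ω ∈ hitSet W D t) (s : ℝ≥0) : firstHit W D ω ≤ s ↔ ω ∈ hitSet W D s :=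
  ⟨fun hs => ⟨_, hs, firstHit_mem hc hD h⟩,
    fun ⟨_, hr, hD'⟩ => (csInf_le (s := {s | W s ω ∈ D}) (OrderBot.bddBelow _) hD').trans hr⟩

section Grid

variable (W) (D : Set ℝ) (n : ℕ)

/-- The first hitting time of `D`, rounded up to the grid of mesh `1 / (n + 1)`, in units of
the mesh. -/
def gridHit (ω : Ω) : ℕ := ⌈((n : ℝ≥0) + 1) * firstHit W D ω⌉₊

/-- The event that `D` is visited up to time `1`, and this happens first in the `j`-th
interval of the grid. -/
def gridCell (j : ℕ) : Set Ω := hitSet W D 1 ∩ {ω | gridHit W D n ω = j}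

variable {W D n}

lemma gridHit_le_iff (hc : ∀ ω, Continuous (W · ω)) (hD : IsClosed D) {ω : Ω}
    (h : ω ∈ hitSet W D 1) (j : ℕ) :
    gridHit W D n ω ≤ j ↔ ω ∈ hitSet W D ((j : ℝ≥0) / ((n : ℝ≥0) + 1)) := by
  rw [gridHit, Nat.ceil_le, ← firstHit_le_iff hc hD h, le_div_iff₀ (by positivity), mul_comm]

lemma gridCell_eq_empty (hc : ∀ ω, Continuous (W · ω)) (hD : IsClosed D) {j : ℕ}
    (hj : n + 1 < j) : gridCell W D n j = ∅ := by
  ext ω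
  simp only [gridCell, Set.mem_inter_iff, Set.mem_ofPred_eq, Set.mem_empty_iff_false, iff_false,
    not_and]
  intro h h'
  have := (gridHit_le_iff (n := n) hc hD h (n + 1)).2 (by
    push_cast
    rwa [div_self (by positivity)])
  omega

/-- Describes the cell through visits by grid times up to j/(n+1) only; this makes the rounded-up
hitting time a stopping time for the grid. -/
lemma gridCell_eq (hc : ∀ ω, Continuous (W · ω)) (hD : IsClosed D) {j : ℕ} (hj : j ≤ n + 1) :
    gridCell W D n j = hitSet W D ((j : ℝ≥0) / ((n : ℝ≥0) + 1)) \
      ⋃ i ∈ Finset.range j, hitSet W D ((i : ℝ≥0) / ((n : ℝ≥0) + 1)) := by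
  have hj1 : (j : ℝ≥0) / ((n : ℝ≥0) + 1) ≤ 1 := by
    rw [div_le_one (by positivity)]
    exact_mod_cast hj
  ext ω
  simp only [gridCell, Set.mem_inter_iff, Set.mem_ofPred_eq, Set.mem_sdiff, Set.mem_iUnion,
    Finset.mem_range, not_exists]
  constructor
  · rintro ⟨h, h'⟩
    refine ⟨(gridHit_le_iff hc hD h j).1 h'.le, fun i hi hh => ?_⟩
    have := (gridHit_le_iff (n := n) hc hD h i).2 hh
    omega
  · rintro ⟨h, h'⟩
    have h1 := hitSet_mono W D hj1 h
    refine ⟨h1, le_antisymm ((gridHit_le_iff hc hD h1 j).2 h) ?_⟩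
    by_contra! hlt
    exact h' _ hlt ((gridHit_le_iff hc hD h1 _).1 le_rfl)

lemma measurableSet_pastAlgebra_gridCell (hc : ∀ ω, Continuous (W · ω)) (hD : IsClosed D)
    (hne : D.Nonempty) {j : ℕ} (hj : j ≤ n + 1) :
    MeasurableSet[pastAlgebra W ((j : ℝ≥0) / ((n : ℝ≥0) + 1))] (gridCell W D n j) := by
  rw [gridCell_eq hc hD hj]
  refine MeasurableSet.diff (measurableSet_pastAlgebra_hitSet hc hD hne _) ?_
  refine Finset.measurableSet_biUnion _ fun i hi => ?_
  refine pastAlgebra_mono W ?_ _ (measurableSet_pastAlgebra_hitSet hc hD hne _)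
  gcongr
  exact (Finset.mem_range.1 hi).le

lemma iUnion_gridCell : ⋃ j, gridCell W D n j = hitSet W D 1 := by
  ext ω; simp [gridCell]

lemma pairwise_disjoint_gridCell : Pairwise (Function.onFun Disjoint (gridCell W D n)) := by
  intro i j hij
  rw [Function.onFun, Set.disjoint_left]
  rintro ω ⟨-, h1⟩ ⟨-, h2⟩
  exact hij (h1.symm.trans h2)

lemma measurableSet_gridCell [MeasurableSpace Ω] {P : Measure Ω} (hW : IsRegularBrownian W P)
    (hD : IsClosed D) (hne : D.Nonempty) (j : ℕ) : MeasurableSet (gridCell W D n j) := by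
  by_cases hj : j ≤ n + 1
  · exact pastAlgebra_le hW.measurable_eval _ _
      (measurableSet_pastAlgebra_gridCell hW.continuous_path hD hne hj)
  · rw [gridCell_eq_empty hW.continuous_path hD (by omega)]
    exact MeasurableSet.empty

/-- The reflected end point of the path, with the first visit rounded up to the grid. -/
def gridReflected (W : ℝ≥0 → Ω → ℝ) (D : Set ℝ) (n : ℕ) (ω : Ω) : ℝ :=
  2 * W ((gridHit W D n ω : ℝ≥0) / ((n : ℝ≥0) + 1)) ω - W 1 ω

lemma aemeasurable_gridReflected [MeasurableSpace Ω] {P : Measure Ω}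
    (hW : IsRegularBrownian W P) (hD : IsClosed D) (hne : D.Nonempty) :
    AEMeasurable (gridReflected W D n) (P.restrict (hitSet W D 1)) := by
  rw [← iUnion_gridCell (n := n), aemeasurable_iUnion_iff]
  intro j
  refine AEMeasurable.congr (f := fun ω => 2 * W ((j : ℝ≥0) / ((n : ℝ≥0) + 1)) ω - W 1 ω) ?_ ?_
  · exact (((hW.measurable_eval _).const_mul 2).sub (hW.measurable_eval 1)).aemeasurable
  · filter_upwards [ae_restrict_mem (measurableSet_gridCell hW hD hne j)] with ω hω
    simp [gridReflected, hω.2.symm]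

/-- The grid time exceeds the first visit by at most one mesh width. This holds for every path: if
`D` is never visited, `firstHit` is the infimum of the empty set, which is 0. -/
lemma tendsto_gridReflected (hc : ∀ ω, Continuous (W · ω)) (ω : Ω) :
    Tendsto (fun n => gridReflected W D n ω) atTop
      (𝓝 (2 * W (firstHit W D ω) ω - W 1 ω)) := by
  refine Tendsto.sub_const (Tendsto.const_mul 2 (((hc ω).tendsto _).comp ?_)) _
  rw [← NNReal.tendsto_coe]
  have hlim : Tendsto (fun n : ℕ => (firstHit W D ω : ℝ) + 1 / ((n : ℝ) + 1)) atTop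
      (𝓝 (firstHit W D ω : ℝ)) := by
    simpa using (tendsto_const_nhds (x := (firstHit W D ω : ℝ))).add
      (tendsto_one_div_add_atTop_nhds_zero_nat (𝕜 := ℝ))
  refine tendsto_of_tendsto_of_tendsto_of_le_of_le tendsto_const_nhds hlim
    (fun n => ?_) (fun n => ?_)
  · have h : (((n : ℝ≥0) + 1) * firstHit W D ω) ≤ gridHit W D n ω := Nat.le_ceil _
    rw [← NNReal.coe_le_coe] at h
    push_cast at h ⊢
    rw [le_div_iff₀ (by positivity)]
    linarith
  · have h : (gridHit W D n ω : ℝ≥0) < ((n : ℝ≥0) + 1) * firstHit W D ω + 1 :=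
      Nat.ceil_lt_add_one zero_le
    rw [← NNReal.coe_lt_coe] at h
    push_cast at h ⊢
    rw [div_le_iff₀ (by positivity), add_mul, one_div_mul_cancel (by positivity)]
    linarith

/-- On each cell the reflection time is a constant and the cell lies in the past of that time, so
the deterministic reflection applies cell by cell. -/
lemma setIntegral_gridReflected [MeasurableSpace Ω] {P : Measure Ω} (hW : IsRegularBrownian W P)
    (hD : IsClosed D) (hne : D.Nonempty) (n : ℕ) (g : BoundedContinuousFunction ℝ ℝ) :
    ∫ ω in hitSet W D 1, g (gridReflected W D n ω) ∂P = ∫ ω in hitSet W D 1, g (W 1 ω) ∂P := by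
  have : IsProbabilityMeasure P := hW.isGaussianProcess.isProbabilityMeasure
  have hbd : ∀ x, ‖g x‖ ≤ ‖g‖ := g.norm_coe_le_norm
  have i1 : IntegrableOn (fun ω => g (gridReflected W D n ω)) (hitSet W D 1) P :=
    Integrable.of_bound (g.continuous.measurable.comp_aemeasurable
      (aemeasurable_gridReflected hW hD hne)).aestronglyMeasurable ‖g‖
      (ae_of_all _ fun _ => hbd _)
  have i2 : IntegrableOn (fun ω => g (W 1 ω)) (hitSet W D 1) P :=
    Integrable.of_bound (g.continuous.measurable.comp
      (hW.measurable_eval 1)).aestronglyMeasurable ‖g‖ (ae_of_all _ fun _ => hbd _)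
  rw [← iUnion_gridCell (n := n)] at i1 i2 ⊢
  rw [integral_iUnion (measurableSet_gridCell hW hD hne) pairwise_disjoint_gridCell i1,
    integral_iUnion (measurableSet_gridCell hW hD hne) pairwise_disjoint_gridCell i2]
  congr 1
  ext j
  by_cases hj : j ≤ n + 1
  · rw [hW.setIntegral_reflect (t := (j : ℝ≥0) / ((n : ℝ≥0) + 1)) ?_
      (measurableSet_pastAlgebra_gridCell hW.continuous_path hD hne hj) g.continuous.measurable]
    · refine setIntegral_congr_fun (measurableSet_gridCell hW hD hne j) fun ω hω => ?_
      simp [gridReflected, hω.2.symm]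
    · rw [div_le_one (by positivity)]
      exact_mod_cast hj
  · rw [gridCell_eq_empty hW.continuous_path hD (by omega)]
    simp

end Grid

variable [MeasurableSpace Ω] {P : Measure Ω} {D : Set ℝ}

/-- The reflection principle: on the event that `D` is visited up to time `1`, the end point of the
path has the same law as its reflection at the point of first visit. -/
theorem IsRegularBrownian.aemeasurable_reflected_and_map_eq (hW : IsRegularBrownian W P)
    (hD : IsClosed D) (hne : D.Nonempty) :
    AEMeasurable (fun ω => 2 * W (firstHit W D ω) ω - W 1 ω) (P.restrict (hitSet W D 1)) ∧
    (P.restrict (hitSet W D 1)).map (W 1) =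
      (P.restrict (hitSet W D 1)).map (fun ω => 2 * W (firstHit W D ω) ω - W 1 ω) := by
  have : IsProbabilityMeasure P := hW.isGaussianProcess.isProbabilityMeasure
  have hlim := tendsto_gridReflected (D := D) hW.continuous_path
  have hm : AEMeasurable (fun ω => 2 * W (firstHit W D ω) ω - W 1 ω)
      (P.restrict (hitSet W D 1)) :=
    aemeasurable_of_tendsto_metrizable_ae' (fun n => aemeasurable_gridReflected hW hD hne)
      (ae_of_all _ hlim)
  refine ⟨hm, ?_⟩
  -- Bounded continuous test functions determine a finite measure, and their continuity lets the
  -- mesh tend to 0 under the integral.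
  apply ext_of_forall_integral_eq_of_IsFiniteMeasure
  intro g
  rw [integral_map (hW.measurable_eval 1).aemeasurable g.continuous.aestronglyMeasurable,
    integral_map hm g.continuous.aestronglyMeasurable]
  have hconv := tendsto_integral_of_dominated_convergence (μ := P.restrict (hitSet W D 1))
    (F := fun n ω => g (gridReflected W D n ω)) (fun _ => ‖g‖)
    (fun n => (g.continuous.measurable.comp_aemeasurable
      (aemeasurable_gridReflected hW hD hne)).aestronglyMeasurable) (integrable_const _)
    (fun n => ae_of_all _ fun ω => g.norm_coe_le_norm _)
    (ae_of_all _ fun ω => (g.continuous.tendsto _).comp (hlim ω))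
  simp_rw [setIntegral_gridReflected hW hD hne] at hconv
  exact tendsto_nhds_unique tendsto_const_nhds hconv

/-- Reflecting at the first visit preserves the law of the end point on this event but changes the
sign of `f`, so the integral equals its own negative. -/
theorem IsRegularBrownian.setIntegral_hitSet_eq_zero (hW : IsRegularBrownian W P)
    (hD : IsClosed D) (hne : D.Nonempty) {f : ℝ → ℝ} (hf : Measurable f)
    (hanti : ∀ b ∈ D, ∀ z, f (2 * b - z) = -f z) :
    ∫ ω in hitSet W D 1, f (W 1 ω) ∂P = 0 := by
  obtain ⟨hm, he⟩ := hW.aemeasurable_reflected_and_map_eq hD hne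
  have hHm : MeasurableSet (hitSet W D 1) := pastAlgebra_le hW.measurable_eval 1 _
    (measurableSet_pastAlgebra_hitSet hW.continuous_path hD hne 1)
  have h1 : ∫ ω in hitSet W D 1, f (W 1 ω) ∂P
      = ∫ ω in hitSet W D 1, f (2 * W (firstHit W D ω) ω - W 1 ω) ∂P := by
    rw [← integral_map (hW.measurable_eval 1).aemeasurable hf.aestronglyMeasurable, he,
      integral_map hm hf.aestronglyMeasurable]
  have h2 : ∫ ω in hitSet W D 1, f (2 * W (firstHit W D ω) ω - W 1 ω) ∂P
      = ∫ ω in hitSet W D 1, -f (W 1 ω) ∂P :=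
    setIntegral_congr_fun hHm fun ω hω => hanti _ (firstHit_mem hW.continuous_path hD hω) _
  rw [integral_neg] at h2
  linarith

lemma IsRegularBrownian.measurableSet_hitSet (hW : IsRegularBrownian W P)
    (hD : IsClosed D) (hne : D.Nonempty) : MeasurableSet (hitSet W D 1) :=
  pastAlgebra_le hW.measurable_eval 1 _
    (measurableSet_pastAlgebra_hitSet hW.continuous_path hD hne 1)

lemma IsRegularBrownian.map_eval_one (hW : IsRegularBrownian W P) : P.map (W 1) = stdNormal := by
  have := (hW.hasLaw_eval 1).map_eq
  simpa using this

lemma IsRegularBrownian.setIntegral_compl_hitSet (hW : IsRegularBrownian W P)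
    (hD : IsClosed D) (hne : D.Nonempty) {f : ℝ → ℝ} (hf : Measurable f) {c : ℝ}
    (hb : ∀ x, |f x| ≤ c) (hanti : ∀ b ∈ D, ∀ z, f (2 * b - z) = -f z) :
    ∫ ω in (hitSet W D 1)ᶜ, f (W 1 ω) ∂P = ∫ x, f x ∂stdNormal := by
  have : IsProbabilityMeasure P := hW.isGaussianProcess.isProbabilityMeasure
  have hi : Integrable (fun ω => f (W 1 ω)) P :=
    Integrable.of_bound (hf.comp (hW.measurable_eval 1)).aestronglyMeasurable c
      (ae_of_all _ fun _ => hb _)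
  rw [← hW.map_eval_one, integral_map (hW.measurable_eval 1).aemeasurable hf.aestronglyMeasurable,
    ← integral_add_compl (hW.measurableSet_hitSet hD hne) hi,
    hW.setIntegral_hitSet_eq_zero hD hne hf hanti, zero_add]

lemma exists_eq_of_path {w : ℝ≥0 → ℝ} (hc : Continuous w) (h0 : w 0 = 0) {b : ℝ} {t : ℝ≥0}
    (h : b ∈ Set.uIcc 0 (w t)) : ∃ s ≤ t, w s = b := by
  have hI := intermediate_value_uIcc (a := (0 : ℝ≥0)) (b := t) hc.continuousOn
  rw [h0] at hI
  obtain ⟨s, hs, rfl⟩ := hI h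
  rw [Set.uIcc_of_le zero_le] at hs
  exact ⟨s, hs.2, rfl⟩

lemma stdNormal_real_Ici (x : ℝ) : stdNormal.real (Set.Ici x) = stdNormal.real (Set.Iic (-x)) := by
  have h1 : stdNormal.map (fun x => -x) = stdNormal := by
    rw [gaussianReal_map_neg]; simp
  have mp : MeasurePreserving (fun x : ℝ => -x) stdNormal stdNormal := ⟨measurable_neg, h1⟩
  rw [← mp.measureReal_preimage measurableSet_Iic.nullMeasurableSet]
  congr 1
  ext z
  simp

/-- The joint law of the end point and the maximum of a Brownian path. -/
theorem IsRegularBrownian.measureReal_le_forall_lt (hW : IsRegularBrownian W P) {x y : ℝ}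
    (hy : 0 < y) (hxy : x ≤ y) :
    P.real {ω | W 1 ω ≤ x ∧ ∀ s ≤ 1, W s ω < y}
      = stdNormal.real (Set.Iic x) - stdNormal.real (Set.Iic (x - 2 * y)) := by
  have : IsProbabilityMeasure P := hW.isGaussianProcess.isProbabilityMeasure
  -- The indicator of z ≤ x minus its mirror image in y. On paths staying below y the image
  -- vanishes, since W_1 < y ≤ 2y − x.
  let f : ℝ → ℝ := fun z => (Set.Iic x).indicator 1 z - (Set.Ici (2 * y - x)).indicator 1 z
  have hf : Measurable f := (measurable_one.indicator measurableSet_Iic).sub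
    (measurable_one.indicator measurableSet_Ici)
  have hD : IsClosed ({y} : Set ℝ) := isClosed_singleton
  have hne : ({y} : Set ℝ).Nonempty := Set.singleton_nonempty y
  have key := hW.setIntegral_compl_hitSet hD hne hf (c := 2) (fun z => by
    simp only [f, Set.indicator_apply, Pi.one_apply]
    split_ifs <;> norm_num) (fun b hb z => by
    rw [Set.mem_singleton_iff.1 hb]
    simp only [f, Set.indicator_apply, Pi.one_apply, Set.mem_Iic, Set.mem_Ici]
    simp only [show 2 * y - z ≤ x ↔ 2 * y - x ≤ z by constructor <;> intro <;> linarith,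
      show 2 * y - x ≤ 2 * y - z ↔ z ≤ x by constructor <;> intro <;> linarith]
    ring)
  have hlt : ∀ ω, ω ∉ hitSet W {y} 1 ↔ ∀ s ≤ 1, W s ω < y := by
    intro ω
    constructor
    · intro h s hs
      by_contra! hc
      obtain ⟨r, hr, hr'⟩ := exists_eq_of_path (hW.continuous_path ω) (hW.eval_zero ω)
        (b := y) (t := s) (Set.mem_uIcc.2 (Or.inl ⟨hy.le, hc⟩))
      exact h ⟨r, hr.trans hs, hr'⟩
    · rintro h ⟨s, hs, hs'⟩
      exact (h s hs).ne hs'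
  have e1 : ∫ ω in (hitSet W {y} 1)ᶜ, f (W 1 ω) ∂P
      = ∫ ω in (hitSet W {y} 1)ᶜ, (W 1 ⁻¹' Set.Iic x).indicator 1 ω ∂P := by
    refine setIntegral_congr_fun (hW.measurableSet_hitSet hD hne).compl fun ω hω => ?_
    have := (hlt ω).1 hω 1 le_rfl
    simp only [f]
    rw [Set.indicator_of_notMem (s := Set.Ici (2 * y - x)) (by simp; linarith), sub_zero]
    rfl
  have hmx : MeasurableSet (W 1 ⁻¹' Set.Iic x) := hW.measurable_eval 1 measurableSet_Iic
  rw [e1, integral_indicator_one hmx, measureReal_restrict_apply hmx] at key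
  have e2 : ∫ z, f z ∂stdNormal
      = stdNormal.real (Set.Iic x) - stdNormal.real (Set.Ici (2 * y - x)) := by
    simp only [f]
    rw [integral_sub ((integrable_const 1).indicator measurableSet_Iic)
      ((integrable_const 1).indicator measurableSet_Ici), integral_indicator_one measurableSet_Iic,
      integral_indicator_one measurableSet_Ici]
  rw [e2, stdNormal_real_Ici, neg_sub] at key
  rw [← key]
  congr 1
  ext ω
  simp [hlt ω]

/-- The square wave of half-period one. -/
def squareWave (u : ℝ) : ℝ := (-1 : ℝ) ^ ⌊u⌋

@[fun_prop]
lemma measurable_squareWave : Measurable squareWave :=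
  (measurable_of_countable fun n : ℤ => (-1 : ℝ) ^ n).comp Int.measurable_floor

lemma abs_squareWave (u : ℝ) : |squareWave u| = 1 := by
  simp [squareWave, abs_zpow]

lemma squareWave_add_two (u : ℝ) : squareWave (u + 2) = squareWave u := by
  have : ⌊u + 2⌋ = ⌊u⌋ + 2 := by exact_mod_cast Int.floor_add_natCast u 2
  rw [squareWave, this, zpow_add₀ (by norm_num)]
  simp [squareWave]

/-- At integers the wave is even, not odd, so the exclusion is needed; there are only countably many
exceptions. -/
lemma squareWave_neg {u : ℝ} (h : ∀ n : ℤ, (n : ℝ) ≠ u) : squareWave (-u) = -squareWave u := by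
  have h1 : ⌊u⌋ < u := lt_of_le_of_ne (Int.floor_le u) (h _)
  have : ⌊-u⌋ = -⌊u⌋ - 1 := by
    rw [Int.floor_eq_iff]
    push_cast
    have := Int.lt_floor_add_one u
    constructor <;> linarith
  rw [squareWave, this, zpow_sub₀ (by norm_num), squareWave, zpow_neg]
  have : ((-1 : ℝ) ^ ⌊u⌋)⁻¹ = (-1 : ℝ) ^ ⌊u⌋ := by
    rw [← inv_zpow]; norm_num
  rw [this, zpow_one, div_neg, div_one]

/-- The probability that a Brownian path stays between two barriers. -/
theorem IsRegularBrownian.measureReal_forall_mem_Ioo (hW : IsRegularBrownian W P) {x y : ℝ}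
    (hx : 0 < x) (hy : 0 < y) :
    P.real {ω | ∀ s ≤ 1, W s ω ∈ Set.Ioo (-x) y}
      = ∫ z, squareWave ((z + x) / (x + y)) ∂stdNormal := by
  have : IsProbabilityMeasure P := hW.isGaussianProcess.isProbabilityMeasure
  have hL : 0 < x + y := by positivity
  -- The affine map `u` sends the barriers −x and y to 0 and 1. The wave is antisymmetrised so that
  -- `f` is odd about 0 at every point; period 2 then makes it odd about 1 as well. On (0, 1) it
  -- equals 1.
  let u : ℝ → ℝ := fun z => (z + x) / (x + y)
  let f : ℝ → ℝ := fun z => (squareWave (u z) - squareWave (-u z)) / 2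
  have hf : Measurable f := by
    simp only [f, u]
    fun_prop
  have hD : IsClosed ({-x, y} : Set ℝ) := (Set.toFinite _).isClosed
  have hne : ({-x, y} : Set ℝ).Nonempty := ⟨y, by simp⟩
  have key := hW.setIntegral_compl_hitSet hD hne hf (c := 1) (fun z => by
    simp only [f, abs_div]
    have := abs_sub (squareWave (u z)) (squareWave (-u z))
    rw [abs_squareWave, abs_squareWave] at this
    rw [abs_two, div_le_one (by norm_num)]
    linarith) (fun b hb z => by
    simp only [f]
    rcases hb with rfl | rfl
    · have : u (2 * -x - z) = -u z := by simp only [u]; field_simp; ring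
      rw [this, neg_neg]; ring
    · have e : u (2 * b - z) = -u z + 2 := by simp only [u]; field_simp; ring
      have e' : squareWave (u z) = squareWave (-(-u z + 2)) := by
        rw [← squareWave_add_two (-(-u z + 2))]; congr 1; ring
      rw [e, squareWave_add_two, ← e']; ring)
  have hin : ∀ ω, ω ∉ hitSet W {-x, y} 1 ↔ ∀ s ≤ 1, W s ω ∈ Set.Ioo (-x) y := by
    intro ω
    constructor
    · intro h s hs
      constructor
      · by_contra! hc
        obtain ⟨r, hr, hr'⟩ := exists_eq_of_path (hW.continuous_path ω) (hW.eval_zero ω)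
          (b := -x) (t := s) (Set.mem_uIcc.2 (Or.inr ⟨hc, by linarith⟩))
        exact h ⟨r, hr.trans hs, by simp [hr']⟩
      · by_contra! hc
        obtain ⟨r, hr, hr'⟩ := exists_eq_of_path (hW.continuous_path ω) (hW.eval_zero ω)
          (b := y) (t := s) (Set.mem_uIcc.2 (Or.inl ⟨hy.le, hc⟩))
        exact h ⟨r, hr.trans hs, by simp [hr']⟩
    · rintro h ⟨s, hs, hs' | hs'⟩
      · exact (h s hs).1.ne hs'.symm
      · exact (h s hs).2.ne hs'
  have e1 : ∫ ω in (hitSet W {-x, y} 1)ᶜ, f (W 1 ω) ∂P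
      = ∫ ω in (hitSet W {-x, y} 1)ᶜ, (1 : ℝ) ∂P := by
    refine setIntegral_congr_fun (hW.measurableSet_hitSet hD hne).compl fun ω hω => ?_
    obtain ⟨h1, h2⟩ := (hin ω).1 hω 1 le_rfl
    have hu0 : 0 < u (W 1 ω) := div_pos (by linarith) hL
    have hu1 : u (W 1 ω) < 1 := (div_lt_one hL).2 (by linarith)
    have f1 : ⌊u (W 1 ω)⌋ = 0 := Int.floor_eq_zero_iff.2 ⟨hu0.le, hu1⟩
    have f2 : ⌊-u (W 1 ω)⌋ = -1 := by
      rw [Int.floor_eq_iff]; push_cast; constructor <;> linarith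
    simp only [f, squareWave, f1, f2]
    norm_num
  rw [e1, setIntegral_const, smul_eq_mul, mul_one] at key
  have hnull : ∀ᵐ z ∂stdNormal, ∀ n : ℤ, (n : ℝ) ≠ u z := by
    rw [ae_all_iff]
    intro n
    have : ∀ᵐ z ∂stdNormal, z ≠ n * (x + y) - x := by
      rw [ae_iff]; simp
    filter_upwards [this] with z hz h
    apply hz
    simp only [u] at h
    rw [eq_div_iff hL.ne'] at h
    linarith
  have e2 : ∫ z, f z ∂stdNormal = ∫ z, squareWave (u z) ∂stdNormal := by
    apply integral_congr_ae
    filter_upwards [hnull] with z hz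
    simp only [f]
    rw [squareWave_neg hz]; ring
  rw [e2] at key
  rw [← key]
  congr 1
  ext ω
  rw [Set.mem_compl_iff, hin ω]
  rfl

end Reflection

/-! ### Existence of copulas and their values at coordinate one -/

noncomputable section Copula

open Filter Topology

lemma continuous_cdf_of_measure_singleton {μ : Measure ℝ} [IsProbabilityMeasure μ]
    (h : ∀ x, μ {x} = 0) : Continuous (cdf μ) := by
  rw [continuous_iff_continuousAt]
  intro a
  have h1 := (cdf μ).measure_singleton a
  rw [measure_cdf, h a, eq_comm, ENNReal.ofReal_eq_zero] at h1
  rw [(monotone_cdf μ).continuousAt_iff_leftLim_eq_rightLim, (cdf μ).rightLim_eq]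
  exact le_antisymm ((monotone_cdf μ).leftLim_le le_rfl) (by linarith)

/-- Probability integral transform. For u < 1 the set is empty, forcing u = 0, or a half-line (−∞,
a], where continuity gives cdf(a) = u. -/
lemma measureReal_cdf_le {μ : Measure ℝ} [IsProbabilityMeasure μ] (h : ∀ x, μ {x} = 0) {u : ℝ}
    (h0 : 0 ≤ u) (h1 : u ≤ 1) : μ.real {x | cdf μ x ≤ u} = u := by
  have hc := continuous_cdf_of_measure_singleton h
  rcases h1.eq_or_lt with rfl | h1
  · rw [show {x | cdf μ x ≤ 1} = Set.univ from Set.eq_univ_of_forall fun x => cdf_le_one μ x]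
    exact probReal_univ
  rcases Set.eq_empty_or_nonempty {x | cdf μ x ≤ u} with he | hne
  · rw [he, measureReal_empty]
    refine le_antisymm h0 ?_
    by_contra! hu
    obtain ⟨x, hx⟩ := ((tendsto_cdf_atBot μ).eventually_lt_const hu).exists
    have : x ∈ {x | cdf μ x ≤ u} := hx.le
    rw [he] at this
    exact this
  · have hcl : IsClosed {x | cdf μ x ≤ u} := isClosed_le hc continuous_const
    obtain ⟨b, hb⟩ := ((tendsto_cdf_atTop μ).eventually_const_lt h1).exists
    have hbdd : BddAbove {x | cdf μ x ≤ u} := by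
      refine ⟨b, fun x hx => ?_⟩
      by_contra! hbx
      exact absurd (monotone_cdf μ hbx.le) (not_le.2 (lt_of_le_of_lt hx hb))
    set a := sSup {x | cdf μ x ≤ u} with ha
    have haS : cdf μ a ≤ u := hcl.csSup_mem hne hbdd
    have hIic : {x | cdf μ x ≤ u} = Set.Iic a := by
      ext x
      exact ⟨fun hx => le_csSup hbdd hx, fun hx => (monotone_cdf μ hx).trans haS⟩
    rw [hIic, ← cdf_eq_real]
    refine le_antisymm haS ?_
    have ht : Tendsto (cdf μ) (𝓝[>] a) (𝓝 (cdf μ a)) := hc.continuousWithinAt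
    refine ge_of_tendsto ht ?_
    filter_upwards [self_mem_nhdsWithin] with x hx
    by_contra! hlt
    exact absurd (le_csSup hbdd (show x ∈ {x | cdf μ x ≤ u} from hlt.le)) (not_le.2 hx)

variable {Ω : Type*} [MeasurableSpace Ω] {P : Measure Ω}

lemma isCopula_of_uniform_marginals [IsProbabilityMeasure P] {n : ℕ} {U : Fin n → Ω → ℝ}
    (hU : ∀ i, Measurable (U i))
    (hunif : ∀ i, ∀ u ∈ Set.Icc (0 : ℝ) 1, P.real {ω | U i ω ≤ u} = u) :
    IsCopula fun u : Fin n → ℝ => P.real {ω | ∀ i, U i ω ≤ u i} where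
  mem_unit _ _ := ⟨measureReal_nonneg, measureReal_le_one⟩
  grounded u _ := by
    rintro ⟨i, hi⟩
    refine le_antisymm ?_ measureReal_nonneg
    have h := hunif i 0 ⟨le_rfl, zero_le_one⟩
    rw [← h]
    exact measureReal_mono fun ω hω => by simpa [hi] using hω i
  margin u hu j hj := by
    have h1 : ∀ i, i ≠ j → ∀ᵐ ω ∂P, U i ω ≤ u i := by
      intro i hij
      have h := hunif i 1 ⟨zero_le_one, le_rfl⟩
      rw [measureReal_def, ENNReal.toReal_eq_one_iff] at h
      rw [hj i hij]
      exact (prob_compl_eq_zero_iff₀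
        (measurableSet_le (hU i) measurable_const).nullMeasurableSet).2 h
    have h2 : ∀ᵐ ω ∂P, ∀ i, i ≠ j → U i ω ≤ u i := by
      rw [ae_all_iff]
      intro i
      by_cases hij : i = j
      · simp [hij]
      · filter_upwards [h1 i hij] with ω hω _ using hω
    rw [← hunif j (u j) ⟨hu.1 j, hu.2 j⟩]
    apply measureReal_congr
    filter_upwards [h2] with ω hω
    apply propext
    refine ⟨fun h => h j, fun h i => ?_⟩
    by_cases hij : i = j
    · rw [hij]; exact h
    · exact hω i hij
  volume_nonneg u _ v _ huv := by
    classical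
    have hm : ∀ w : Fin n → ℝ, MeasurableSet {ω | ∀ i, U i ω ≤ w i} := fun w =>
      MeasurableSet.congr (MeasurableSet.iInter fun i => measurableSet_le (hU i)
        (measurable_const (a := w i))) (by ext; simp)
    have e : ∀ w : Fin n → ℝ, P.real {ω | ∀ i, U i ω ≤ w i}
        = ∫ ω, ∏ i, (Set.Iic (w i)).indicator 1 (U i ω) ∂P := by
      intro w
      rw [← integral_indicator_one (hm w)]
      congr 1
      ext ω
      by_cases h : ∀ i, U i ω ≤ w i
      · rw [Set.indicator_of_mem (show ω ∈ {ω | ∀ i, U i ω ≤ w i} from h), Finset.prod_eq_one]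
        · rfl
        · intro i _
          rw [Set.indicator_of_mem (Set.mem_Iic.2 (h i))]; rfl
      · rw [Set.indicator_of_notMem (show ω ∉ {ω | ∀ i, U i ω ≤ w i} from h)]
        push Not at h
        obtain ⟨i, hi⟩ := h
        rw [Finset.prod_eq_zero (Finset.mem_univ i)]
        rw [Set.indicator_of_notMem]
        simpa using hi
    simp_rw [e, ← integral_const_mul]
    rw [← integral_finsetSum]
    · refine integral_nonneg fun ω => ?_
      -- The signed sum over vertices is the expectation of the product of the differences 1{U_i ≤
      -- v_i} − 1{U_i ≤ u_i}, all nonnegative.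
      have hprod := Finset.prod_sub (fun i => (Set.Iic (v i)).indicator (1 : ℝ → ℝ) (U i ω))
        (fun i => (Set.Iic (u i)).indicator (1 : ℝ → ℝ) (U i ω)) Finset.univ
      have hle : 0 ≤ ∏ i, ((Set.Iic (v i)).indicator (1 : ℝ → ℝ) (U i ω)
          - (Set.Iic (u i)).indicator (1 : ℝ → ℝ) (U i ω)) := by
        refine Finset.prod_nonneg fun i _ => sub_nonneg.2 ?_
        exact Set.indicator_le_indicator_of_subset (Set.Iic_subset_Iic.2 (huv i))
          (fun _ => zero_le_one) _
      rw [hprod, Finset.powerset_univ] at hle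
      refine hle.trans_eq (Finset.sum_congr rfl fun S _ => ?_)
      rw [mul_assoc]
      congr 1
      rw [← Finset.prod_sdiff (Finset.subset_univ S)]
      congr 1
      · refine Finset.prod_congr rfl fun i hi => ?_
        rw [if_neg (Finset.mem_sdiff.1 hi).2]
      · refine Finset.prod_congr rfl fun i hi => ?_
        rw [if_pos hi]
    · intro S _
      refine Integrable.const_mul ?_ _
      refine Integrable.of_bound (C := 1) ?_ (ae_of_all _ fun ω => ?_)
      · refine (Finset.measurable_fun_prod _ fun i _ => ?_).aestronglyMeasurable
        exact (measurable_one.indicator measurableSet_Iic).comp (hU i)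
      · rw [norm_prod]
        refine Finset.prod_le_one (fun _ _ => norm_nonneg _) fun i _ => ?_
        exact (norm_indicator_le_norm_self _ _).trans (by simp)

/-- Sklar's theorem for continuous marginals. -/
theorem exists_isCopulaOf [IsProbabilityMeasure P] {n : ℕ} {X : Fin n → Ω → ℝ}
    (hX : ∀ i, Measurable (X i)) (hatom : ∀ i x, P {ω | X i ω = x} = 0) :
    ∃ C, IsCopulaOf C X P := by
  have hprob : ∀ i, IsProbabilityMeasure (P.map (X i)) := fun i =>
    Measure.isProbabilityMeasure_map (hX i).aemeasurable
  have hsing : ∀ i x, P.map (X i) {x} = 0 := by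
    intro i x
    rw [Measure.map_apply (hX i) (measurableSet_singleton x)]
    exact hatom i x
  have hcdf : ∀ i x, P.real {ω | X i ω ≤ x} = cdf (P.map (X i)) x := by
    intro i x
    rw [cdf_eq_real, map_measureReal_apply (hX i) measurableSet_Iic]
    rfl
  let U : Fin n → Ω → ℝ := fun i ω => cdf (P.map (X i)) (X i ω)
  have hU : ∀ i, Measurable (U i) := fun i =>
    (continuous_cdf_of_measure_singleton (hsing i)).measurable.comp (hX i)
  have hunif : ∀ i, ∀ u ∈ Set.Icc (0 : ℝ) 1, P.real {ω | U i ω ≤ u} = u := by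
    intro i u hu
    have hm : MeasurableSet {x | cdf (P.map (X i)) x ≤ u} := measurableSet_le
      (continuous_cdf_of_measure_singleton (hsing i)).measurable measurable_const
    have h := measureReal_cdf_le (hsing i) hu.1 hu.2
    rwa [map_measureReal_apply (hX i) hm] at h
  refine ⟨_, isCopula_of_uniform_marginals hU hunif, fun x => ?_⟩
  -- The event {X_i ≤ x_i} is contained in {U_i ≤ F_i(x_i)} and has the same probability, so the two
  -- agree almost surely.
  have hae : ∀ᵐ ω ∂P, ∀ i, U i ω ≤ P.real {ω | X i ω ≤ x i} → X i ω ≤ x i := by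
    rw [ae_all_iff]
    intro i
    have hsub : {ω | X i ω ≤ x i} ⊆ {ω | U i ω ≤ P.real {ω | X i ω ≤ x i}} := by
      intro ω hω
      rw [Set.mem_ofPred_eq, hcdf]
      exact monotone_cdf _ hω
    have h1 := hunif i (P.real {ω | X i ω ≤ x i}) ⟨measureReal_nonneg, measureReal_le_one⟩
    have h2 := ae_eq_of_subset_of_measure_ge (μ := P) hsub (by
      rw [measureReal_def, measureReal_def] at h1
      exact ((ENNReal.toReal_eq_toReal_iff' (measure_ne_top _ _) (measure_ne_top _ _)).1 h1).le)
      (measurableSet_le (hX i) measurable_const).nullMeasurableSet (measure_ne_top _ _)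
    filter_upwards [h2] with ω hω
    exact (iff_of_eq hω).2
  apply measureReal_congr
  filter_upwards [hae] with ω hω
  apply propext
  refine ⟨fun h i => ?_, fun h i => hω i (h i)⟩
  simp only [U]
  rw [hcdf]
  exact monotone_cdf _ (h i)

lemma IsCopulaOf.congr {Ω' : Type*} [MeasurableSpace Ω'] {P' : Measure Ω'} {n : ℕ}
    {C : (Fin n → ℝ) → ℝ} {X : Fin n → Ω → ℝ} {Y : Fin n → Ω' → ℝ} (h : IsCopulaOf C X P)
    (hj : ∀ x : Fin n → ℝ, P.real {ω | ∀ i, X i ω ≤ x i} = P'.real {ω | ∀ i, Y i ω ≤ x i})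
    (hm : ∀ i x, P.real {ω | X i ω ≤ x} = P'.real {ω | Y i ω ≤ x}) : IsCopulaOf C Y P' :=
  ⟨h.1, fun x => by simp_rw [← hj, ← hm]; exact h.2 x⟩

lemma isCopulaOf_const_mul_iff {n : ℕ} {C : (Fin n → ℝ) → ℝ} {X : Fin n → Ω → ℝ} {c : ℝ}
    (hc : 0 < c) : IsCopulaOf C (fun i ω => c * X i ω) P ↔ IsCopulaOf C X P := by
  have e : ∀ a b : ℝ, c * a ≤ b ↔ a ≤ b / c := fun a b => by rw [le_div_iff₀' hc]
  constructor
  · intro h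
    refine ⟨h.1, fun x => ?_⟩
    have := h.2 fun i => c * x i
    simp only [e, mul_div_cancel_left₀ _ hc.ne'] at this
    exact this
  · intro h
    refine ⟨h.1, fun x => ?_⟩
    simp only [e]
    exact h.2 fun i => x i / c

section Trivariate

variable {C : (Fin 3 → ℝ) → ℝ}

lemma vec3_mem_Icc {a b c : ℝ} (ha : a ∈ Set.Icc (0 : ℝ) 1) (hb : b ∈ Set.Icc (0 : ℝ) 1)
    (hc : c ∈ Set.Icc (0 : ℝ) 1) : (![a, b, c] : Fin 3 → ℝ) ∈ Set.Icc (0 : Fin 3 → ℝ) 1 := by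
  constructor <;> intro i <;> fin_cases i <;> simp [ha.1, ha.2, hb.1, hb.2, hc.1, hc.2]

lemma IsCopula.volume_three (hC : IsCopula C) {a b c a' b' c' : ℝ}
    (ha : 0 ≤ a) (ha' : a ≤ a') (ha1 : a' ≤ 1) (hb : 0 ≤ b) (hb' : b ≤ b') (hb1 : b' ≤ 1)
    (hc : 0 ≤ c) (hc' : c ≤ c') (hc1 : c' ≤ 1) :
    0 ≤ C ![a', b', c'] - C ![a, b', c'] - C ![a', b, c'] - C ![a', b', c]
      + C ![a, b, c'] + C ![a, b', c] + C ![a', b, c] - C ![a, b, c] := by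
  have h := hC.volume_nonneg ![a, b, c] (vec3_mem_Icc ⟨ha, ha'.trans ha1⟩ ⟨hb, hb'.trans hb1⟩
    ⟨hc, hc'.trans hc1⟩) ![a', b', c'] (vec3_mem_Icc ⟨ha.trans ha', ha1⟩ ⟨hb.trans hb', hb1⟩
    ⟨hc.trans hc', hc1⟩) (by intro i; fin_cases i <;> simpa)
  have hv : ∀ S : Finset (Fin 3), (fun i => if i ∈ S then (![a, b, c] : Fin 3 → ℝ) i
      else (![a', b', c'] : Fin 3 → ℝ) i) = ![if 0 ∈ S then a else a', if 1 ∈ S then b else b',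
        if 2 ∈ S then c else c'] := by
    intro S; ext i; fin_cases i <;> simp
  simp_rw [hv] at h
  rw [show (Finset.univ : Finset (Finset (Fin 3))) = {∅, {0}, {1}, {2}, {0, 1}, {0, 2}, {1, 2},
    {0, 1, 2}} by decide] at h
  rw [Finset.sum_insert (by decide), Finset.sum_insert (by decide), Finset.sum_insert (by decide),
    Finset.sum_insert (by decide), Finset.sum_insert (by decide), Finset.sum_insert (by decide),
    Finset.sum_insert (by decide), Finset.sum_singleton] at h
  simp at h
  linarith

lemma IsCopula.zero_of_eq_zero (hC : IsCopula C) {a b c : ℝ} (ha : a ∈ Set.Icc (0 : ℝ) 1)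
    (hb : b ∈ Set.Icc (0 : ℝ) 1) (hc : c ∈ Set.Icc (0 : ℝ) 1) (h : a = 0 ∨ b = 0 ∨ c = 0) :
    C ![a, b, c] = 0 := by
  refine hC.grounded _ (vec3_mem_Icc ha hb hc) ?_
  rcases h with h | h | h
  exacts [⟨0, h⟩, ⟨1, h⟩, ⟨2, h⟩]

/-- Monotonicity is the volume of the box [s,1] × [0,b] × [0,c]. The upper bound enlarges b and then
c to 1, using the boxes [s,1] × [b,1] × [0,c] and [s,1] × [0,1] × [c,1], after which the margin
gives 1 − s. -/
lemma IsCopula.abs_sub_one_fst (hC : IsCopula C) {s b c : ℝ} (hs : s ∈ Set.Icc (0 : ℝ) 1)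
    (hb : b ∈ Set.Icc (0 : ℝ) 1) (hc : c ∈ Set.Icc (0 : ℝ) 1) :
    |C ![1, b, c] - C ![s, b, c]| ≤ 1 - s := by
  have o : (1 : ℝ) ∈ Set.Icc (0 : ℝ) 1 := ⟨zero_le_one, le_rfl⟩
  have z : (0 : ℝ) ∈ Set.Icc (0 : ℝ) 1 := ⟨le_rfl, zero_le_one⟩
  have h1 := hC.volume_three hs.1 hs.2 le_rfl le_rfl hb.1 hb.2 le_rfl hc.1 hc.2
  have h2 := hC.volume_three hs.1 hs.2 le_rfl hb.1 hb.2 le_rfl le_rfl hc.1 hc.2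
  have h3 := hC.volume_three hs.1 hs.2 le_rfl le_rfl zero_le_one le_rfl hc.1 hc.2 le_rfl
  have m1 := hC.margin ![1, 1, 1] (vec3_mem_Icc o o o) 0 (by intro i _; fin_cases i <;> rfl)
  have m2 := hC.margin ![s, 1, 1] (vec3_mem_Icc hs o o) 0 (by
    intro i hi; fin_cases i
    · exact absurd rfl hi
    · rfl
    · rfl)
  simp only [Matrix.cons_val_zero] at m1 m2
  have g : ∀ x y : ℝ, x ∈ Set.Icc (0 : ℝ) 1 → y ∈ Set.Icc (0 : ℝ) 1 →
      C ![x, 0, y] = 0 ∧ C ![x, y, 0] = 0 := fun x y hx hy =>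
    ⟨hC.zero_of_eq_zero hx z hy (by simp), hC.zero_of_eq_zero hx hy z (by simp)⟩
  simp only [g, o, z, hs, hb, hc] at h1 h2 h3
  rw [abs_le]
  constructor <;> linarith

lemma IsCopula.abs_sub_one_snd (hC : IsCopula C) {a s c : ℝ} (ha : a ∈ Set.Icc (0 : ℝ) 1)
    (hs : s ∈ Set.Icc (0 : ℝ) 1) (hc : c ∈ Set.Icc (0 : ℝ) 1) :
    |C ![a, 1, c] - C ![a, s, c]| ≤ 1 - s := by
  have o : (1 : ℝ) ∈ Set.Icc (0 : ℝ) 1 := ⟨zero_le_one, le_rfl⟩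
  have z : (0 : ℝ) ∈ Set.Icc (0 : ℝ) 1 := ⟨le_rfl, zero_le_one⟩
  have h1 := hC.volume_three le_rfl ha.1 ha.2 hs.1 hs.2 le_rfl le_rfl hc.1 hc.2
  have h2 := hC.volume_three ha.1 ha.2 le_rfl hs.1 hs.2 le_rfl le_rfl hc.1 hc.2
  have h3 := hC.volume_three le_rfl zero_le_one le_rfl hs.1 hs.2 le_rfl hc.1 hc.2 le_rfl
  have m1 := hC.margin ![1, 1, 1] (vec3_mem_Icc o o o) 1 (by intro i _; fin_cases i <;> rfl)
  have m2 := hC.margin ![1, s, 1] (vec3_mem_Icc o hs o) 1 (by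
    intro i hi; fin_cases i
    · rfl
    · exact absurd rfl hi
    · rfl)
  simp only [Matrix.cons_val_one, Matrix.cons_val_zero] at m1 m2
  have g : ∀ x y : ℝ, x ∈ Set.Icc (0 : ℝ) 1 → y ∈ Set.Icc (0 : ℝ) 1 →
      C ![0, x, y] = 0 ∧ C ![x, y, 0] = 0 := fun x y hx hy =>
    ⟨hC.zero_of_eq_zero z hx hy (by simp), hC.zero_of_eq_zero hx hy z (by simp)⟩
  simp only [g, o, z, hs, ha, hc] at h1 h2 h3
  rw [abs_le]
  constructor <;> linarith

variable {X : Fin 3 → Ω → ℝ}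

lemma measureReal_le_mem_Icc [IsProbabilityMeasure P] (X : Ω → ℝ) (x : ℝ) :
    P.real {ω | X ω ≤ x} ∈ Set.Icc (0 : ℝ) 1 := ⟨measureReal_nonneg, measureReal_le_one⟩

lemma tendsto_measureReal_le_atTop [IsProbabilityMeasure P] (X : Ω → ℝ) (A : Set Ω) :
    Tendsto (fun k : ℕ => P.real (A ∩ {ω | X ω ≤ k})) atTop (𝓝 (P.real A)) := by
  have h := tendsto_measure_iUnion_atTop (μ := P) (s := fun k : ℕ => A ∩ {ω | X ω ≤ k})
    (fun i j hij ω hω => ⟨hω.1, le_trans (b := (i : ℝ)) hω.2 (by exact_mod_cast hij)⟩)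
  have hU : ⋃ k : ℕ, A ∩ {ω | X ω ≤ k} = A := by
    ext ω
    simp only [Set.mem_iUnion, Set.mem_inter_iff, Set.mem_ofPred_eq, exists_and_left,
      and_iff_left_iff_imp]
    exact fun _ => exists_nat_ge _
  rw [hU] at h
  exact (ENNReal.tendsto_toReal (measure_ne_top _ _)).comp h

lemma IsCopulaOf.apply_vec3 (h : IsCopulaOf C X P) (x y z : ℝ) :
    C ![P.real {ω | X 0 ω ≤ x}, P.real {ω | X 1 ω ≤ y}, P.real {ω | X 2 ω ≤ z}]
      = P.real {ω | X 0 ω ≤ x ∧ X 1 ω ≤ y ∧ X 2 ω ≤ z} := by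
  have := h.2 ![x, y, z]
  have e : (fun i => P.real {ω | X i ω ≤ (![x, y, z] : Fin 3 → ℝ) i})
      = ![P.real {ω | X 0 ω ≤ x}, P.real {ω | X 1 ω ≤ y}, P.real {ω | X 2 ω ≤ z}] := by
    ext i; fin_cases i <;> rfl
  rw [e] at this
  rw [← this]
  congr 1
  ext ω
  simp only [Fin.forall_fin_succ, Set.mem_ofPred_eq]
  simp

/-- A distribution function need not attain 1, so the defining identity may say nothing at this
coordinate. The value is the limit along P(X_0 ≤ k) → 1, by the Lipschitz bound at 1. -/
lemma IsCopulaOf.apply_one_fst [IsProbabilityMeasure P] (h : IsCopulaOf C X P) (y z : ℝ) :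
    C ![1, P.real {ω | X 1 ω ≤ y}, P.real {ω | X 2 ω ≤ z}]
      = P.real {ω | X 1 ω ≤ y ∧ X 2 ω ≤ z} := by
  have h1 := tendsto_measureReal_le_atTop (P := P) (X 0) {ω | X 1 ω ≤ y ∧ X 2 ω ≤ z}
  have h2 := tendsto_measureReal_le_atTop (P := P) (X 0) Set.univ
  rw [probReal_univ] at h2
  simp only [Set.univ_inter] at h2
  refine tendsto_nhds_unique (f := fun k : ℕ => C ![P.real {ω | X 0 ω ≤ k},
    P.real {ω | X 1 ω ≤ y}, P.real {ω | X 2 ω ≤ z}]) (l := atTop) ?_ ?_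
  · rw [tendsto_iff_norm_sub_tendsto_zero]
    refine squeeze_zero (fun _ => norm_nonneg _) (fun k => ?_)
      (show Tendsto (fun k : ℕ => 1 - P.real {ω | X 0 ω ≤ k}) atTop (𝓝 0) by
        simpa using h2.const_sub 1)
    rw [norm_sub_rev]
    exact h.1.abs_sub_one_fst (measureReal_le_mem_Icc _ _) (measureReal_le_mem_Icc _ _)
      (measureReal_le_mem_Icc _ _)
  · refine h1.congr fun k => ?_
    rw [h.apply_vec3]
    congr 1
    ext ω
    simp only [Set.mem_inter_iff, Set.mem_ofPred_eq]
    tauto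

lemma IsCopulaOf.apply_one_snd [IsProbabilityMeasure P] (h : IsCopulaOf C X P) (x z : ℝ) :
    C ![P.real {ω | X 0 ω ≤ x}, 1, P.real {ω | X 2 ω ≤ z}]
      = P.real {ω | X 0 ω ≤ x ∧ X 2 ω ≤ z} := by
  have h1 := tendsto_measureReal_le_atTop (P := P) (X 1) {ω | X 0 ω ≤ x ∧ X 2 ω ≤ z}
  have h2 := tendsto_measureReal_le_atTop (P := P) (X 1) Set.univ
  rw [probReal_univ] at h2
  simp only [Set.univ_inter] at h2
  refine tendsto_nhds_unique (f := fun k : ℕ => C ![P.real {ω | X 0 ω ≤ x},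
    P.real {ω | X 1 ω ≤ k}, P.real {ω | X 2 ω ≤ z}]) (l := atTop) ?_ ?_
  · rw [tendsto_iff_norm_sub_tendsto_zero]
    refine squeeze_zero (fun _ => norm_nonneg _) (fun k => ?_)
      (show Tendsto (fun k : ℕ => 1 - P.real {ω | X 1 ω ≤ k}) atTop (𝓝 0) by
        simpa using h2.const_sub 1)
    rw [norm_sub_rev]
    exact h.1.abs_sub_one_snd (measureReal_le_mem_Icc _ _) (measureReal_le_mem_Icc _ _)
      (measureReal_le_mem_Icc _ _)
  · refine h1.congr fun k => ?_
    rw [h.apply_vec3]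
    congr 1
    ext ω
    simp only [Set.mem_inter_iff, Set.mem_ofPred_eq]
    tauto

end Trivariate

end Copula

/-! ### Scaling, and the joint laws of end point, maximum and minimum -/

noncomputable section ExtremaLaw

open Filter Topology

/-- The standard normal distribution function. -/
def normalCdf (x : ℝ) : ℝ := stdNormal.real (Set.Iic x)

lemma normalCdf_eq_cdf : normalCdf = cdf stdNormal := by
  ext x; rw [cdf_eq_real]; rfl

lemma continuous_normalCdf : Continuous normalCdf := by
  rw [normalCdf_eq_cdf]
  exact continuous_cdf_of_measure_singleton fun x => measure_singleton x

lemma normalCdf_neg (x : ℝ) : normalCdf (-x) = 1 - normalCdf x := by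
  rw [normalCdf, ← stdNormal_real_Ici, normalCdf, ← probReal_compl_eq_one_sub measurableSet_Iic,
    Set.compl_Iic]
  exact measureReal_congr Ioi_ae_eq_Ici.symm

/-- The distribution function, on the half-line, of the maximum of a Brownian path up to
time `1`. -/
def maxCdf (y : ℝ) : ℝ := normalCdf y - normalCdf (-y)

lemma continuous_maxCdf : Continuous maxCdf :=
  continuous_normalCdf.sub (continuous_normalCdf.comp continuous_neg)

lemma maxCdf_zero : maxCdf 0 = 0 := by simp [maxCdf]

section Path

variable {Ω : Type*} {W : ℝ≥0 → Ω → ℝ} {ω : Ω}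

lemma runningMax_lt_iff (hc : Continuous (W · ω)) {t : ℝ≥0} {y : ℝ} :
    runningMax W t ω < y ↔ ∀ s ≤ t, W s ω < y := by
  rw [runningMax, isCompact_Icc.sSup_lt_iff_of_continuous ⟨0, by simp⟩ hc.continuousOn]
  simp

lemma lt_runningMin_iff (hc : Continuous (W · ω)) {t : ℝ≥0} {y : ℝ} :
    y < runningMin W t ω ↔ ∀ s ≤ t, y < W s ω := by
  rw [runningMin, isCompact_Icc.lt_sInf_iff_of_continuous ⟨0, by simp⟩ hc.continuousOn]
  simp

lemma runningMin_eq_neg_runningMax_neg (W : ℝ≥0 → Ω → ℝ) (t : ℝ≥0) (ω : Ω) :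
    runningMin W t ω = -runningMax (-W) t ω := by
  rw [runningMin, runningMax, Real.sInf_def, ← Set.image_neg_eq_neg, Set.image_image]
  rfl

lemma runningMin_le_neg_iff (W : ℝ≥0 → Ω → ℝ) (ω : Ω) (y : ℝ) :
    runningMin W 1 ω ≤ -y ↔ y ≤ runningMax (-W) 1 ω := by
  rw [runningMin_eq_neg_runningMax_neg, neg_le_neg_iff]

lemma le_runningMax (hc : Continuous (W · ω)) {s t : ℝ≥0} (h : s ≤ t) :
    W s ω ≤ runningMax W t ω := by
  by_contra! hlt
  exact lt_irrefl _ ((runningMax_lt_iff hc).1 hlt s h)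

/-- By continuity countably many times suffice. So the triple is a measurable function of the path,
and its law depends only on the law of the process. -/
lemma runningMax_eq_iSup_denseSeq (hc : Continuous (W · ω)) (t : ℝ≥0) :
    runningMax W t ω = ⨆ k, W (TopologicalSpace.denseSeq (Set.Iic t) k) ω := by
  set q := TopologicalSpace.denseSeq (Set.Iic t) with hq
  have hbdd : BddAbove (Set.range fun k => W (q k) ω) :=
    ⟨runningMax W t ω, by rintro _ ⟨k, rfl⟩; exact le_runningMax hc (q k).2⟩
  refine le_antisymm ?_ (ciSup_le fun k => le_runningMax hc (q k).2)
  have hcl : IsClosed {s : Set.Iic t | W s ω ≤ ⨆ k, W (q k) ω} :=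
    isClosed_le (hc.comp continuous_subtype_val) continuous_const
  have hall : ∀ s : Set.Iic t, W s ω ≤ ⨆ k, W (q k) ω := by
    intro s
    refine (TopologicalSpace.denseRange_denseSeq (Set.Iic t)).induction_on
      (p := fun s : Set.Iic t => W s ω ≤ ⨆ k, W (q k) ω) s hcl fun k => ?_
    exact le_ciSup hbdd k
  refine csSup_le ⟨W 0 ω, 0, by simp, rfl⟩ ?_
  rintro _ ⟨s, hs, rfl⟩
  exact hall ⟨s, hs.2⟩

/-- The triple (end point, maximum, minimum) at time `1`, as a function of a path. -/
def pathTriple : Fin 3 → (ℝ≥0 → ℝ) → ℝ :=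
  ![fun w => w 1, fun w => ⨆ k, w (TopologicalSpace.denseSeq (Set.Iic (1 : ℝ≥0)) k),
    fun w => -⨆ k, -w (TopologicalSpace.denseSeq (Set.Iic (1 : ℝ≥0)) k)]

lemma measurable_pathTriple (i : Fin 3) : Measurable (pathTriple i) := by
  fin_cases i
  · exact measurable_pi_apply _
  · exact Measurable.iSup fun k => measurable_pi_apply _
  · have h : ∀ s : ℝ≥0, Measurable fun w : ℝ≥0 → ℝ => -w s := fun s =>
      (measurable_pi_apply s).neg
    exact (Measurable.iSup fun k => h _).neg

lemma wienerTriple_one_eq (hc : Continuous (W · ω)) (i : Fin 3) :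
    wienerTriple W 1 i ω = pathTriple i (fun s => W s ω) := by
  fin_cases i
  · rfl
  · exact runningMax_eq_iSup_denseSeq hc 1
  · change runningMin W 1 ω = _
    rw [runningMin_eq_neg_runningMax_neg, runningMax_eq_iSup_denseSeq (W := -W) hc.neg]
    rfl

lemma runningMax_scale (W : ℝ≥0 → Ω → ℝ) {c : ℝ} (hc : 0 ≤ c) {t : ℝ≥0} (ht : 0 < t) (ω : Ω) :
    runningMax (fun s ω => c * W (t * s) ω) 1 ω = c * runningMax W t ω ∧
    runningMin (fun s ω => c * W (t * s) ω) 1 ω = c * runningMin W t ω := by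
  open scoped Pointwise in
  have h : (fun s => c * W (t * s) ω) '' Set.Icc 0 1 = c • ((fun s => W s ω) '' Set.Icc 0 t) := by
    ext z
    simp only [Set.mem_image, Set.mem_smul_set, smul_eq_mul, exists_exists_and_eq_and]
    constructor
    · rintro ⟨s, hs, rfl⟩
      exact ⟨t * s, ⟨zero_le, by simpa using mul_le_mul_right hs.2 t⟩, rfl⟩
    · rintro ⟨s, hs, rfl⟩
      exact ⟨s / t, ⟨zero_le, (div_le_one ht).2 hs.2⟩, by rw [mul_div_cancel₀ _ ht.ne']⟩
  constructor
  · rw [runningMax, h, Real.sSup_smul_of_nonneg hc]; rfl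
  · rw [runningMin, h, Real.sInf_smul_of_nonneg hc]; rfl

lemma wienerTriple_scale (W : ℝ≥0 → Ω → ℝ) {c : ℝ} (hc : 0 ≤ c) {t : ℝ≥0} (ht : 0 < t) :
    wienerTriple (fun s ω => c * W (t * s) ω) 1 = fun i ω => c * wienerTriple W t i ω := by
  ext i ω
  fin_cases i
  · simp [wienerTriple]
  · exact (runningMax_scale W hc ht ω).1
  · exact (runningMax_scale W hc ht ω).2

end Path

variable {Ω : Type*} [MeasurableSpace Ω] {P : Measure Ω} {W V : ℝ≥0 → Ω → ℝ}

lemma IsRegularBrownian.measurable_wienerTriple (hW : IsRegularBrownian W P) (i : Fin 3) :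
    Measurable (wienerTriple W 1 i) := by
  have : wienerTriple W 1 i = fun ω => pathTriple i (fun s => W s ω) :=
    funext fun ω => wienerTriple_one_eq (hW.continuous_path ω) i
  rw [this]
  exact (measurable_pathTriple i).comp (measurable_pi_lambda _ hW.measurable_eval)

lemma IsRegularBrownian.map_path_eq (hW : IsRegularBrownian W P) (hV : IsRegularBrownian V P) :
    P.map (fun ω s => W s ω) = P.map (fun ω s => V s ω) := by
  have : IsProbabilityMeasure P := hW.isGaussianProcess.isProbabilityMeasure
  rw [map_eq_iff_forall_finset_map_restrict_eq
    (measurable_pi_lambda _ hW.measurable_eval).aemeasurable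
    (measurable_pi_lambda _ hV.measurable_eval).aemeasurable]
  intro I
  rw [(hW.hasLaw I).map_eq, (hV.hasLaw I).map_eq]

lemma IsRegularBrownian.measureReal_wienerTriple (hW : IsRegularBrownian W P) {S : Set (Fin 3 → ℝ)}
    (hS : MeasurableSet S) : P.real {ω | (fun i => wienerTriple W 1 i ω) ∈ S} =
      (P.map fun ω s => W s ω).real {w | (fun i => pathTriple i w) ∈ S} := by
  have hm : MeasurableSet {w | (fun i => pathTriple i w) ∈ S} :=
    measurable_pi_lambda _ measurable_pathTriple hS
  rw [map_measureReal_apply (measurable_pi_lambda _ hW.measurable_eval) hm]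
  congr 1
  ext ω
  simp only [Set.mem_ofPred_eq, Set.mem_preimage]
  rw [funext fun i => wienerTriple_one_eq (hW.continuous_path ω) i]

lemma IsRegularBrownian.isCopulaOf_wienerTriple {C : (Fin 3 → ℝ) → ℝ}
    (hW : IsRegularBrownian W P) (hV : IsRegularBrownian V P)
    (h : IsCopulaOf C (wienerTriple W 1) P) : IsCopulaOf C (wienerTriple V 1) P := by
  refine h.congr (fun x => ?_) fun i x => ?_
  · have hS : MeasurableSet {y : Fin 3 → ℝ | ∀ i, y i ≤ x i} := measurableSet_Iic (a := x)
    have h1 := hW.measureReal_wienerTriple hS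
    rw [hW.map_path_eq hV, ← hV.measureReal_wienerTriple hS] at h1
    exact h1
  · have hS : MeasurableSet {y : Fin 3 → ℝ | y i ≤ x} :=
      measurableSet_le (measurable_pi_apply i) measurable_const
    have h1 := hW.measureReal_wienerTriple hS
    rw [hW.map_path_eq hV, ← hV.measureReal_wienerTriple hS] at h1
    exact h1

lemma isCopulaOf_wienerTriple_congr {C : (Fin 3 → ℝ) → ℝ} {t : ℝ≥0}
    (h : ∀ᵐ ω ∂P, ∀ t, W t ω = V t ω) (hC : IsCopulaOf C (wienerTriple W t) P) :
    IsCopulaOf C (wienerTriple V t) P := by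
  have he : ∀ᵐ ω ∂P, ∀ i, wienerTriple W t i ω = wienerTriple V t i ω := by
    filter_upwards [h] with ω hω i
    have : (fun s => W s ω) = fun s => V s ω := funext hω
    fin_cases i
    · exact hω t
    · change runningMax W t ω = runningMax V t ω
      rw [runningMax, runningMax, this]
    · change runningMin W t ω = runningMin V t ω
      rw [runningMin, runningMin, this]
  refine hC.congr (fun x => measureReal_congr ?_) fun i x => measureReal_congr ?_
  · filter_upwards [he] with ω hω
    apply propext
    change (∀ i, _ ≤ _) ↔ (∀ i, _ ≤ _)
    simp_rw [hω]
  · filter_upwards [he] with ω hω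
    apply propext
    change _ ≤ _ ↔ _ ≤ _
    rw [hω i]

/-- By Brownian scaling, the copulas of `(W_t, M_t, m_t)` are those of a regular Brownian motion
at time `1`. -/
theorem isCopulaOf_wienerTriple_iff {C : (Fin 3 → ℝ) → ℝ} (hW : IsBrownianReal W P)
    (hV : IsRegularBrownian V P) {t : ℝ≥0} (ht : 0 < t) :
    IsCopulaOf C (wienerTriple W t) P ↔ IsCopulaOf C (wienerTriple V 1) P := by
  -- With c = t^(−1/2) the process s ↦ c W(ts) is again Brownian, and its triple at time 1 is c
  -- times the triple of W at time t.
  have hc : 0 < (√(t : ℝ))⁻¹ := inv_pos.2 (Real.sqrt_pos.2 (by exact_mod_cast ht))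
  obtain ⟨V', hV', he⟩ := exists_isRegularBrownian (hW.smul ht.ne')
  rw [← isCopulaOf_const_mul_iff hc, ← wienerTriple_scale W hc.le ht]
  constructor
  · intro h
    exact hV'.isCopulaOf_wienerTriple hV (isCopulaOf_wienerTriple_congr he h)
  · intro h
    refine isCopulaOf_wienerTriple_congr ?_ (hV.isCopulaOf_wienerTriple hV' h)
    filter_upwards [he] with ω hω s using (hω s).symm

lemma IsRegularBrownian.neg (hW : IsRegularBrownian W P) : IsRegularBrownian (-W) P where
  toIsPreBrownianReal := hW.toIsPreBrownianReal.neg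
  measurable_eval t := (hW.measurable_eval t).neg
  continuous_path ω := (hW.continuous_path ω).neg
  eval_zero ω := by simp [hW.eval_zero ω]

lemma IsRegularBrownian.isProbabilityMeasure (hW : IsRegularBrownian W P) :
    IsProbabilityMeasure P := hW.isGaussianProcess.isProbabilityMeasure

lemma IsRegularBrownian.measurable_runningMax (hW : IsRegularBrownian W P) :
    Measurable (runningMax W 1) := hW.measurable_wienerTriple 1

lemma IsRegularBrownian.runningMax_nonneg (hW : IsRegularBrownian W P) (ω : Ω) :
    0 ≤ runningMax W 1 ω := by
  rw [← hW.eval_zero ω]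
  exact le_runningMax (hW.continuous_path ω) zero_le_one

lemma IsRegularBrownian.measureReal_runningMax_lt (hW : IsRegularBrownian W P) {y : ℝ}
    (hy : 0 ≤ y) : P.real {ω | runningMax W 1 ω < y} = maxCdf y := by
  rcases hy.eq_or_lt with rfl | hy
  · rw [maxCdf_zero]
    convert measureReal_empty
    ext ω
    simpa using hW.runningMax_nonneg ω
  · have h := hW.measureReal_le_forall_lt hy le_rfl
    rw [show y - 2 * y = -y by ring] at h
    rw [maxCdf, normalCdf, normalCdf, ← h]
    congr 1
    ext ω
    simp only [Set.mem_ofPred_eq, runningMax_lt_iff (hW.continuous_path ω)]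
    exact ⟨fun h => ⟨(h 1 le_rfl).le, h⟩, fun h => h.2⟩

/-- Only P(M < y) is known so far; its continuity in y rules out atoms. -/
lemma IsRegularBrownian.measure_runningMax_eq (hW : IsRegularBrownian W P) (y : ℝ) :
    P {ω | runningMax W 1 ω = y} = 0 := by
  have := hW.isProbabilityMeasure
  rcases lt_or_ge y 0 with hy | hy
  · convert measure_empty (μ := P)
    ext ω
    simpa using (hy.trans_le (hW.runningMax_nonneg ω)).ne'
  have hle : ∀ ε : ℝ, 0 < ε → P.real {ω | runningMax W 1 ω = y} ≤ maxCdf (y + ε) - maxCdf y := by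
    intro ε hε
    rw [← hW.measureReal_runningMax_lt (show 0 ≤ y + ε by linarith),
      ← hW.measureReal_runningMax_lt hy, le_sub_iff_add_le, ← measureReal_union]
    · refine measureReal_mono ?_
      rintro ω (h | h)
      · simp only [Set.mem_ofPred_eq] at h ⊢; linarith
      · simp only [Set.mem_ofPred_eq] at h ⊢; linarith
    · rw [Set.disjoint_left]
      intro ω h h'
      simp only [Set.mem_ofPred_eq] at h h'
      linarith
    · exact measurableSet_lt hW.measurable_runningMax measurable_const
  have hlim : Tendsto (fun ε : ℝ => maxCdf (y + ε) - maxCdf y) (𝓝[>] 0) (𝓝 0) := by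
    have : Continuous fun ε : ℝ => maxCdf (y + ε) - maxCdf y :=
      (continuous_maxCdf.comp (continuous_const.add continuous_id)).sub continuous_const
    have h := (this.tendsto 0).mono_left (nhdsWithin_le_nhds (s := Set.Ioi 0))
    simpa using h
  have h0 : P.real {ω | runningMax W 1 ω = y} ≤ 0 :=
    ge_of_tendsto hlim (by filter_upwards [self_mem_nhdsWithin] with ε hε using hle ε hε)
  have h1 := le_antisymm h0 measureReal_nonneg
  rwa [measureReal_eq_zero_iff] at h1

lemma IsRegularBrownian.ae_runningMax_ne (hW : IsRegularBrownian W P) (y : ℝ) :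
    ∀ᵐ ω ∂P, runningMax W 1 ω ≠ y := by
  rw [ae_iff]
  simpa using hW.measure_runningMax_eq y

lemma IsRegularBrownian.ae_eval_ne (hW : IsRegularBrownian W P) (x : ℝ) :
    ∀ᵐ ω ∂P, W 1 ω ≠ x := by
  have h : P.map (W 1) {x} = 0 := by rw [hW.map_eval_one]; exact measure_singleton x
  rw [Measure.map_apply (hW.measurable_eval 1) (measurableSet_singleton x)] at h
  rw [ae_iff]
  convert h using 2
  ext ω
  simp

/-- The common copula of the triples exists. -/
lemma IsRegularBrownian.exists_isCopulaOf (hW : IsRegularBrownian W P) :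
    ∃ C, IsCopulaOf C (wienerTriple W 1) P := by
  have := hW.isProbabilityMeasure
  refine _root_.exists_isCopulaOf hW.measurable_wienerTriple fun i x => ?_
  fin_cases i
  · have h := hW.ae_eval_ne x
    rw [ae_iff] at h
    simp only [ne_eq, not_not] at h
    exact h
  · exact hW.measure_runningMax_eq x
  · have h := hW.neg.measure_runningMax_eq (-x)
    convert h using 2
    ext ω
    change runningMin W 1 ω = x ↔ _
    rw [runningMin_eq_neg_runningMax_neg, neg_eq_iff_eq_neg]
    rfl

lemma IsRegularBrownian.measureReal_eval_le (hW : IsRegularBrownian W P) (x : ℝ) :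
    P.real {ω | W 1 ω ≤ x} = normalCdf x := by
  rw [normalCdf, ← hW.map_eval_one, map_measureReal_apply (hW.measurable_eval 1) measurableSet_Iic]
  rfl

lemma IsRegularBrownian.measureReal_runningMax_le (hW : IsRegularBrownian W P) {y : ℝ}
    (hy : 0 ≤ y) : P.real {ω | runningMax W 1 ω ≤ y} = maxCdf y := by
  rw [← hW.measureReal_runningMax_lt hy]
  apply measureReal_congr
  filter_upwards [hW.ae_runningMax_ne y] with ω hω
  exact propext ⟨fun h => lt_of_le_of_ne h hω, fun h => le_of_lt h⟩

/-- The joint distribution function of the end point and the maximum of a Brownian path. -/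
def endMaxCdf (x y : ℝ) : ℝ := normalCdf (min x y) - normalCdf (min x y - 2 * y)

/-- Since W_1 ≤ M_1, the bound x may be lowered to min(x, y), which meets the requirement x ≤ y of
the reflection formula. -/
lemma IsRegularBrownian.measureReal_eval_le_runningMax_le (hW : IsRegularBrownian W P) (x : ℝ)
    {y : ℝ} (hy : 0 < y) :
    P.real {ω | W 1 ω ≤ x ∧ runningMax W 1 ω ≤ y} = endMaxCdf x y := by
  have h := hW.measureReal_le_forall_lt hy (min_le_right x y)
  rw [endMaxCdf, normalCdf, normalCdf, ← h]
  apply measureReal_congr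
  filter_upwards [hW.ae_runningMax_ne y] with ω hω
  apply propext
  change (W 1 ω ≤ x ∧ runningMax W 1 ω ≤ y) ↔ (W 1 ω ≤ min x y ∧ ∀ s ≤ 1, W s ω < y)
  rw [← runningMax_lt_iff (hW.continuous_path ω), le_min_iff]
  have h1 := le_runningMax (hW.continuous_path ω) (le_refl (1 : ℝ≥0))
  constructor
  · rintro ⟨ha, hb⟩
    exact ⟨⟨ha, h1.trans hb⟩, lt_of_le_of_ne hb hω⟩
  · rintro ⟨⟨ha, _⟩, hb⟩
    exact ⟨ha, hb.le⟩

lemma IsRegularBrownian.measureReal_runningMin_le_neg (hW : IsRegularBrownian W P) {y : ℝ}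
    (hy : 0 ≤ y) : P.real {ω | runningMin W 1 ω ≤ -y} = 1 - maxCdf y := by
  have := hW.isProbabilityMeasure
  rw [← hW.neg.measureReal_runningMax_lt hy, ← probReal_compl_eq_one_sub
    (measurableSet_lt hW.neg.measurable_runningMax measurable_const)]
  congr 1
  ext ω
  simp [runningMin_le_neg_iff W ω y]

/-- Up to null sets the event is the complement of {−W_1 ≤ −x} ∪ {max(−W) ≤ y}; inclusion–exclusion
and the law for −W give the formula. -/
lemma IsRegularBrownian.measureReal_eval_le_runningMin_le_neg (hW : IsRegularBrownian W P)
    (x : ℝ) {y : ℝ} (hy : 0 < y) :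
    P.real {ω | W 1 ω ≤ x ∧ runningMin W 1 ω ≤ -y}
      = 1 - normalCdf (-x) - maxCdf y + endMaxCdf (-x) y := by
  have := hW.isProbabilityMeasure
  have hA : MeasurableSet {ω | (-W) 1 ω ≤ -x} :=
    measurableSet_le (hW.neg.measurable_eval 1) measurable_const
  have hB : MeasurableSet {ω | runningMax (-W) 1 ω ≤ y} :=
    measurableSet_le hW.neg.measurable_runningMax measurable_const
  have e1 := measureReal_union_add_inter (μ := P) (s := {ω | (-W) 1 ω ≤ -x}) hB
  have e2 := probReal_compl_eq_one_sub (μ := P) (hA.union hB)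
  have e3 := hW.neg.measureReal_eval_le_runningMax_le (-x) hy
  rw [hW.neg.measureReal_eval_le, hW.neg.measureReal_runningMax_le hy.le] at e1
  have e4 : P.real ({ω | (-W) 1 ω ≤ -x} ∩ {ω | runningMax (-W) 1 ω ≤ y})
      = endMaxCdf (-x) y := e3
  have e5 : P.real {ω | W 1 ω ≤ x ∧ runningMin W 1 ω ≤ -y}
      = P.real ({ω | (-W) 1 ω ≤ -x} ∪ {ω | runningMax (-W) 1 ω ≤ y})ᶜ := by
    apply measureReal_congr
    filter_upwards [hW.neg.ae_runningMax_ne y, hW.ae_eval_ne x] with ω h1 h2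
    apply propext
    change (W 1 ω ≤ x ∧ runningMin W 1 ω ≤ -y) ↔ ¬ (-W 1 ω ≤ -x ∨ runningMax (-W) 1 ω ≤ y)
    rw [runningMin_le_neg_iff W ω y]
    push Not
    rw [neg_lt_neg_iff]
    exact ⟨fun h => ⟨lt_of_le_of_ne h.1 h2, lt_of_le_of_ne h.2 h1.symm⟩,
      fun h => ⟨h.1.le, h.2.le⟩⟩
  rw [e5, e2]
  linarith

/-- The probability that a Brownian path stays in `(-x, y)` up to time `1`. -/
def stayProb (x y : ℝ) : ℝ := ∫ z, squareWave ((z + x) / (x + y)) ∂stdNormal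

lemma IsRegularBrownian.measureReal_runningMax_le_runningMin_le_neg (hW : IsRegularBrownian W P)
    {x y : ℝ} (hx : 0 < x) (hy : 0 < y) :
    P.real {ω | runningMax W 1 ω ≤ y ∧ runningMin W 1 ω ≤ -x} = maxCdf y - stayProb x y := by
  have := hW.isProbabilityMeasure
  have hB : MeasurableSet {ω | x ≤ runningMax (-W) 1 ω} :=
    measurableSet_le measurable_const hW.neg.measurable_runningMax
  have e1 := measureReal_inter_add_sdiff (μ := P) (s := {ω | runningMax W 1 ω ≤ y}) hB
  rw [hW.measureReal_runningMax_le hy.le] at e1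
  rw [stayProb, ← hW.measureReal_forall_mem_Ioo hx hy, ← e1, eq_sub_iff_add_eq]
  congr 1
  · congr 1
    ext ω
    simp [runningMin_le_neg_iff W ω x]
  · apply measureReal_congr
    filter_upwards [hW.ae_runningMax_ne y] with ω h1
    apply propext
    change (∀ s ≤ 1, W s ω ∈ Set.Ioo (-x) y) ↔
      (runningMax W 1 ω ≤ y ∧ ¬ (x ≤ runningMax (-W) 1 ω))
    rw [← runningMin_le_neg_iff W ω x, not_le,
      lt_runningMin_iff (hW.continuous_path ω)]
    constructor
    · intro h
      exact ⟨((runningMax_lt_iff (hW.continuous_path ω)).2 fun s hs => (h s hs).2).le,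
        fun s hs => (h s hs).1⟩
    · rintro ⟨h2, h3⟩ s hs
      exact ⟨h3 s hs, (runningMax_lt_iff (hW.continuous_path ω)).1 (lt_of_le_of_ne h2 h1) s hs⟩

end ExtremaLaw

/-! ### Spearman's rho for the end point with the maximum or the minimum -/

noncomputable section SpearmanIntegrals

open Filter Topology

lemma continuous_gaussianPDFReal_zero_one : Continuous (gaussianPDFReal 0 1) := by
  unfold gaussianPDFReal; fun_prop

lemma normalCdf_eq_integral (x : ℝ) :
    normalCdf x = ∫ t in Set.Iic x, gaussianPDFReal 0 1 t := by
  rw [normalCdf, measureReal_def, gaussianReal_apply_eq_integral 0 one_ne_zero,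
    ENNReal.toReal_ofReal (integral_nonneg fun t => gaussianPDFReal_nonneg 0 1 t)]

lemma hasDerivAt_normalCdf (x : ℝ) : HasDerivAt normalCdf (gaussianPDFReal 0 1 x) x := by
  have hi := integrable_gaussianPDFReal 0 1
  have h : normalCdf = fun x => normalCdf 0 + ∫ t in (0 : ℝ)..x, gaussianPDFReal 0 1 t := by
    ext x
    rw [normalCdf_eq_integral, normalCdf_eq_integral,
      ← intervalIntegral.integral_Iic_sub_Iic hi.integrableOn hi.integrableOn]
    ring
  rw [h]
  exact (continuous_gaussianPDFReal_zero_one.integral_hasStrictDerivAt 0 x).hasDerivAt.const_add _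

lemma strictMono_normalCdf : StrictMono normalCdf :=
  strictMono_of_hasDerivAt_pos hasDerivAt_normalCdf fun x =>
    gaussianPDFReal_pos 0 1 x one_ne_zero

lemma normalCdf_zero : normalCdf 0 = 1 / 2 := by
  have := normalCdf_neg 0
  rw [neg_zero] at this
  linarith

lemma maxCdf_eq (y : ℝ) : maxCdf y = 2 * normalCdf y - 1 := by
  rw [maxCdf, normalCdf_neg]; ring

lemma range_normalCdf : normalCdf '' Set.univ = Set.Ioo 0 1 := by
  ext u
  rw [Set.image_univ]
  constructor
  · rintro ⟨x, rfl⟩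
    have h0 : 0 ≤ normalCdf (x - 1) := measureReal_nonneg
    have h1 : normalCdf (x + 1) ≤ 1 := measureReal_le_one
    exact ⟨h0.trans_lt (strictMono_normalCdf (by linarith)),
      (strictMono_normalCdf (by linarith)).trans_le h1⟩
  · rintro ⟨h0, h1⟩
    have hb := tendsto_cdf_atBot stdNormal
    have ht := tendsto_cdf_atTop stdNormal
    rw [← normalCdf_eq_cdf] at hb ht
    obtain ⟨a, ha⟩ := (hb.eventually_lt_const h0).exists
    obtain ⟨b, hb⟩ := (ht.eventually_const_lt h1).exists
    exact mem_range_of_exists_le_of_exists_ge continuous_normalCdf ⟨a, ha.le⟩ ⟨b, hb.le⟩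

lemma image_maxCdf_Ioi : maxCdf '' Set.Ioi 0 = Set.Ioo 0 1 := by
  ext u
  constructor
  · rintro ⟨x, hx, rfl⟩
    have h1 : normalCdf x ∈ Set.Ioo 0 1 := by rw [← range_normalCdf]; exact ⟨x, trivial, rfl⟩
    have h2 := strictMono_normalCdf hx
    rw [normalCdf_zero] at h2
    rw [maxCdf_eq]
    exact ⟨by linarith, by linarith [h1.2]⟩
  · rintro ⟨h0, h1⟩
    have h2 : (1 + u) / 2 ∈ normalCdf '' Set.univ := by
      rw [range_normalCdf]; exact ⟨by linarith, by linarith⟩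
    obtain ⟨x, -, hx⟩ := h2
    refine ⟨x, ?_, by rw [maxCdf_eq, hx]; ring⟩
    rw [Set.mem_Ioi, ← strictMono_normalCdf.lt_iff_lt, hx, normalCdf_zero]
    linarith

lemma setIntegral_stdNormal {s : Set ℝ} (hs : MeasurableSet s) (f : ℝ → ℝ) :
    ∫ x in s, f x ∂stdNormal = ∫ x in s, gaussianPDFReal 0 1 x * f x := by
  rw [← integral_indicator hs, integral_gaussianReal_eq_integral_smul one_ne_zero,
    ← integral_indicator hs]
  congr 1
  ext x
  by_cases h : x ∈ s <;> simp [h]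

/-- The substitution u = Φ(x) is injective with range (0, 1), so it is valid for every `f`, without
any regularity assumed of the copula. -/
lemma intervalIntegral_eq_integral_normalCdf (f : ℝ → ℝ) :
    ∫ u in (0 : ℝ)..1, f u = ∫ x, f (normalCdf x) ∂stdNormal := by
  rw [intervalIntegral.integral_of_le zero_le_one, integral_Ioc_eq_integral_Ioo,
    ← range_normalCdf, integral_image_eq_integral_abs_deriv_smul MeasurableSet.univ
      (fun x _ => (hasDerivAt_normalCdf x).hasDerivWithinAt) strictMono_normalCdf.injective.injOn,
    ← setIntegral_univ (μ := stdNormal), setIntegral_stdNormal MeasurableSet.univ]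
  simp only [abs_of_nonneg (gaussianPDFReal_nonneg 0 1 _), smul_eq_mul]

/-- The factor 2 arises because |W_1|, which has the law of the maximum, has twice the normal
density on the half-line. -/
lemma intervalIntegral_eq_integral_maxCdf (f : ℝ → ℝ) :
    ∫ u in (0 : ℝ)..1, f u = ∫ y in Set.Ioi 0, 2 * f (maxCdf y) ∂stdNormal := by
  have hd : ∀ y, HasDerivAt maxCdf (2 * gaussianPDFReal 0 1 y) y := by
    intro y
    rw [funext maxCdf_eq]
    exact ((hasDerivAt_normalCdf y).const_mul 2).sub_const 1
  have hinj : Set.InjOn maxCdf (Set.Ioi 0) := by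
    intro a _ b _ h
    rw [maxCdf_eq, maxCdf_eq] at h
    exact strictMono_normalCdf.injective (by linarith)
  rw [intervalIntegral.integral_of_le zero_le_one, integral_Ioc_eq_integral_Ioo,
    ← image_maxCdf_Ioi, integral_image_eq_integral_abs_deriv_smul measurableSet_Ioi
      (fun x _ => (hd x).hasDerivWithinAt) hinj, setIntegral_stdNormal measurableSet_Ioi]
  congr 1
  ext y
  rw [abs_of_nonneg (mul_nonneg zero_le_two (gaussianPDFReal_nonneg 0 1 _)), smul_eq_mul]
  ring

lemma intervalIntegral_eq_integral_one_sub_maxCdf (f : ℝ → ℝ) :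
    ∫ u in (0 : ℝ)..1, f u = ∫ y in Set.Ioi 0, 2 * f (1 - maxCdf y) ∂stdNormal := by
  rw [← intervalIntegral_eq_integral_maxCdf fun u => f (1 - u),
    intervalIntegral.integral_comp_sub_left]
  simp

lemma integral_stdNormal3 {f : ℝ × ℝ × ℝ → ℝ} (hf : Measurable f) {c : ℝ} (hc : ∀ p, |f p| ≤ c) :
    ∫ p, f p ∂stdNormal3 = ∫ a, ∫ b, ∫ z, f (a, b, z) ∂stdNormal ∂stdNormal ∂stdNormal := by
  rw [integral_prod _ (Integrable.of_bound hf.aestronglyMeasurable c (ae_of_all _ hc))]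
  congr 1
  ext a
  rw [integral_prod]
  exact Integrable.of_bound (hf.comp measurable_prodMk_left).aestronglyMeasurable c
    (ae_of_all _ fun _ => hc _)

lemma setIntegral_Ioi_stdNormal_eq (f : ℝ → ℝ) :
    ∫ y in Set.Ioi 0, f y ∂stdNormal = ∫ y, (Set.Ici 0).indicator f y ∂stdNormal := by
  rw [integral_indicator measurableSet_Ici]
  exact setIntegral_congr_set Ioi_ae_eq_Ici

lemma measurable_normalCdf : Measurable normalCdf := continuous_normalCdf.measurable

lemma abs_normalCdf_le (x : ℝ) : |normalCdf x| ≤ 1 := by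
  rw [normalCdf, abs_of_nonneg measureReal_nonneg]; exact measureReal_le_one

/-- Φ(g) is the probability that an independent standard normal third coordinate is at most g;
Fubini does the rest. -/
lemma setIntegral_normalCdf_eq_stdNormal3 {g : ℝ → ℝ → ℝ} (hg : Measurable (Function.uncurry g)) :
    ∫ y in Set.Ioi 0, ∫ x, normalCdf (g y x) ∂stdNormal ∂stdNormal
      = stdNormal3.real {p | 0 ≤ p.1 ∧ p.2.2 ≤ g p.1 p.2.1} := by
  have hS : MeasurableSet {p : ℝ × ℝ × ℝ | 0 ≤ p.1 ∧ p.2.2 ≤ g p.1 p.2.1} := by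
    refine MeasurableSet.inter (s₁ := {p : ℝ × ℝ × ℝ | 0 ≤ p.1})
      (s₂ := {p : ℝ × ℝ × ℝ | p.2.2 ≤ g p.1 p.2.1})
      (measurableSet_le measurable_const measurable_fst)
      (measurableSet_le (measurable_snd.comp measurable_snd) ?_)
    exact hg.comp (measurable_fst.prodMk (measurable_fst.comp measurable_snd))
  rw [← integral_indicator_one hS, integral_stdNormal3 (measurable_one.indicator hS) (c := 1)
    (fun p => by
      by_cases h : p ∈ {p : ℝ × ℝ × ℝ | 0 ≤ p.1 ∧ p.2.2 ≤ g p.1 p.2.1}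
      · rw [Set.indicator_of_mem h]; simp
      · rw [Set.indicator_of_notMem h]; simp), setIntegral_Ioi_stdNormal_eq]
  congr 1
  ext y
  by_cases hy : y ∈ Set.Ici (0 : ℝ)
  · rw [Set.indicator_of_mem hy]
    congr 1
    ext x
    rw [normalCdf, ← integral_indicator_one measurableSet_Iic]
    congr 1
    ext z
    simp only [Set.indicator_apply, Set.mem_Iic, Set.mem_ofPred_eq, Set.mem_Ici.1 hy, true_and]
    rfl
  · rw [Set.indicator_of_notMem hy]
    have : ∀ x z, (y, x, z) ∉ {p : ℝ × ℝ × ℝ | 0 ≤ p.1 ∧ p.2.2 ≤ g p.1 p.2.1} :=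
      fun x z h => hy h.1
    simp only [Set.indicator_of_notMem (this _ _), integral_zero]

lemma integrable_normalCdf_comp {α : Type*} [MeasurableSpace α] {μ : Measure α} [IsFiniteMeasure μ]
    {g : α → ℝ} (hg : Measurable g) : Integrable (fun x => normalCdf (g x)) μ :=
  Integrable.of_bound (measurable_normalCdf.comp hg).aestronglyMeasurable 1
    (ae_of_all _ fun _ => abs_normalCdf_le _)

lemma integrable_integral_normalCdf {g : ℝ → ℝ → ℝ} (hg : Measurable (Function.uncurry g))
    {μ : Measure ℝ} [IsFiniteMeasure μ] :
    Integrable (fun y => ∫ x, normalCdf (g y x) ∂stdNormal) μ :=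
  (integrable_normalCdf_comp (μ := μ.prod stdNormal) hg).integral_prod_left

/-- The integral over the unit square of the copula of the end point and the maximum. -/
lemma integral_endMaxCdf :
    ∫ y in Set.Ioi 0, 2 * ∫ x, endMaxCdf x y ∂stdNormal ∂stdNormal
      = 5 / 12 - Real.arccos (√6 / 3) / (2 * Real.pi) := by
  have hm1 : Measurable (Function.uncurry fun y x : ℝ => min x y) := by
    simp only [Function.uncurry_def]; fun_prop
  have hm2 : Measurable (Function.uncurry fun y x : ℝ => min x y - 2 * y) := by
    simp only [Function.uncurry_def]; fun_prop
  have e : ∀ y, ∫ x, endMaxCdf x y ∂stdNormal = ∫ x, normalCdf (min x y) ∂stdNormal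
      - ∫ x, normalCdf (min x y - 2 * y) ∂stdNormal := fun y =>
    integral_sub (integrable_normalCdf_comp (by fun_prop))
      (integrable_normalCdf_comp (by fun_prop))
  simp_rw [e]
  rw [integral_const_mul, integral_sub (integrable_integral_normalCdf hm1)
    (integrable_integral_normalCdf hm2), setIntegral_normalCdf_eq_stdNormal3 hm1,
    setIntegral_normalCdf_eq_stdNormal3 hm2]
  have s1 : {p : ℝ × ℝ × ℝ | 0 ≤ p.1 ∧ p.2.2 ≤ min p.2.1 p.1}
      = {p | 0 ≤ linForm 1 0 0 p} ∩ {p | 0 ≤ linForm 0 1 (-1) p} ∩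
        {p | 0 ≤ linForm 1 0 (-1) p} := by
    ext p
    simp only [linForm, Set.mem_inter_iff, Set.mem_ofPred_eq, le_min_iff]
    constructor
    · rintro ⟨h1, h2, h3⟩; refine ⟨⟨?_, ?_⟩, ?_⟩ <;> linarith
    · rintro ⟨⟨h1, h2⟩, h3⟩; refine ⟨?_, ?_, ?_⟩ <;> linarith
  have s2 : {p : ℝ × ℝ × ℝ | 0 ≤ p.1 ∧ p.2.2 ≤ min p.2.1 p.1 - 2 * p.1}
      = {p | 0 ≤ linForm 1 0 0 p} ∩ {p | 0 ≤ linForm (-2) 1 (-1) p} ∩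
        {p | 0 ≤ linForm (-1) 0 (-1) p} := by
    ext p
    simp only [linForm, Set.mem_inter_iff, Set.mem_ofPred_eq, le_sub_iff_add_le, le_min_iff]
    constructor
    · rintro ⟨h1, h2, h3⟩; refine ⟨⟨?_, ?_⟩, ?_⟩ <;> linarith
    · rintro ⟨⟨h1, h2⟩, h3⟩; refine ⟨?_, ?_, ?_⟩ <;> linarith
  rw [s1, s2, stdNormal3_max_cone, stdNormal3_reflected_cone]
  have := Real.pi_pos
  field_simp
  ring

variable {Ω : Type*} [MeasurableSpace Ω] {P : Measure Ω} {W : ℝ≥0 → Ω → ℝ}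
  {C : (Fin 3 → ℝ) → ℝ}

lemma IsRegularBrownian.runningMin_nonpos (hW : IsRegularBrownian W P) (ω : Ω) :
    runningMin W 1 ω ≤ 0 := by
  rw [runningMin_eq_neg_runningMax_neg]
  linarith [hW.neg.runningMax_nonneg ω]

theorem spearmanRho_marginWM (hW : IsRegularBrownian W P)
    (hC : IsCopulaOf C (wienerTriple W 1) P) :
    spearmanRho (marginWM C) = 2 - 6 / Real.pi * Real.arccos (√6 / 3) := by
  have := hW.isProbabilityMeasure
  have key : ∀ x, ∀ y ∈ Set.Ioi (0 : ℝ),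
      marginWM C ![normalCdf x, maxCdf y] = endMaxCdf x y := by
    intro x y hy
    have h := hC.apply_vec3 x y 0
    -- The minimum is at most W_0 = 0, so the third coordinate 1 is attained at threshold 0 and no
    -- limit is needed.
    have h0 : P.real {ω | wienerTriple W 1 2 ω ≤ 0} = 1 := by
      convert probReal_univ (μ := P)
      exact Set.eq_univ_of_forall hW.runningMin_nonpos
    have h1 : P.real {ω | wienerTriple W 1 0 ω ≤ x} = normalCdf x := hW.measureReal_eval_le x
    have h2 : P.real {ω | wienerTriple W 1 1 ω ≤ y} = maxCdf y :=
      hW.measureReal_runningMax_le (le_of_lt hy)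
    rw [h0, h1, h2] at h
    change C ![normalCdf x, maxCdf y, 1] = _
    rw [h, ← hW.measureReal_eval_le_runningMax_le x hy]
    congr 1
    ext ω
    have := hW.runningMin_nonpos ω
    change (W 1 ω ≤ x ∧ runningMax W 1 ω ≤ y ∧ runningMin W 1 ω ≤ 0) ↔
      (W 1 ω ≤ x ∧ runningMax W 1 ω ≤ y)
    tauto
  have e : ∫ v in (0 : ℝ)..1, ∫ u in (0 : ℝ)..1, marginWM C ![u, v]
      = ∫ y in Set.Ioi 0, 2 * ∫ x, endMaxCdf x y ∂stdNormal ∂stdNormal := by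
    rw [intervalIntegral_eq_integral_maxCdf]
    refine setIntegral_congr_fun measurableSet_Ioi fun y hy => ?_
    rw [intervalIntegral_eq_integral_normalCdf]
    congr 2
    ext x
    exact key x y hy
  rw [spearmanRho, e, integral_endMaxCdf]
  have := Real.pi_pos
  field_simp
  ring

lemma integral_comp_neg_stdNormal (f : ℝ → ℝ) :
    ∫ x, f (-x) ∂stdNormal = ∫ x, f x ∂stdNormal := by
  have h1 : stdNormal.map (fun x => -x) = stdNormal := by
    rw [gaussianReal_map_neg]; simp
  have mp : MeasurePreserving (fun x : ℝ => -x) stdNormal stdNormal := ⟨measurable_neg, h1⟩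
  exact mp.integral_comp (MeasurableEquiv.neg ℝ).measurableEmbedding f

lemma integrable_endMaxCdf (y : ℝ) : Integrable (fun x => endMaxCdf x y) stdNormal :=
  (integrable_normalCdf_comp (by fun_prop)).sub (integrable_normalCdf_comp (by fun_prop))

lemma integrable_integral_endMaxCdf {μ : Measure ℝ} [IsFiniteMeasure μ] :
    Integrable (fun y => ∫ x, endMaxCdf x y ∂stdNormal) μ := by
  have hm1 : Measurable (Function.uncurry fun y x : ℝ => min x y) := by
    simp only [Function.uncurry_def]; fun_prop
  have hm2 : Measurable (Function.uncurry fun y x : ℝ => min x y - 2 * y) := by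
    simp only [Function.uncurry_def]; fun_prop
  refine ((integrable_integral_normalCdf hm1).sub (integrable_integral_normalCdf hm2)).congr
    (ae_of_all _ fun y => ?_)
  exact (integral_sub (integrable_normalCdf_comp (by fun_prop))
    (integrable_normalCdf_comp (by fun_prop))).symm

lemma integrable_maxCdf {μ : Measure ℝ} [IsFiniteMeasure μ] : Integrable maxCdf μ :=
  (integrable_normalCdf_comp measurable_id).sub (integrable_normalCdf_comp measurable_neg)

/-- The law of (W, m) differs from that of (−W, max(−W)) by the terms 1 − Φ − P(M ≤ y), whose
integral is that of 1/2 − v over [0, 1], namely 0. The same integral as for (W, M) remains. -/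
theorem spearmanRho_marginWm (hW : IsRegularBrownian W P)
    (hC : IsCopulaOf C (wienerTriple W 1) P) :
    spearmanRho (marginWm C) = 2 - 6 / Real.pi * Real.arccos (√6 / 3) := by
  have := hW.isProbabilityMeasure
  have key : ∀ x, ∀ y ∈ Set.Ioi (0 : ℝ),
      marginWm C ![normalCdf x, 1 - maxCdf y]
        = 1 - normalCdf (-x) - maxCdf y + endMaxCdf (-x) y := by
    intro x y hy
    have h := hC.apply_one_snd x (-y)
    have h1 : P.real {ω | wienerTriple W 1 0 ω ≤ x} = normalCdf x := hW.measureReal_eval_le x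
    have h2 : P.real {ω | wienerTriple W 1 2 ω ≤ -y} = 1 - maxCdf y :=
      hW.measureReal_runningMin_le_neg (le_of_lt hy)
    rw [h1, h2] at h
    rw [← hW.measureReal_eval_le_runningMin_le_neg x hy]
    exact h
  have hhalf : ∫ x, normalCdf x ∂stdNormal = 1 / 2 := by
    rw [← intervalIntegral_eq_integral_normalCdf fun u => u]; simp
  have e : ∫ v in (0 : ℝ)..1, ∫ u in (0 : ℝ)..1, marginWm C ![u, v]
      = ∫ y in Set.Ioi 0, 2 * ∫ x, endMaxCdf x y ∂stdNormal ∂stdNormal := by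
    have inner : ∀ y ∈ Set.Ioi (0 : ℝ),
        2 * ∫ u in (0 : ℝ)..1, marginWm C ![u, 1 - maxCdf y]
          = 2 * (1 / 2 - maxCdf y) + 2 * ∫ x, endMaxCdf x y ∂stdNormal := by
      intro y hy
      rw [intervalIntegral_eq_integral_normalCdf]
      simp_rw [key _ y hy]
      rw [integral_comp_neg_stdNormal fun x => 1 - normalCdf x - maxCdf y + endMaxCdf x y]
      have i0 : Integrable normalCdf stdNormal := integrable_normalCdf_comp measurable_id
      have i1 : Integrable (fun x => 1 - normalCdf x) stdNormal :=
        (integrable_const _).sub i0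
      have i2 : Integrable (fun x => 1 - normalCdf x - maxCdf y) stdNormal :=
        i1.sub (integrable_const _)
      rw [integral_add i2 (integrable_endMaxCdf y), integral_sub i1 (integrable_const _),
        integral_sub (integrable_const _) i0, hhalf]
      simp
      ring
    have i3 : Integrable (fun y => 2 * (1 / 2 - maxCdf y)) (stdNormal.restrict (Set.Ioi 0)) :=
      ((integrable_const _).sub integrable_maxCdf).const_mul 2
    rw [intervalIntegral_eq_integral_one_sub_maxCdf, setIntegral_congr_fun measurableSet_Ioi inner,
      integral_add i3 (integrable_integral_endMaxCdf.const_mul 2),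
      ← intervalIntegral_eq_integral_maxCdf fun v => 1 / 2 - v,
      intervalIntegral.integral_sub intervalIntegrable_const intervalIntegral.intervalIntegrable_id,
      integral_id]
    norm_num
  rw [spearmanRho, e, integral_endMaxCdf]
  have := Real.pi_pos
  field_simp
  ring

end SpearmanIntegrals

/-! ### Spearman's rho for the maximum and the minimum as a series -/

noncomputable section MaxMin

open Filter Topology

/-- The measure of the cone `{X ≥ 0, Y ≥ 0, Z ≥ (k - 1) X + k Y}`. -/
def exitCone (k : ℝ) : ℝ :=
  -1 / 8 + (Real.arccos ((k - 1) / √(2 * (k * (k - 1) + 1)))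
    + Real.arccos (k / √(2 * (k * (k - 1) + 1)))) / (4 * Real.pi)

/-- Reflects the symmetry Z ↦ −Z combined with X ↔ Y, which takes a cone to its complement in the
region X, Y ≥ 0, of measure 1/4. -/
lemma exitCone_neg (k : ℝ) : exitCone (-k) = 1 / 4 - exitCone (k + 1) := by
  have e : 2 * (-k * (-k - 1) + 1) = 2 * ((k + 1) * (k + 1 - 1) + 1) := by ring
  have e1 : -k - 1 = -(k + 1) := by ring
  have := Real.pi_pos
  rw [exitCone, exitCone, e, e1, neg_div _ (k + 1), neg_div _ k, Real.arccos_neg, Real.arccos_neg,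
    add_sub_cancel_right]
  field_simp
  ring

lemma arccos_one_div_sqrt_two : Real.arccos (1 / √2) = Real.pi / 4 := by
  rw [show (1 : ℝ) / √2 = Real.cos (Real.pi / 4) by
    rw [Real.cos_pi_div_four, div_eq_div_iff (by positivity) (by norm_num), one_mul,
      Real.mul_self_sqrt (by norm_num)]]
  exact Real.arccos_cos (by positivity) (by linarith [Real.pi_pos])

lemma exitCone_one : exitCone 1 = 1 / 16 := by
  have := Real.pi_pos
  rw [exitCone]
  norm_num
  rw [← one_div, arccos_one_div_sqrt_two]
  field_simp
  ring

lemma exitCone_sub_exitCone (n : ℕ) :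
    exitCone ((n : ℝ) + 1) - exitCone ((n : ℝ) + 1 + 1) = arccosBracket n / (4 * Real.pi) := by
  rw [exitCone, exitCone, arccosBracket]
  rw [show ((n : ℝ) + 1) * (n + 1 - 1) + 1 = (n : ℝ) * (n + 1) + 1 by ring,
    show ((n : ℝ) + 1 + 1) * (n + 1 + 1 - 1) + 1 = ((n : ℝ) + 1) * (n + 2) + 1 by ring,
    show (n : ℝ) + 1 + 1 = n + 2 by ring, show (n : ℝ) + 2 - 1 = n + 1 by ring,
    show (n : ℝ) + 1 - 1 = n by ring]
  ring

/-- The octant where both barriers are at positive distance. -/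
def barrierSet : Set (ℝ × ℝ × ℝ) := {p | 0 < p.1 ∧ 0 < p.2.1}

/-- The part of `barrierSet` where the end point lies at least `k` strips above the lower
barrier. -/
def stripAbove (k : ℤ) : Set (ℝ × ℝ × ℝ) :=
  {p | p ∈ barrierSet ∧ (k : ℝ) ≤ (p.2.2 + p.1) / (p.1 + p.2.1)}

lemma measurableSet_barrierSet : MeasurableSet barrierSet :=
  MeasurableSet.inter (s₁ := {p : ℝ × ℝ × ℝ | 0 < p.1}) (s₂ := {p : ℝ × ℝ × ℝ | 0 < p.2.1})
    (measurableSet_lt measurable_const (by fun_prop))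
    (measurableSet_lt measurable_const (by fun_prop))

lemma measurableSet_stripAbove (k : ℤ) : MeasurableSet (stripAbove k) :=
  measurableSet_barrierSet.inter (s₂ := {p : ℝ × ℝ × ℝ | (k : ℝ) ≤ (p.2.2 + p.1) / (p.1 + p.2.1)})
    (measurableSet_le measurable_const (by fun_prop))

lemma measureReal_stripAbove (k : ℤ) : stdNormal3.real (stripAbove k) = exitCone k := by
  rw [exitCone, ← stdNormal3_exit_cone]
  apply measureReal_congr
  filter_upwards [stdNormal3_linForm_eq_zero (a := 1) (b := 0) (c := 0) (by norm_num),
    stdNormal3_linForm_eq_zero (a := 0) (b := 1) (c := 0) (by norm_num)] with p h1 h2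
  apply propext
  change ((0 < p.1 ∧ 0 < p.2.1) ∧ (k : ℝ) ≤ (p.2.2 + p.1) / (p.1 + p.2.1)) ↔
    (0 ≤ linForm 1 0 0 p ∧ 0 ≤ linForm 0 1 0 p) ∧ 0 ≤ linForm (1 - k) (-k) 1 p
  simp only [linForm] at h1 h2 ⊢
  have e1 : 1 * p.1 + 0 * p.2.1 + 0 * p.2.2 = p.1 := by ring
  have e2 : 0 * p.1 + 1 * p.2.1 + 0 * p.2.2 = p.2.1 := by ring
  rw [e1] at h1 ⊢
  rw [e2] at h2 ⊢
  have hiff : 0 < p.1 → 0 < p.2.1 → ((k : ℝ) ≤ (p.2.2 + p.1) / (p.1 + p.2.1) ↔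
      0 ≤ (1 - (k : ℝ)) * p.1 + -(k : ℝ) * p.2.1 + 1 * p.2.2) := by
    intro ha hb
    rw [le_div_iff₀ (by positivity)]
    constructor <;> intro <;> linarith
  constructor
  · rintro ⟨⟨ha, hb⟩, hc⟩
    exact ⟨⟨ha.le, hb.le⟩, (hiff ha hb).1 hc⟩
  · rintro ⟨⟨ha, hb⟩, hc⟩
    have ha' := lt_of_le_of_ne ha h1.symm
    have hb' := lt_of_le_of_ne hb h2.symm
    exact ⟨⟨ha', hb'⟩, (hiff ha' hb').2 hc⟩

/-- The square wave of the end point relative to the two barriers. -/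
def barrierWave (p : ℝ × ℝ × ℝ) : ℝ := squareWave ((p.2.2 + p.1) / (p.1 + p.2.1))

lemma measurable_barrierWave : Measurable barrierWave := by
  unfold barrierWave; fun_prop

/-- The wave equals (−1)^k on the k-th strip, a difference of two nested cones. Summability is part
of countable additivity for an integrable function. -/
lemma hasSum_exitCone :
    HasSum (fun k : ℤ => (-1 : ℝ) ^ k * (exitCone k - exitCone (k + 1)))
      (∫ p in barrierSet, barrierWave p ∂stdNormal3) := by
  have hU : ⋃ k : ℤ, stripAbove k \ stripAbove (k + 1) = barrierSet := by
    ext p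
    simp only [Set.mem_iUnion, Set.mem_sdiff, stripAbove, Set.mem_ofPred_eq]
    constructor
    · rintro ⟨k, h, -⟩; exact h.1
    · intro h
      refine ⟨⌊(p.2.2 + p.1) / (p.1 + p.2.1)⌋, ⟨h, Int.floor_le _⟩, fun h' => ?_⟩
      have := Int.lt_floor_add_one ((p.2.2 + p.1) / (p.1 + p.2.1))
      have h2 := h'.2
      push_cast at h2
      linarith
  have hfl : ∀ k : ℤ, ∀ p ∈ stripAbove k \ stripAbove (k + 1),
      ⌊(p.2.2 + p.1) / (p.1 + p.2.1)⌋ = k := by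
    intro k p hp
    rw [Int.floor_eq_iff]
    refine ⟨hp.1.2, ?_⟩
    by_contra! hc
    exact hp.2 ⟨hp.1.1, by push_cast; exact hc⟩
  have hi : Integrable barrierWave stdNormal3 :=
    Integrable.of_bound measurable_barrierWave.aestronglyMeasurable 1
      (ae_of_all _ fun p => (abs_squareWave _).le)
  have hm : ∀ k : ℤ, MeasurableSet (stripAbove k \ stripAbove (k + 1)) := fun k =>
    (measurableSet_stripAbove k).diff (measurableSet_stripAbove (k + 1))
  have h := hasSum_integral_iUnion (μ := stdNormal3) (f := barrierWave) hm
    (fun i j hij => by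
      rw [Function.onFun, Set.disjoint_left]
      intro p h1 h2
      exact hij ((hfl i p h1).symm.trans (hfl j p h2))) hi.integrableOn
  rw [hU] at h
  refine h.congr_fun fun k => ?_
  rw [setIntegral_congr_fun (g := fun _ => (-1 : ℝ) ^ k) (hm k) (fun p hp => by
    simp only [barrierWave, squareWave, hfl k p hp]), setIntegral_const, smul_eq_mul, mul_comm]
  congr 1
  have hsub : stripAbove (k + 1) ⊆ stripAbove k := fun p hp =>
    ⟨hp.1, le_trans (by push_cast; linarith) hp.2⟩
  rw [measureReal_sdiff hsub (measurableSet_stripAbove _), measureReal_stripAbove,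
    measureReal_stripAbove]
  push_cast
  ring

lemma hasSum_arccosBracket :
    HasSum (fun n : ℕ => (-1 : ℝ) ^ n * arccosBracket n)
      (2 * Real.pi * (1 / 8 - ∫ p in barrierSet, barrierWave p ∂stdNormal3)) := by
  -- By `exitCone_neg` the terms of index k and −k coincide. Pairing counts the term of index 0
  -- twice; dropping the pair leaves the integral minus that term, which is 3/16 − 1/16 = 1/8.
  have h := hasSum_exitCone.nat_add_neg
  rw [← hasSum_nat_add_iff' 1] at h
  have h0 : exitCone 0 = 3 / 16 := by
    have := exitCone_neg 0
    rw [neg_zero, zero_add, exitCone_one] at this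
    linarith
  have hp := Real.pi_pos
  have h2 := h.mul_left (-(2 * Real.pi))
  have hf : (fun n : ℕ => (-1 : ℝ) ^ n * arccosBracket n) = fun n : ℕ => -(2 * Real.pi) *
      ((-1 : ℝ) ^ ((n + 1 : ℕ) : ℤ) * (exitCone ((n + 1 : ℕ) : ℤ)
        - exitCone (((n + 1 : ℕ) : ℤ) + 1)) + (-1 : ℝ) ^ (-((n + 1 : ℕ) : ℤ)) *
        (exitCone ((-((n + 1 : ℕ) : ℤ) : ℤ)) - exitCone (((-((n + 1 : ℕ) : ℤ) : ℤ) : ℝ) + 1))) := by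
    funext n
    have e1 := exitCone_sub_exitCone n
    have e2 := exitCone_neg ((n : ℝ) + 1)
    have e3 := exitCone_neg (n : ℝ)
    push_cast
    rw [show -((n : ℝ) + 1) + 1 = -n by ring, e2, e3, zpow_neg]
    have e4 : (-1 : ℝ) ^ ((n : ℤ) + 1) = -(-1) ^ n := by
      rw [zpow_add₀ (by norm_num)]; simp
    have e5 : ((-1 : ℝ) ^ ((n : ℤ) + 1))⁻¹ = (-1 : ℝ) ^ ((n : ℤ) + 1) := by
      rw [← inv_zpow]; norm_num
    rw [e5, e4]
    rw [eq_div_iff (by positivity)] at e1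
    rw [← e1]
    ring
  rw [hf]
  refine (congrArg (HasSum _) ?_).mpr h2
  simp only [Finset.sum_range_one, Nat.cast_zero, Int.cast_zero, neg_zero, zpow_zero, zero_add,
    h0, exitCone_one]
  ring

lemma setIntegral_stayProb :
    ∫ x in Set.Ioi 0, ∫ y in Set.Ioi 0, stayProb x y ∂stdNormal ∂stdNormal
      = ∫ p in barrierSet, barrierWave p ∂stdNormal3 := by
  rw [← integral_indicator measurableSet_barrierSet,
    integral_stdNormal3 (measurable_barrierWave.indicator measurableSet_barrierSet) (c := 1)
    (fun p => le_trans (b := ‖barrierWave p‖)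
      (norm_indicator_le_norm_self barrierWave p) (abs_squareWave _).le),
    ← integral_indicator measurableSet_Ioi]
  congr 1
  ext x
  by_cases hx : x ∈ Set.Ioi (0 : ℝ)
  · rw [Set.indicator_of_mem hx, ← integral_indicator measurableSet_Ioi]
    congr 1
    ext y
    by_cases hy : y ∈ Set.Ioi (0 : ℝ)
    · rw [Set.indicator_of_mem hy, stayProb]
      congr 1
      ext z
      rw [Set.indicator_of_mem (show (x, y, z) ∈ barrierSet from ⟨hx, hy⟩)]
      rfl
    · rw [Set.indicator_of_notMem hy]
      have : ∀ z, (x, y, z) ∉ barrierSet := fun z h => hy h.2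
      simp only [Set.indicator_of_notMem (this _), integral_zero]
  · rw [Set.indicator_of_notMem hx]
    have : ∀ y z, (x, y, z) ∉ barrierSet := fun y z h => hx h.1
    simp only [Set.indicator_of_notMem (this _ _), integral_zero]

variable {Ω : Type*} [MeasurableSpace Ω] {P : Measure Ω} {W : ℝ≥0 → Ω → ℝ}
  {C : (Fin 3 → ℝ) → ℝ}

lemma integrable_stayProb {μ : Measure ℝ} [IsFiniteMeasure μ] :
    Integrable (Function.uncurry stayProb) (μ.prod μ) := by
  have hm : Measurable fun q : (ℝ × ℝ) × ℝ =>
      squareWave ((q.2 + q.1.1) / (q.1.1 + q.1.2)) := by fun_prop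
  exact (Integrable.of_bound (μ := (μ.prod μ).prod stdNormal) hm.aestronglyMeasurable 1
    (ae_of_all _ fun p => (abs_squareWave _).le)).integral_prod_left

/-- Both substitutions contribute a factor 2. The part P(M ≤ y) integrates to 1/2, and the staying
probability contributes four times the integral of the wave. -/
theorem spearmanRho_marginMm (hW : IsRegularBrownian W P)
    (hC : IsCopulaOf C (wienerTriple W 1) P) :
    spearmanRho (marginMm C)
      = 3 - 48 * ∫ p in barrierSet, barrierWave p ∂stdNormal3 := by
  have := hW.isProbabilityMeasure
  have key : ∀ x ∈ Set.Ioi (0 : ℝ), ∀ y ∈ Set.Ioi (0 : ℝ),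
      marginMm C ![maxCdf y, 1 - maxCdf x] = maxCdf y - stayProb x y := by
    intro x hx y hy
    have h := hC.apply_one_fst y (-x)
    have h1 : P.real {ω | wienerTriple W 1 1 ω ≤ y} = maxCdf y :=
      hW.measureReal_runningMax_le (le_of_lt hy)
    have h2 : P.real {ω | wienerTriple W 1 2 ω ≤ -x} = 1 - maxCdf x :=
      hW.measureReal_runningMin_le_neg (le_of_lt hx)
    rw [h1, h2] at h
    rw [← hW.measureReal_runningMax_le_runningMin_le_neg hx hy]
    exact h
  have hhalf : ∫ y in Set.Ioi 0, 2 * maxCdf y ∂stdNormal = 1 / 2 := by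
    rw [← intervalIntegral_eq_integral_maxCdf fun u => u]; simp
  have hone : ∫ y in Set.Ioi 0, (2 : ℝ) ∂stdNormal = 1 := by
    have := intervalIntegral_eq_integral_maxCdf fun _ => 1
    simpa using this.symm
  have hs := integrable_stayProb (μ := stdNormal.restrict (Set.Ioi 0))
  have inner : ∀ x ∈ Set.Ioi (0 : ℝ),
      2 * ∫ u in (0 : ℝ)..1, marginMm C ![u, 1 - maxCdf x]
        = 2 * (1 / 2) - 4 * ∫ y in Set.Ioi 0, stayProb x y ∂stdNormal := by
    intro x hx
    rw [intervalIntegral_eq_integral_maxCdf, setIntegral_congr_fun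
      (g := fun y => 2 * maxCdf y - 2 * stayProb x y) measurableSet_Ioi (fun y hy => by
        simp only [key x hx y hy]; ring), integral_sub, hhalf, integral_const_mul]
    · ring
    · exact integrable_maxCdf.const_mul 2
    · refine Integrable.const_mul ?_ 2
      have hm : Measurable fun q : ℝ × ℝ => squareWave ((q.2 + x) / (x + q.1)) := by fun_prop
      exact (Integrable.of_bound (μ := (stdNormal.restrict (Set.Ioi 0)).prod stdNormal)
        hm.aestronglyMeasurable 1
        (ae_of_all _ fun p => (abs_squareWave _).le)).integral_prod_left
  have hs' : Integrable (fun x => ∫ y in Set.Ioi 0, stayProb x y ∂stdNormal)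
      (stdNormal.restrict (Set.Ioi 0)) := hs.integral_prod_left
  have e : ∫ v in (0 : ℝ)..1, ∫ u in (0 : ℝ)..1, marginMm C ![u, v]
      = 1 / 2 - 4 * ∫ p in barrierSet, barrierWave p ∂stdNormal3 := by
    rw [intervalIntegral_eq_integral_one_sub_maxCdf, setIntegral_congr_fun measurableSet_Ioi inner,
      integral_sub (integrable_const _) (hs'.const_mul 4), integral_const_mul (4 : ℝ),
      ← setIntegral_stayProb]
    congr 1
    rw [setIntegral_const, smul_eq_mul] at hone ⊢
    linarith
  rw [spearmanRho, e]
  ring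

end MaxMin

/-! ### Elementary bounds for arcsines and the asymptotics of the angles -/

noncomputable section Numerics

open Filter Topology

lemma nonneg_of_hasDerivAt_nonneg {f f' : ℝ → ℝ} (hf : ∀ x, HasDerivAt f (f' x) x) (h0 : f 0 = 0)
    (hf' : ∀ x, 0 ≤ x → 0 ≤ f' x) {x : ℝ} (hx : 0 ≤ x) : 0 ≤ f x := by
  have hmono : MonotoneOn f (Set.Ici 0) := by
    refine monotoneOn_of_deriv_nonneg (convex_Ici 0)
      (fun y _ => (hf y).continuousAt.continuousWithinAt)
      (fun y _ => (hf y).differentiableAt.differentiableWithinAt) fun y hy => ?_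
    rw [(hf y).deriv]
    rw [interior_Ici] at hy
    exact hf' y (le_of_lt hy)
  rw [← h0]
  exact hmono Set.self_mem_Ici hx hx

/-- Start of a chain of Taylor bounds, each obtained by integrating the previous one from 0. -/
lemma cos_le_quartic {x : ℝ} (hx : 0 ≤ x) : Real.cos x ≤ 1 - x ^ 2 / 2 + x ^ 4 / 24 := by
  have := nonneg_of_hasDerivAt_nonneg (f := fun x => 1 - x ^ 2 / 2 + x ^ 4 / 24 - Real.cos x)
    (f' := fun x => Real.sin x - (x - x ^ 3 / 6)) (fun x => by
      exact HasDerivAt.congr_deriv (((((hasDerivAt_const x (1 : ℝ)).sub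
        ((hasDerivAt_pow 2 x).div_const 2)).add
        ((hasDerivAt_pow 4 x).div_const 24)).sub (Real.hasDerivAt_cos x)))
        (by norm_num; try ring)) (by simp) (fun x hx => sub_nonneg.2 (Real.sin_ge_sub_cube hx)) hx
  linarith

lemma sin_le_quintic {x : ℝ} (hx : 0 ≤ x) : Real.sin x ≤ x - x ^ 3 / 6 + x ^ 5 / 120 := by
  have := nonneg_of_hasDerivAt_nonneg (f := fun x => x - x ^ 3 / 6 + x ^ 5 / 120 - Real.sin x)
    (f' := fun x => 1 - x ^ 2 / 2 + x ^ 4 / 24 - Real.cos x) (fun x => by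
      exact HasDerivAt.congr_deriv (((((hasDerivAt_id x).sub ((hasDerivAt_pow 3 x).div_const 6)).add
        ((hasDerivAt_pow 5 x).div_const 120)).sub (Real.hasDerivAt_sin x)))
        (by norm_num; try ring)) (by simp) (fun x hx => sub_nonneg.2 (cos_le_quartic hx)) hx
  linarith

lemma sextic_le_cos {x : ℝ} (hx : 0 ≤ x) :
    1 - x ^ 2 / 2 + x ^ 4 / 24 - x ^ 6 / 720 ≤ Real.cos x := by
  have := nonneg_of_hasDerivAt_nonneg
    (f := fun x => Real.cos x - (1 - x ^ 2 / 2 + x ^ 4 / 24 - x ^ 6 / 720))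
    (f' := fun x => x - x ^ 3 / 6 + x ^ 5 / 120 - Real.sin x) (fun x => by
      exact HasDerivAt.congr_deriv ((Real.hasDerivAt_cos x).sub
        ((((hasDerivAt_const x (1 : ℝ)).sub ((hasDerivAt_pow 2 x).div_const 2)).add
        ((hasDerivAt_pow 4 x).div_const 24)).sub ((hasDerivAt_pow 6 x).div_const 720)))
        (by norm_num; try ring)) (by simp) (fun x hx => sub_nonneg.2 (sin_le_quintic hx)) hx
  linarith

lemma septic_le_sin {x : ℝ} (hx : 0 ≤ x) :
    x - x ^ 3 / 6 + x ^ 5 / 120 - x ^ 7 / 5040 ≤ Real.sin x := by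
  have := nonneg_of_hasDerivAt_nonneg
    (f := fun x => Real.sin x - (x - x ^ 3 / 6 + x ^ 5 / 120 - x ^ 7 / 5040))
    (f' := fun x => Real.cos x - (1 - x ^ 2 / 2 + x ^ 4 / 24 - x ^ 6 / 720)) (fun x => by
      exact HasDerivAt.congr_deriv ((Real.hasDerivAt_sin x).sub
        ((((hasDerivAt_id x).sub ((hasDerivAt_pow 3 x).div_const 6)).add
        ((hasDerivAt_pow 5 x).div_const 120)).sub ((hasDerivAt_pow 7 x).div_const 5040)))
        (by norm_num; try ring)) (by simp) (fun x hx => sub_nonneg.2 (sextic_le_cos hx)) hx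
  linarith

lemma le_arcsin_of_quintic_le {a s : ℝ} (ha : 0 ≤ a) (ha' : a ≤ 1) 
    (h : a - a ^ 3 / 6 + a ^ 5 / 120 ≤ s) : a ≤ Real.arcsin s := by
  have h2 := (sin_le_quintic ha).trans h
  have := Real.pi_gt_three
  rw [Real.le_arcsin_iff_sin_le' ⟨by linarith, by linarith⟩]
  exact h2

lemma arcsin_le_of_le_septic {b s : ℝ} (hb : 0 ≤ b) (hb' : b ≤ 1)
    (h : s ≤ b - b ^ 3 / 6 + b ^ 5 / 120 - b ^ 7 / 5040) : Real.arcsin s ≤ b := by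
  have h2 := h.trans (septic_le_sin hb)
  have := Real.pi_gt_three
  rw [Real.arcsin_le_iff_le_sin' ⟨by linarith, by linarith⟩]
  exact h2

/-- With `p = n (n + 1) + 1`, the amount by which `arccos (n / √(2 p)) + arccos ((n + 1) / √(2 p))`
exceeds `π / 2`. -/
def angleExcess (p : ℝ) : ℝ := Real.arcsin ((1 + √(p ^ 2 + 1) - p) / (2 * p))

/-- The cosine of the sum is (p − 1 − √(p² + 1))/(2p), a function of p alone. The sum lies in [0,
π], so shifting by π/2 lands in the range of `arcsin`. -/
lemma arccos_add_arccos {x p : ℝ} (hx : 0 ≤ x) (hp : p = x * (x + 1) + 1) :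
    Real.arccos (x / √(2 * p)) + Real.arccos ((x + 1) / √(2 * p))
      = Real.pi / 2 + angleExcess p := by
  have hp1 : 1 ≤ p := by rw [hp]; nlinarith
  have hs : 0 < √(2 * p) := by positivity
  have hs2 : √(2 * p) ^ 2 = 2 * p := Real.sq_sqrt (by positivity)
  have h1 : 0 ≤ x / √(2 * p) := by positivity
  have h2 : 0 ≤ (x + 1) / √(2 * p) := by positivity
  have h1' : x / √(2 * p) ≤ 1 := by
    rw [div_le_one hs]; exact Real.le_sqrt_of_sq_le (by rw [hp]; nlinarith)
  have h2' : (x + 1) / √(2 * p) ≤ 1 := by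
    rw [div_le_one hs]; exact Real.le_sqrt_of_sq_le (by rw [hp]; nlinarith)
  have hcos : Real.cos (Real.arccos (x / √(2 * p)) + Real.arccos ((x + 1) / √(2 * p)))
      = -((1 + √(p ^ 2 + 1) - p) / (2 * p)) := by
    rw [Real.cos_add, Real.cos_arccos (by linarith) h1', Real.cos_arccos (by linarith) h2',
      Real.sin_arccos, Real.sin_arccos, ← Real.sqrt_mul (by nlinarith)]
    have e : (1 - (x / √(2 * p)) ^ 2) * (1 - ((x + 1) / √(2 * p)) ^ 2)
        = (p ^ 2 + 1) / (2 * p) ^ 2 := by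
      rw [div_pow, div_pow, hs2]
      field_simp
      rw [hp]; ring
    rw [e, Real.sqrt_div (by positivity), Real.sqrt_sq (by positivity), div_mul_div_comm,
      ← pow_two (√(2 * p)), hs2, show x * (x + 1) = p - 1 by linarith]
    ring
  have ha := Real.arccos_nonneg (x / √(2 * p))
  have hb := Real.arccos_nonneg ((x + 1) / √(2 * p))
  have ha' := Real.arccos_le_pi_div_two.2 h1
  have hb' := Real.arccos_le_pi_div_two.2 h2
  rw [angleExcess, ← neg_neg ((1 + √(p ^ 2 + 1) - p) / (2 * p)), ← hcos,
    ← Real.sin_sub_pi_div_two, Real.arcsin_sin (by linarith) (by linarith)]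
  ring

lemma arccosBracket_eq (n : ℕ) : arccosBracket n
    = angleExcess (n * (n + 1) + 1) - angleExcess ((n + 1) * (n + 2) + 1) := by
  have h1 := arccos_add_arccos (x := n) (Nat.cast_nonneg n) rfl
  have h2 := arccos_add_arccos (x := (n : ℝ) + 1) (by positivity) rfl
  rw [show (n : ℝ) + 1 + 1 = n + 2 by ring] at h2
  rw [arccosBracket]
  linarith

lemma le_angleExcess {a p r : ℝ} (ha : 0 ≤ a) (ha' : a ≤ 1) (hp : 1 ≤ p)
    (hr : r ^ 2 ≤ p ^ 2 + 1) (h : a - a ^ 3 / 6 + a ^ 5 / 120 ≤ (1 + r - p) / (2 * p)) :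
    a ≤ angleExcess p := by
  refine le_arcsin_of_quintic_le ha ha' (h.trans ?_)
  gcongr
  exact Real.le_sqrt_of_sq_le hr

lemma angleExcess_le {b p r : ℝ} (hb : 0 ≤ b) (hb' : b ≤ 1) (hp : 1 ≤ p) (hr0 : 0 ≤ r)
    (hr : p ^ 2 + 1 ≤ r ^ 2)
    (h : (1 + r - p) / (2 * p) ≤ b - b ^ 3 / 6 + b ^ 5 / 120 - b ^ 7 / 5040) :
    angleExcess p ≤ b := by
  refine arcsin_le_of_le_septic hb hb' (le_trans ?_ h)
  gcongr
  exact Real.sqrt_le_iff.2 ⟨hr0, hr⟩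

lemma angleExcess_one : angleExcess 1 = Real.pi / 4 := by
  have h := arccos_add_arccos (x := 0) (p := 1) le_rfl (by norm_num)
  rw [zero_div, Real.arccos_zero, zero_add, mul_one, arccos_one_div_sqrt_two] at h
  linarith

lemma pow_le_one_div_ten {q : ℝ} (hq : 0 ≤ q) (hq' : q ≤ 1 / 10) (k : ℕ) (hk : k ≠ 0) :
    q ^ k ≤ 1 / 10 :=
  (pow_le_of_le_one hq (by linarith) hk).trans hq'

lemma angleExcess_le_expansion {p : ℝ} (hp : 10 ≤ p) :
    angleExcess p ≤ 1 / (2 * p) + 1 / (4 * p ^ 2) + 1 / (48 * p ^ 3) := by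
  obtain ⟨q, hq, rfl⟩ : ∃ q : ℝ, 0 < q ∧ p = q⁻¹ := ⟨p⁻¹, by positivity, by simp⟩
  have hq' : q ≤ 1 / 10 := by
    rw [le_inv_comm₀ (by norm_num) hq] at hp; linarith
  have e : 1 / (2 * q⁻¹) + 1 / (4 * q⁻¹ ^ 2) + 1 / (48 * q⁻¹ ^ 3)
      = q / 2 + q ^ 2 / 4 + q ^ 3 / 48 := by field_simp
  rw [e]
  set b := q / 2 + q ^ 2 / 4 + q ^ 3 / 48 with hb
  have hb0 : 0 ≤ b := by positivity
  have pb := pow_le_one_div_ten hq.le hq'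
  have pn := pow_nonneg hq.le
  have hb1 : b ≤ 1 := by linarith [hq', pb 2 (by norm_num), pb 3 (by norm_num)]
  -- With q = 1/p, `r` is the binomial expansion of √(p² + 1) cut after a positive term, hence an
  -- upper bound.
  refine angleExcess_le (r := q⁻¹ + q / 2 - q ^ 3 / 8 + q ^ 5 / 16) hb0 hb1 (by linarith)
    ?_ ?_ ?_
  · linarith [pb 3 (by norm_num), pn 5]
  · have e1 : (q⁻¹ + q / 2 - q ^ 3 / 8 + q ^ 5 / 16) ^ 2
        = q⁻¹ ^ 2 + 1 + q ^ 6 * (5 / 64 - q ^ 2 / 64 + q ^ 4 / 256) := by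
      field_simp; ring
    have : 0 ≤ q ^ 6 * (5 / 64 - q ^ 2 / 64 + q ^ 4 / 256) :=
      mul_nonneg (by positivity) (by linarith [pb 2 (by norm_num), pn 4])
    linarith
  · have e2 : (1 + (q⁻¹ + q / 2 - q ^ 3 / 8 + q ^ 5 / 16) - q⁻¹) / (2 * q⁻¹)
        = q / 2 + q ^ 2 / 4 - q ^ 4 / 16 + q ^ 6 / 32 := by
      field_simp; ring
    rw [e2]
    -- The last two terms of the sine bound have nonnegative sum and are discarded; the cubic part
    -- already suffices.
    have hb7 : b ^ 7 ≤ b ^ 5 := pow_le_pow_of_le_one hb0 hb1 (by norm_num)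
    have hb5 : 0 ≤ b ^ 5 := by positivity
    have e3 : b - b ^ 3 / 6 - (q / 2 + q ^ 2 / 4 - q ^ 4 / 16 + q ^ 6 / 32) = q ^ 4 * (1 / 32
        - 7 / 384 * q - 7 / 192 * q ^ 2 - 7 / 9216 * q ^ 3 - q ^ 4 / 18432 - q ^ 5 / 663552) := by
      rw [hb]; ring
    have e4 : 0 ≤ q ^ 4 * (1 / 32
        - 7 / 384 * q - 7 / 192 * q ^ 2 - 7 / 9216 * q ^ 3 - q ^ 4 / 18432 - q ^ 5 / 663552) :=
      mul_nonneg (by positivity)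
        (by linarith [hq', pb 2 (by norm_num), pb 3 (by norm_num), pb 4 (by norm_num),
          pb 5 (by norm_num)])
    linarith

lemma expansion_le_angleExcess {p : ℝ} (hp : 10 ≤ p) :
    1 / (2 * p) + 1 / (4 * p ^ 2) + 1 / (48 * p ^ 3) - 1 / (16 * p ^ 4) ≤ angleExcess p := by
  obtain ⟨q, hq, rfl⟩ : ∃ q : ℝ, 0 < q ∧ p = q⁻¹ := ⟨p⁻¹, by positivity, by simp⟩
  have hq' : q ≤ 1 / 10 := by
    rw [le_inv_comm₀ (by norm_num) hq] at hp; linarith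
  have e : 1 / (2 * q⁻¹) + 1 / (4 * q⁻¹ ^ 2) + 1 / (48 * q⁻¹ ^ 3) - 1 / (16 * q⁻¹ ^ 4)
      = q / 2 + q ^ 2 / 4 + q ^ 3 / 48 - q ^ 4 / 16 := by field_simp
  rw [e]
  set a := q / 2 + q ^ 2 / 4 + q ^ 3 / 48 - q ^ 4 / 16 with ha
  have pb := pow_le_one_div_ten hq.le hq'
  have pn := pow_nonneg hq.le
  have hq4 : q ^ 4 ≤ q ^ 2 := pow_le_pow_of_le_one hq.le (by linarith) (by norm_num)
  have hq3 : q ^ 3 ≤ q ^ 2 := pow_le_pow_of_le_one hq.le (by linarith) (by norm_num)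
  have hq2 : q ^ 2 ≤ q := pow_le_of_le_one hq.le (by linarith) (by norm_num)
  have ha0 : 0 ≤ a := by linarith [pn 3, pn 2]
  have haq : a ≤ q := by linarith [pn 4]
  -- Here the expansion of √(p² + 1) is cut after a negative term, giving a lower bound.
  refine le_angleExcess (r := q⁻¹ + q / 2 - q ^ 3 / 8) ha0 (by linarith) (by linarith) ?_ ?_
  · have e1 : (q⁻¹ + q / 2 - q ^ 3 / 8) ^ 2
        = q⁻¹ ^ 2 + 1 - q ^ 4 * (1 / 8 - q ^ 2 / 64) := by
      field_simp; ring
    have : 0 ≤ q ^ 4 * (1 / 8 - q ^ 2 / 64) :=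
      mul_nonneg (by positivity) (by linarith [pb 2 (by norm_num)])
    linarith
  · have e2 : (1 + (q⁻¹ + q / 2 - q ^ 3 / 8) - q⁻¹) / (2 * q⁻¹)
        = q / 2 + q ^ 2 / 4 - q ^ 4 / 16 := by
      field_simp; ring
    rw [e2]
    have ha5 : a ^ 5 ≤ q ^ 5 := pow_le_pow_left₀ ha0 haq 5
    have ha3 : (q / 2 + q ^ 2 / 4 - q ^ 4 / 16) ^ 3 ≤ a ^ 3 :=
      pow_le_pow_left₀ (by linarith) (by linarith [pn 3]) 3
    have e3 : a - (q / 2 + q ^ 2 / 4 - q ^ 4 / 16) ^ 3 / 6 + q ^ 5 / 120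
        - (q / 2 + q ^ 2 / 4 - q ^ 4 / 16) = -(q ^ 4 * (1 / 32
        + 7 / 960 * q - 1 / 192 * q ^ 2 - 1 / 128 * q ^ 3 - 1 / 512 * q ^ 4 + 1 / 1024 * q ^ 5
        + 1 / 2048 * q ^ 6 - 1 / 24576 * q ^ 8)) := by
      rw [ha]; ring
    have e4 : 0 ≤ q ^ 4 * (1 / 32 + 7 / 960 * q - 1 / 192 * q ^ 2 - 1 / 128 * q ^ 3
      - 1 / 512 * q ^ 4 + 1 / 1024 * q ^ 5 + 1 / 2048 * q ^ 6 - 1 / 24576 * q ^ 8) :=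
      mul_nonneg (by positivity) (by
        linarith [hq', pb 2 (by norm_num), pb 3 (by norm_num), pb 4 (by norm_num),
          pb 5 (by norm_num), pb 6 (by norm_num), pb 7 (by norm_num), pb 8 (by norm_num),
          pn 2, pn 3, pn 4, pn 5, pn 6, pn 7, pn 8])
    linarith

end Numerics

/-! ### Acceleration of the alternating series and numerical values -/

noncomputable section AlternatingSum

open Filter Topology

/-- `bracketAngle n + bracketAngle (n + 1)` approximates `2 * angleExcess (n * (n + 1) + 1)`, which
makes the alternating sum of these angles telescope. -/
def bracketAngle (x : ℝ) : ℝ := 1 / (2 * (x ^ 2 + 1)) + 25 / (48 * (x ^ 2 + 1) ^ 3)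

/-- The identity (x² + 1)((x+1)² + 1) = p² + 1 makes the sum a function of p. The main terms give
1/p + 1/(2p²) − 1/p³ + …, while 2α has 1/(24p³); since 1/(x²+1)³ contributes about 2/p³ over the
pair, its coefficient must be 25/48. -/
lemma bracketAngle_add {x p : ℝ} (hp : p = x * (x + 1) + 1) :
    bracketAngle x + bracketAngle (x + 1) = (2 * p + 1) / (2 * (p ^ 2 + 1))
      + 25 * ((2 * p + 1) * (p ^ 2 + 4 * p - 2)) / (48 * (p ^ 2 + 1) ^ 3) := by
  have e : p ^ 2 + 1 = (x ^ 2 + 1) * ((x + 1) ^ 2 + 1) := by rw [hp]; ring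
  have h1 : x ^ 2 + 1 ≠ 0 := by positivity
  have h2 : (x + 1) ^ 2 + 1 ≠ 0 := by positivity
  rw [bracketAngle, bracketAngle, e, hp]
  field_simp
  ring

lemma abs_two_mul_angleExcess_sub_le {x p : ℝ} (hp : p = x * (x + 1) + 1) (hp' : 91 ≤ p) :
    |2 * angleExcess p - bracketAngle x - bracketAngle (x + 1)| ≤ 9 / (2 * p ^ 4) := by
  have hu := angleExcess_le_expansion (p := p) (by linarith)
  have hl := expansion_le_angleExcess (p := p) (by linarith)
  have e := bracketAngle_add hp
  -- Expanding about p = 91, the value at n = 9, leaves numerators with positive coefficients only,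
  -- so both inequalities become evident.
  obtain ⟨q, hq, rfl⟩ : ∃ q : ℝ, 0 ≤ q ∧ p = q + 91 := ⟨p - 91, by linarith, by ring⟩
  have h1 : 2 * (1 / (2 * (q + 91)) + 1 / (4 * (q + 91) ^ 2) + 1 / (48 * (q + 91) ^ 3))
      ≤ (2 * (q + 91) + 1) / (2 * ((q + 91) ^ 2 + 1))
      + 25 * ((2 * (q + 91) + 1) * ((q + 91) ^ 2 + 4 * (q + 91) - 2))
        / (48 * ((q + 91) ^ 2 + 1) ^ 3) := by
    rw [← sub_nonneg]
    have : (2 * (q + 91) + 1) / (2 * ((q + 91) ^ 2 + 1))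
      + 25 * ((2 * (q + 91) + 1) * ((q + 91) ^ 2 + 4 * (q + 91) - 2))
        / (48 * ((q + 91) ^ 2 + 1) ^ 3)
      - 2 * (1 / (2 * (q + 91)) + 1 / (4 * (q + 91) ^ 2) + 1 / (48 * (q + 91) ^ 3))
      = (201 * q ^ 5 + 91353 * q ^ 4 + 16607584 * q ^ 3 + 1509582930 * q ^ 2 + 68607934371 *
        q ^ 1 + 1247235666311) / (48 * (q + 91) ^ 3 * ((q + 91) ^ 2 + 1) ^ 3) := by
      field_simp
      ring
    rw [this]
    positivity
  have h2 : (2 * (q + 91) + 1) / (2 * ((q + 91) ^ 2 + 1))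
      + 25 * ((2 * (q + 91) + 1) * ((q + 91) ^ 2 + 4 * (q + 91) - 2))
        / (48 * ((q + 91) ^ 2 + 1) ^ 3) ≤
      2 * (1 / (2 * (q + 91)) + 1 / (4 * (q + 91) ^ 2) + 1 / (48 * (q + 91) ^ 3)
        - 1 / (16 * (q + 91) ^ 4)) + 9 / (2 * (q + 91) ^ 4) := by
    rw [← sub_nonneg]
    have : 2 * (1 / (2 * (q + 91)) + 1 / (4 * (q + 91) ^ 2) + 1 / (48 * (q + 91) ^ 3)
        - 1 / (16 * (q + 91) ^ 4)) + 9 / (2 * (q + 91) ^ 4)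
      - ((2 * (q + 91) + 1) / (2 * ((q + 91) ^ 2 + 1))
      + 25 * ((2 * (q + 91) + 1) * ((q + 91) ^ 2 + 4 * (q + 91) - 2))
        / (48 * ((q + 91) ^ 2 + 1) ^ 3))
      = (9 * q ^ 6 + 5016 * q ^ 5 + 1165073 * q ^ 4 + 144354446 * q ^ 3 + 10062448959 * q ^ 2
        + 374146447768 * q ^ 1 + 5797304736979) / (48 * (q + 91) ^ 4 * ((q + 91) ^ 2 + 1) ^ 3) := by
      field_simp
      ring
    rw [this]
    positivity
  have h3 : 0 ≤ 9 / (2 * (q + 91) ^ 4) := by positivity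
  rw [abs_le]
  constructor <;> linarith

/-- The right side is the integral of t⁻⁸ over [x, x+1], at least (x + 1/2)⁻⁸ by convexity, and p
exceeds (x + 1/2)². -/
lemma inv_pow_four_le_sub {x p : ℝ} (hx : 0 < x) (hp : p = x * (x + 1) + 1) :
    1 / p ^ 4 ≤ 1 / (7 * x ^ 7) - 1 / (7 * (x + 1) ^ 7) := by
  have hp0 : 0 < p := by rw [hp]; positivity
  rw [← sub_nonneg]
  have : 1 / (7 * x ^ 7) - 1 / (7 * (x + 1) ^ 7) - 1 / p ^ 4
      = (42 * x ^ 12 + 252 * x ^ 11 + 735 * x ^ 10 + 1365 * x ^ 9 + 1821 * x ^ 8 + 1866 * x ^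
        7 + 1522 * x ^ 6 + 996 * x ^ 5 + 516 * x ^ 4 + 205 * x ^ 3 + 59 * x ^ 2 + 11 * x ^ 1
        + 1)
        / (7 * x ^ 7 * (x + 1) ^ 7 * p ^ 4) := by
    field_simp
    rw [hp]
    ring
  rw [this]
  positivity

/-- Passing from N to N + 1 adds exactly (−1)^N (2α − β(N) − β(N+1)), where α has p = N(N+1) + 1.
These errors are summable by the telescoping bound for p⁻⁴. -/
lemma abs_sum_arccosBracket_sub_le {N : ℕ} (hN : 9 ≤ N) :
    |∑ n ∈ Finset.range N, (-1 : ℝ) ^ n * arccosBracket n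
      - (∑ n ∈ Finset.range 9, (-1 : ℝ) ^ n * arccosBracket n + angleExcess 91 - bracketAngle 9)
      - (-1) ^ N * (angleExcess (N * (N + 1) + 1) - bracketAngle N)|
    ≤ 9 / 2 * (1 / (7 * 9 ^ 7) - 1 / (7 * (N : ℝ) ^ 7)) := by
  induction N, hN using Nat.le_induction with
  | base =>
    norm_num
    ring
  | succ N hN ih =>
    have hN' : (9 : ℝ) ≤ N := by exact_mod_cast hN
    have h1 := abs_two_mul_angleExcess_sub_le (x := N) (p := N * (N + 1) + 1) rfl (by nlinarith)
    have h2 := inv_pow_four_le_sub (x := N) (p := N * (N + 1) + 1) (by linarith) rfl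
    rw [Finset.sum_range_succ, arccosBracket_eq]
    push_cast
    rw [show (N : ℝ) + 1 + 1 = N + 2 by ring]
    set A := ∑ n ∈ Finset.range N, (-1 : ℝ) ^ n * arccosBracket n
    set B := ∑ n ∈ Finset.range 9, (-1 : ℝ) ^ n * arccosBracket n + angleExcess 91
      - bracketAngle 9
    set a := angleExcess (N * (N + 1) + 1)
    set b := angleExcess ((N + 1) * (N + 2) + 1)
    have e : A + (-1) ^ N * (a - b) - B - (-1) ^ (N + 1) * (b - bracketAngle (N + 1))
        = (A - B - (-1) ^ N * (a - bracketAngle N))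
          + (-1) ^ N * (2 * a - bracketAngle N - bracketAngle (N + 1)) := by ring
    rw [e]
    refine (abs_add_le _ _).trans ?_
    rw [abs_mul, abs_pow, abs_neg, abs_one, one_pow, one_mul]
    have h3 : 9 / (2 * ((N : ℝ) * (N + 1) + 1) ^ 4)
        = 9 / 2 * (1 / ((N : ℝ) * (N + 1) + 1) ^ 4) := by
      field_simp
    linarith

lemma abs_angleExcess_sub_bracketAngle_le {N : ℕ} (hN : 9 ≤ N) :
    |angleExcess (N * (N + 1) + 1) - bracketAngle N| ≤ 1 / N := by
  have hN' : (9 : ℝ) ≤ N := by exact_mod_cast hN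
  have h1 : bracketAngle N ≤ 1 / N := by
    rw [bracketAngle]
    have h2 : 1 / (2 * ((N : ℝ) ^ 2 + 1)) ≤ 1 / (2 * N) := by
      gcongr; nlinarith
    have h3 : 25 / (48 * ((N : ℝ) ^ 2 + 1) ^ 3) ≤ 25 / (48 * (2 * N)) := by
      gcongr
      calc 2 * (N : ℝ) ≤ N ^ 2 + 1 := by nlinarith
        _ ≤ (N ^ 2 + 1) ^ 3 := le_self_pow₀ (by nlinarith) (by norm_num)
    have h4 : 1 / (N : ℝ) - 1 / (2 * N) - 25 / (48 * (2 * N)) = 23 / (96 * N) := by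
      field_simp; norm_num
    have h5 : 0 ≤ 23 / (96 * (N : ℝ)) := by positivity
    linarith
  have h0 : 0 ≤ bracketAngle N := by rw [bracketAngle]; positivity
  have hp : (91 : ℝ) ≤ N * (N + 1) + 1 := by nlinarith
  have hpN : (N : ℝ) ≤ N * (N + 1) + 1 := by nlinarith
  have ha0 : 0 ≤ angleExcess (N * (N + 1) + 1) :=
    le_angleExcess le_rfl zero_le_one (by linarith) (r := N * (N + 1) + 1) (by linarith)
      (by norm_num; positivity)
  have ha1 : angleExcess (N * (N + 1) + 1) ≤ 1 / N := by
    refine (angleExcess_le_expansion (by linarith)).trans ?_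
    refine le_trans ?_ (one_div_le_one_div_of_le (by linarith) hpN)
    set p := (N : ℝ) * (N + 1) + 1
    have h2 : 1 / (4 * p ^ 2) ≤ 1 / (4 * p) := by
      gcongr; exact le_self_pow₀ (by linarith) two_ne_zero
    have h3 : 1 / (48 * p ^ 3) ≤ 1 / (4 * p) := by
      gcongr
      · norm_num
      · exact le_self_pow₀ (by linarith) three_ne_zero
    have h4 : 1 / p = 1 / (2 * p) + 1 / (4 * p) + 1 / (4 * p) := by
      field_simp; norm_num
    linarith
  rw [abs_le]
  constructor <;> linarith

lemma abs_tsum_arccosBracket_sub_le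
    (hs : Summable fun n : ℕ => (-1 : ℝ) ^ n * arccosBracket n) :
    |∑' n : ℕ, (-1 : ℝ) ^ n * arccosBracket n
      - (∑ n ∈ Finset.range 9, (-1 : ℝ) ^ n * arccosBracket n + angleExcess 91 - bracketAngle 9)|
    ≤ 9 / (2 * (7 * 9 ^ 7)) := by
  have ht := (hs.hasSum.tendsto_sum_nat.sub_const
    (∑ n ∈ Finset.range 9, (-1 : ℝ) ^ n * arccosBracket n + angleExcess 91 - bracketAngle 9)).abs
  have hr : Tendsto (fun N : ℕ => 9 / (2 * (7 * 9 ^ 7)) + 1 / (N : ℝ)) atTop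
      (𝓝 (9 / (2 * (7 * 9 ^ 7)) + 0)) :=
    tendsto_const_nhds.add tendsto_one_div_atTop_nhds_zero_nat
  rw [add_zero] at hr
  refine le_of_tendsto_of_tendsto ht hr ?_
  filter_upwards [eventually_ge_atTop 9] with N hN
  have h1 := abs_sum_arccosBracket_sub_le hN
  have h2 := abs_angleExcess_sub_bracketAngle_le hN
  have h3 : (0 : ℝ) ≤ 1 / (7 * (N : ℝ) ^ 7) := by positivity
  have h4 := abs_add_le (∑ n ∈ Finset.range N, (-1 : ℝ) ^ n * arccosBracket n
      - (∑ n ∈ Finset.range 9, (-1 : ℝ) ^ n * arccosBracket n + angleExcess 91 - bracketAngle 9)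
      - (-1) ^ N * (angleExcess (N * (N + 1) + 1) - bracketAngle N))
      ((-1) ^ N * (angleExcess (N * (N + 1) + 1) - bracketAngle N))
  rw [sub_add_cancel, abs_mul ((-1) ^ N), abs_pow, abs_neg, abs_one, one_pow, one_mul] at h4
  linarith

/-- The head equals α(1) + 2Σ(−1)^k α(k(k+1)+1) over 1 ≤ k ≤ 8, minus β(9): α(91) cancels and needs
no estimate. The tolerance is twice the sum of the half-widths of the eight enclosures, plus
rounding. -/
lemma abs_sum_arccosBracket_sub_value_le :
    |∑ n ∈ Finset.range 9, (-1 : ℝ) ^ n * arccosBracket n + angleExcess 91 - bracketAngle 9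
      - (Real.pi / 4 - 0.2871297956)| ≤ 0.0000000362 := by
  simp only [Finset.sum_range_succ, Finset.sum_range_zero, arccosBracket_eq, bracketAngle]
  norm_num
  rw [angleExcess_one]
  have l3 : 0.194945369 ≤ angleExcess 3 :=
    le_angleExcess (r := 3.16227766016) (by norm_num) (by norm_num) (by norm_num) (by norm_num)
      (by norm_num)
  have u3 : angleExcess 3 ≤ 0.194945377 :=
    angleExcess_le (r := 3.16227766017) (by norm_num) (by norm_num) (by norm_num) (by norm_num)
      (by norm_num) (by norm_num)
  have l7 : 0.076579669 ≤ angleExcess 7 :=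
    le_angleExcess (r := 7.07106781186) (by norm_num) (by norm_num) (by norm_num) (by norm_num)
      (by norm_num)
  have u7 : angleExcess 7 ≤ 0.076579673 :=
    angleExcess_le (r := 7.07106781187) (by norm_num) (by norm_num) (by norm_num) (by norm_num)
      (by norm_num) (by norm_num)
  have l13 : 0.039949269 ≤ angleExcess 13 :=
    le_angleExcess (r := 13.03840481040) (by norm_num) (by norm_num) (by norm_num) (by norm_num)
      (by norm_num)
  have u13 : angleExcess 13 ≤ 0.039949273 :=
    angleExcess_le (r := 13.03840481041) (by norm_num) (by norm_num) (by norm_num) (by norm_num)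
      (by norm_num) (by norm_num)
  have l21 : 0.024378508 ≤ angleExcess 21 :=
    le_angleExcess (r := 21.02379604162) (by norm_num) (by norm_num) (by norm_num) (by norm_num)
      (by norm_num)
  have u21 : angleExcess 21 ≤ 0.024378512 :=
    angleExcess_le (r := 21.02379604163) (by norm_num) (by norm_num) (by norm_num) (by norm_num)
      (by norm_num) (by norm_num)
  have l31 : 0.016389842 ≤ angleExcess 31 :=
    le_angleExcess (r := 31.01612483854) (by norm_num) (by norm_num) (by norm_num) (by norm_num)
      (by norm_num)
  have u31 : angleExcess 31 ≤ 0.016389846 :=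
    angleExcess_le (r := 31.01612483855) (by norm_num) (by norm_num) (by norm_num) (by norm_num)
      (by norm_num) (by norm_num)
  have l43 : 0.011763366 ≤ angleExcess 43 :=
    le_angleExcess (r := 43.01162633521) (by norm_num) (by norm_num) (by norm_num) (by norm_num)
      (by norm_num)
  have u43 : angleExcess 43 ≤ 0.011763370 :=
    angleExcess_le (r := 43.01162633522) (by norm_num) (by norm_num) (by norm_num) (by norm_num)
      (by norm_num) (by norm_num)
  have l57 : 0.008848984 ≤ angleExcess 57 :=
    le_angleExcess (r := 57.00877125495) (by norm_num) (by norm_num) (by norm_num) (by norm_num)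
      (by norm_num)
  have u57 : angleExcess 57 ≤ 0.008848988 :=
    angleExcess_le (r := 57.00877125496) (by norm_num) (by norm_num) (by norm_num) (by norm_num)
      (by norm_num) (by norm_num)
  have l73 : 0.006896278 ≤ angleExcess 73 :=
    le_angleExcess (r := 73.00684899377) (by norm_num) (by norm_num) (by norm_num) (by norm_num)
      (by norm_num)
  have u73 : angleExcess 73 ≤ 0.006896282 :=
    angleExcess_le (r := 73.00684899378) (by norm_num) (by norm_num) (by norm_num) (by norm_num)
      (by norm_num) (by norm_num)
  rw [abs_le]
  constructor <;> linarith

theorem abs_tsum_arccosBracket_sub_value_lt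
    (hs : Summable fun n : ℕ => (-1 : ℝ) ^ n * arccosBracket n) :
    |24 / Real.pi * (∑' n : ℕ, (-1 : ℝ) ^ n * arccosBracket n) - 3 - 0.80649| < 0.000005 := by
  have h1 := abs_le.1 (abs_tsum_arccosBracket_sub_le hs)
  have h2 := abs_le.1 abs_sum_arccosBracket_sub_value_le
  set S := ∑' n : ℕ, (-1 : ℝ) ^ n * arccosBracket n
  have hl := Real.pi_gt_d20
  have hu := Real.pi_lt_d20
  have hp := Real.pi_pos
  rw [show 24 / Real.pi * S - 3 - 0.80649 = (24 * S - 3.80649 * Real.pi) / Real.pi by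
    field_simp; ring, abs_div, abs_of_pos hp, div_lt_iff₀ hp, abs_lt]
  norm_num at h1
  constructor <;> linarith

theorem abs_two_sub_arccos_sub_value_lt :
    |2 - 6 / Real.pi * Real.arccos (√6 / 3) - 0.8245| < 0.00005 := by
  have hl := Real.pi_gt_d20
  have hu := Real.pi_lt_d20
  have hp := Real.pi_pos
  have h3 : (0 : ℝ) < √3 := by positivity
  have h33 : √3 ^ 2 = (3 : ℝ) := Real.sq_sqrt (by norm_num)
  -- The complementary leg is √(1 − 6/9) = 1/√3, which brings the angle within reach of the arcsine
  -- bounds.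
  have e : Real.arccos (√6 / 3) = Real.arcsin (1 / √3) := by
    rw [Real.arccos_eq_arcsin (by positivity), div_pow, Real.sq_sqrt (by norm_num),
      show (1 : ℝ) - 6 / 3 ^ 2 = 1 / 3 by norm_num, Real.sqrt_div zero_le_one, Real.sqrt_one]
  have s1 : (0.57735026 : ℝ) ≤ 1 / √3 := by
    rw [le_div_iff₀ h3]
    nlinarith
  have s2 : 1 / √3 ≤ (0.57735028 : ℝ) := by
    rw [div_le_iff₀ h3]
    nlinarith
  have h1 : 0.61547 ≤ Real.arcsin (1 / √3) :=
    le_arcsin_of_quintic_le (by norm_num) (by norm_num) (le_trans (by norm_num) s1)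
  have h2 : Real.arcsin (1 / √3) ≤ 0.6155 :=
    arcsin_le_of_le_septic (by norm_num) (by norm_num) (s2.trans (by norm_num))
  rw [e, show 2 - 6 / Real.pi * Real.arcsin (1 / √3) - 0.8245
      = (1.1755 * Real.pi - 6 * Real.arcsin (1 / √3)) / Real.pi by field_simp; ring, abs_div,
    abs_of_pos hp, div_lt_iff₀ hp, abs_lt]
  constructor <;> linarith

end AlternatingSum

/-! ### The theorem -/

theorem proposition1 {Ω : Type*} [MeasurableSpace Ω] (P : Measure Ω) [IsProbabilityMeasure P]
    (W : ℝ≥0 → Ω → ℝ) (hW : IsBrownianReal W P) :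
    -- the copula of the triple exists and does not depend on the time
    (∃ C : (Fin 3 → ℝ) → ℝ, ∀ t : ℝ≥0, 0 < t → IsCopulaOf C (wienerTriple W t) P) ∧
    ∀ C : (Fin 3 → ℝ) → ℝ, (∃ t : ℝ≥0, 0 < t ∧ IsCopulaOf C (wienerTriple W t) P) →
      spearmanRho (marginWM C) = 2 - 6 / Real.pi * Real.arccos (√6 / 3) ∧
      spearmanRho (marginWm C) = 2 - 6 / Real.pi * Real.arccos (√6 / 3) ∧
      |2 - 6 / Real.pi * Real.arccos (√6 / 3) - 0.8245| < 0.00005 ∧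
      Summable (fun n : ℕ => (-1 : ℝ) ^ n * arccosBracket n) ∧
      spearmanRho (marginMm C) =
        24 / Real.pi * (∑' n : ℕ, (-1 : ℝ) ^ n * arccosBracket n) - 3 ∧
      |spearmanRho (marginMm C) - 0.80649| < 0.000005 := by
  obtain ⟨V, hV, -⟩ := exists_isRegularBrownian hW
  refine ⟨?_, ?_⟩
  · obtain ⟨C, hC⟩ := hV.exists_isCopulaOf
    exact ⟨C, fun t ht => (isCopulaOf_wienerTriple_iff hW hV ht).2 hC⟩
  · rintro C ⟨t, ht, hC⟩
    -- A copula at any one time is a copula of the regular version at time 1, so a single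
    -- computation serves all `t` and all `C`.
    replace hC := (isCopulaOf_wienerTriple_iff hW hV ht).1 hC
    have hsum := hasSum_arccosBracket
    have hMm : spearmanRho (marginMm C)
        = 24 / Real.pi * (∑' n : ℕ, (-1 : ℝ) ^ n * arccosBracket n) - 3 := by
      have := Real.pi_pos
      rw [hsum.tsum_eq, spearmanRho_marginMm hV hC]
      field_simp
      ring
    refine ⟨spearmanRho_marginWM hV hC, spearmanRho_marginWm hV hC,
      abs_two_sub_arccos_sub_value_lt, hsum.summable, hMm, ?_⟩
    rw [hMm]
    exact abs_tsum_arccosBracket_sub_value_lt hsum.summable
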